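/- **Setting.** Identify $S^3$ with $SU(2)=\{h(\alpha,\beta)=\begin{pmatrix}\alpha&-\bar\beta\\ \beta&\bar\alpha\end{pmatrix}:|\alpha|^2+|\beta|^2=1\}$, with the round metric of the sphere $2S^3$ of radius $2$, and take $L^2$ with respect to its Riemannian volume (total mass $16\pi^2$). For $\ell\in\frac12\mathbb N$ and $m,s\in\{-\ell,-\ell+1,\dots,\ell\}$ the Wigner functions $D^\ell_{m,s}$ are defined by $$\sum_{m=-\ell}^{\ell}\psi^\ell_m(z)\,D^\ell_{m,s}(g)=\psi^\ell_s(g^{-1}z),\qquad \psi^\ell_m(z_0,z_1)=\tbinom{2\ell}{\ell+m}^{1/2}z_0^{\ell+m}z_1^{\ell-m},$$ and $\phi^\ell_{m,s}=\frac{\sqrt{2\ell+1}}{4\pi}D^\ell_{m,s}$. The spin-$\frac12$ bundle over $S^2\cong\mathbb{CP}^1$ is the tautological line bundle, and for $s\in\frac12\mathbb Z$ the spin-$s$ bundle $\mathcal T^{\otimes s}$ is its tensor power of exponent $2s$ (powers of the dual bundle if $s<0$). A function $F$ on $SU(2)$ is the pullback of a section $\sigma$ of $\mathcal T^{\otimes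 s}$ if $\sigma([\alpha:\beta])=F(g)\,(\alpha,\beta)^{\otimes 2s}$ for all $g=h(\alpha,\beta)$. Let $X:\Omega\times S^3\to\mathbb C$ be a jointly measurable random field on a probability space $(\Omega,P)$ with $X(\omega,\cdot)\in L^2(S^3)$ for almost every $\omega$. Put $$a^\ell_{m,s}=\int_{SU(2)}\overline{\phi^\ell_{m,s}}\,X,\qquad X^\ell_{\bullet,s}=\sum_{m=-\ell}^{\ell}a^\ell_{m,s}\phi^\ell_{m,s},\qquad X^\ell=\sum_{s=-\ell}^{\ell}X^\ell_{\bullet,s}.$$ A collection $(Y_i)_i$ of random fields is jointly left- (right-, bi-) invariant if $(Y_i\circ\varphi)_i$ and $(Y_i)_i$ have the same joint law for every $\varphi$ of the form $x\mapsto g^{-1}x$ (respectively $x\mapsto xg$, $x\mapsto g^{-1}xg'$), $g,g'\in SU(2)$. The joint law is either that of the $Y_i$ as random elements of $L^2(S^3)$ (invariance *in $L^2$-law*) or that given by all joint finite-dimensional distributions (*pointwise* invariance). **Theorem.** 1. The $a^\ell_{m,s}$ are random variables, and almost surely $X=\sum_{\ell\in\frac12\mathbb N}\sum_{s=-\ell}^{\ell}X^\ell_{\bullet,s}$,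 with unconditional convergence in $L^2(S^3)$. 2. Each $X^\ell_{\bullet,s}$ is a jointly measurable random field which is a random harmonic polynomial: for every $\omega$ it is the restriction to $S^3$ of a complex homogeneous harmonic polynomial of degree $2\ell$ on $\mathbb R^4$. It is smooth with $-\Delta_{2S^3}X^\ell_{\bullet,s}=\ell(\ell+1)X^\ell_{\bullet,s}$, and it is the pullback of a random smooth section of the spin-$s$ bundle. 3. For each of the three kinds of invariance (left, right, bi): - $X$ is invariant in $L^2$-law if and only if $(X^\ell)_{\ell}$ is jointly invariant in $L^2$-law, and this holds if and only if $(X^\ell)_\ell$ is jointly pointwise invariant; - if $X$ is pointwise invariant then $(X^\ell)_\ell$ is jointly pointwise invariant, and the converse holds if $X$ is continuous in probability; - if $X$ is invariant in $L^2$-law and $\mathbb E\|X\|^2_{L^2(S^3)}<\infty$, then the fields $X^\ell$ are pairwise uncorrelated: for $\ell\ne\ell'$ and all $x,y\in S^3$, the variables $Z=X^\ell(x)$, $W=X^{\ell'}(y)$ are square integrable and $\mathbb E[(Z-\mathbb EZ)\overline{(W-\mathbb EW)}]=\mathbb E[(Z-\mathbb EZ)(W-\mathbb EW)]=0$. -/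

import Mathlib

open MeasureTheory ProbabilityTheory Filter Topology Function
open scoped TensorProduct ENNReal ComplexConjugate LinearAlgebra.Projectivization

noncomputable section

namespace HypersphereFields

/-! ### The sphere `S³` as the group `SU(2)` -/

/-- `S³`, identified with the group `SU(2)` of the matrices
`h(α, β) = (α, -conj β; β, conj α)`, `|α|² + |β|² = 1`. -/
abbrev SU2 : Type := Matrix.specialUnitaryGroup (Fin 2) ℂ

instance : MeasurableSpace SU2 := borel SU2

instance : BorelSpace SU2 := ⟨rfl⟩

/-- `ℝ⁴` with its Euclidean structure; the coordinates `(x₀, y₀, x₁, y₁)` stand for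
`α = x₀ + i y₀`, `β = x₁ + i y₁`. -/
abbrev E4 : Type := EuclideanSpace ℝ (Fin 4)

theorem mem_SU2 (a b : ℂ) (h : Complex.normSq a + Complex.normSq b = 1) :
    !![a, -conj b; b, conj a] ∈ Matrix.specialUnitaryGroup (Fin 2) ℂ := by
  have h' : a * conj a + b * conj b = 1 := by
    rw [Complex.mul_conj, Complex.mul_conj]; exact_mod_cast h
  rw [Matrix.mem_specialUnitaryGroup_iff, Matrix.mem_unitaryGroup_iff]
  constructor
  · ext i j
    fin_cases i <;> fin_cases j <;>
      simp [Matrix.mul_apply, Fin.sum_univ_two, Matrix.star_apply]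
    · linear_combination h'
    · ring
    · ring
    · linear_combination h'
  · rw [Matrix.det_fin_two_of]
    linear_combination h'

/-- The matrix `h(α, β)` as an element of `SU(2)`. -/
def ofUnit (a b : ℂ) (h : Complex.normSq a + Complex.normSq b = 1) : SU2 :=
  ⟨!![a, -conj b; b, conj a], mem_SU2 a b h⟩

theorem normSq_div_norm (y : E4) (hy : y ≠ 0) :
    Complex.normSq ⟨y 0 / ‖y‖, y 1 / ‖y‖⟩ + Complex.normSq ⟨y 2 / ‖y‖, y 3 / ‖y‖⟩ = 1 := by
  have h0 : ‖y‖ ≠ 0 := norm_ne_zero_iff.mpr hy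
  have h1 : ‖y‖ ^ 2 = y 0 ^ 2 + y 1 ^ 2 + y 2 ^ 2 + y 3 ^ 2 := by
    rw [EuclideanSpace.norm_sq_eq]; simp [Fin.sum_univ_four]
  simp only [Complex.normSq_mk]
  field_simp
  linarith

open Classical in
/-- The radial projection `y ↦ y / |y|` of `ℝ⁴ ∖ {0}` onto `S³ ≅ SU(2)` (junk value `1` at `0`). -/
def radial (y : E4) : SU2 :=
  if hy : y ≠ 0 then
    ofUnit ⟨y 0 / ‖y‖, y 1 / ‖y‖⟩ ⟨y 2 / ‖y‖, y 3 / ‖y‖⟩ (normSq_div_norm y hy)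
  else 1

/-- The unit vector of `ℝ⁴` that corresponds to an element of `SU(2)`. -/
def coords (g : SU2) : E4 :=
  !₂[(g.1 0 0).re, (g.1 0 0).im, (g.1 1 0).re, (g.1 1 0).im]

/-- The Riemannian volume of the round sphere `2S³` of radius `2`, carried over to `SU(2)`:
`2 ^ 3` times the surface measure of the unit sphere of `ℝ⁴` (total mass `16 π²`). -/
def vol : Measure SU2 :=
  (2 ^ 3 : ℝ≥0∞) •
    ((volume : Measure E4).toSphere).map (fun y : Metric.sphere (0 : E4) 1 => radial y)

/-- The Laplace-Beltrami operator of the round sphere `2S³` of radius `2`: the Euclidean Laplacian,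
at the points `2g` of that sphere, of the extension of `f` that is constant along the normal
lines, i.e. along the rays from the origin. -/
def laplaceBeltrami (f : SU2 → ℂ) (g : SU2) : ℂ :=
  Laplacian.laplacian (fun y : E4 => f (radial y)) ((2 : ℝ) • coords g)

/-- `f` is smooth, and `-Δ f = c f` on `2S³`. -/
def IsLaplaceEigenfunction (c : ℝ) (f : SU2 → ℂ) : Prop :=
  ContDiffOn ℝ (⊤ : ℕ∞) (fun y : E4 => f (radial y)) {0}ᶜ ∧ ∀ g, -laplaceBeltrami f g = (c : ℂ) * f g

/-- `f` is the restriction to `S³` of a homogeneous harmonic polynomial of degree `n` on `ℝ⁴`. -/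
def IsHarmonicPolynomial (n : ℕ) (f : SU2 → ℂ) : Prop :=
  ∃ p : MvPolynomial (Fin 4) ℂ, p.IsHomogeneous n ∧
    ∑ i, MvPolynomial.pderiv i (MvPolynomial.pderiv i p) = 0 ∧
    ∀ g, f g = MvPolynomial.eval (fun i => (coords g i : ℂ)) p

/-! ### Wigner functions

The half-integer indices are encoded by `n = 2ℓ`, `j = ℓ + m`, `k = ℓ + s`, where `j, k` run
through `0, …, n`. -/

open Polynomial in
/-- The Wigner function `D^ℓ_{m,s}`. With `g = h(α, β)`, these are the coefficients in
`∑_m ψ_m(z₀, z₁) D^ℓ_{m,s}(g) = ψ_s(g⁻¹ (z₀, z₁))` for the monomials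
`ψ_m = (2ℓ choose ℓ+m)^(1/2) z₀^(ℓ+m) z₁^(ℓ-m)`; here `g⁻¹ (z₀, z₁) =
(conj α z₀ + conj β z₁, -β z₀ + α z₁)`, and `z₁` is set to `1`. -/
def wignerD (n : ℕ) (j k : Fin (n + 1)) (g : SU2) : ℂ :=
  ((Real.sqrt (n.choose k) / Real.sqrt (n.choose j) : ℝ) : ℂ) *
    ((C (conj (g.1 0 0)) * X + C (conj (g.1 1 0))) ^ (k : ℕ) *
      (C (-(g.1 1 0)) * X + C (g.1 0 0)) ^ (n - (k : ℕ)) : ℂ[X]).coeff j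

/-- The hyperspherical harmonic `φ^ℓ_{m,s} = √(2ℓ+1) / (4π) · D^ℓ_{m,s}`. -/
def phi (n : ℕ) (j k : Fin (n + 1)) (g : SU2) : ℂ :=
  ((Real.sqrt (n + 1) / (4 * Real.pi) : ℝ) : ℂ) * wignerD n j k g

/-! ### The components of a random field -/

variable {Ω : Type*}

/-- The random coefficient `a^ℓ_{m,s} = ⟨φ^ℓ_{m,s}, X⟩` in `L²(2S³)`. -/
def fourierCoeff (X : Ω → SU2 → ℂ) (n : ℕ) (j k : Fin (n + 1)) (ω : Ω) : ℂ :=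
  ∫ x, conj (phi n j k x) * X ω x ∂vol

/-- `X^ℓ_{•,s} = ∑_m a^ℓ_{m,s} φ^ℓ_{m,s}`. -/
def columnField (X : Ω → SU2 → ℂ) (n : ℕ) (k : Fin (n + 1)) (ω : Ω) (x : SU2) : ℂ :=
  ∑ j, fourierCoeff X n j k ω * phi n j k x

/-- `X^ℓ = ∑_s X^ℓ_{•,s}`. -/
def degreeField (X : Ω → SU2 → ℂ) (n : ℕ) (ω : Ω) (x : SU2) : ℂ :=
  ∑ k, columnField X n k ω x

/-! ### Spin bundles

The base is `S² ≅ ℂℙ¹`. The spin-`1/2` bundle is the tautological line bundle, whose fibre over a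
line of `ℂ²` is that line, and the spin-`s` bundle is its tensor power of exponent `d = 2s`. -/

/-- The two-dimensional sphere `S² ≅ ℂℙ¹`, the space of lines of `ℂ²`. -/
abbrev RiemannSphere : Type := ℙ ℂ (Fin 2 → ℂ)

/-- The fibre of the spin-`d/2` bundle over the line `p`: `p^{⊗ d}` if `d ≥ 0` and `(p*)^{⊗ (-d)}`
if `d ≤ 0` (the other tensor factor being the zeroth power). -/
abbrev SpinFibre (d : ℤ) (p : RiemannSphere) : Type :=
  (⨂[ℂ]^(d.toNat) p.submodule) ⊗[ℂ] (⨂[ℂ]^((-d).toNat) (Module.Dual ℂ p.submodule))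

/-- A non-zero vector `v` as a vector of the line it spans. -/
def lineVec (v : Fin 2 → ℂ) (hv : v ≠ 0) : (Projectivization.mk ℂ v hv).submodule :=
  ⟨v, by rw [Projectivization.submodule_mk]; exact Submodule.mem_span_singleton_self v⟩

/-- The linear form `v^{⊗ -1}` on the line spanned by `v` that takes the value `1` at `v`. -/
def lineDual (v : Fin 2 → ℂ) (hv : v ≠ 0) :
    Module.Dual ℂ (Projectivization.mk ℂ v hv).submodule where
  toFun w := (star v ⬝ᵥ (w : Fin 2 → ℂ)) / (star v ⬝ᵥ v)
  map_add' w w' := by rw [Submodule.coe_add, dotProduct_add, add_div]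
  map_smul' c w := by
    rw [Submodule.coe_smul, dotProduct_smul, smul_eq_mul, mul_div_assoc, RingHom.id_apply, smul_eq_mul]

open scoped ComplexOrder in
theorem lineDual_lineVec (v : Fin 2 → ℂ) (hv : v ≠ 0) : lineDual v hv (lineVec v hv) = 1 := by
  have h : star v ⬝ᵥ v ≠ 0 := by
    rwa [Ne, dotProduct_star_self_eq_zero]
  exact div_self h

/-- The frame `v^{⊗ d}`, `d ∈ ℤ`, of the fibre over the line spanned by `v`. -/
def vecPow (d : ℤ) (v : Fin 2 → ℂ) (hv : v ≠ 0) : SpinFibre d (Projectivization.mk ℂ v hv) :=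
  PiTensorProduct.tprod ℂ (fun _ => lineVec v hv) ⊗ₜ[ℂ]
    PiTensorProduct.tprod ℂ (fun _ => lineDual v hv)

theorem vec_ne_zero_right (z : ℂ) : (![z, 1] : Fin 2 → ℂ) ≠ 0 := fun h => by
  simpa using congrFun h 1

theorem vec_ne_zero_left (z : ℂ) : (![1, z] : Fin 2 → ℂ) ≠ 0 := fun h => by
  simpa using congrFun h 0

/-- A random (smooth) section of the spin-`d/2` bundle: in the two standard trivializations, over
`{z₁ ≠ 0}` with coordinate `ζ = z₀ / z₁` and frame `(ζ, 1)^{⊗ d}` and over `{z₀ ≠ 0}` with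
coordinate `η = z₁ / z₀` and frame `(1, η)^{⊗ d}`, its component is jointly measurable, and smooth
in the real sense for every `ω`. -/
def IsRandomSection [MeasurableSpace Ω] (d : ℤ)
    (σ : Ω → (p : RiemannSphere) → SpinFibre d p) : Prop :=
  (∃ c : Ω → ℂ → ℂ, Measurable (uncurry c) ∧ (∀ ω, ContDiff ℝ (⊤ : ℕ∞) (c ω)) ∧
    ∀ ω ζ, σ ω (Projectivization.mk ℂ ![ζ, 1] (vec_ne_zero_right ζ)) =
      c ω ζ • vecPow d ![ζ, 1] (vec_ne_zero_right ζ)) ∧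
  (∃ c : Ω → ℂ → ℂ, Measurable (uncurry c) ∧ (∀ ω, ContDiff ℝ (⊤ : ℕ∞) (c ω)) ∧
    ∀ ω η, σ ω (Projectivization.mk ℂ ![1, η] (vec_ne_zero_left η)) =
      c ω η • vecPow d ![1, η] (vec_ne_zero_left η))

/-- The vector `τ_g = (α, β) ∈ ℂ²` of `g = h(α, β)`. -/
def tau (g : SU2) : Fin 2 → ℂ := fun i => g.1 i 0

theorem tau_ne_zero (g : SU2) : tau g ≠ 0 := by
  intro h
  have h0 : g.1 0 0 = 0 := congrFun h 0
  have h1 : g.1 1 0 = 0 := congrFun h 1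
  have hd : g.1.det = 1 := (Matrix.mem_specialUnitaryGroup_iff.mp g.2).2
  rw [Matrix.det_fin_two, h0, h1] at hd
  simp at hd

/-- The Hopf map `g ↦ g · ∞ = [α : β]`. -/
def hopf (g : SU2) : RiemannSphere := Projectivization.mk ℂ (tau g) (tau_ne_zero g)

/-- `F : SU(2) → ℂ` is the pullback of the section `σ` of the spin-`d/2` bundle:
`σ (g · ∞) = F(g) τ_g^{⊗ d}` for all `g`. -/
def IsPullback (d : ℤ) (σ : (p : RiemannSphere) → SpinFibre d p) (F : SU2 → ℂ) : Prop :=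
  ∀ g, σ (hopf g) = F g • vecPow d (tau g) (tau_ne_zero g)

/-! ### Invariance in law -/

/-- The three kinds of invariance. -/
inductive Side
  | left
  | right
  | bi

/-- The transformations of `S³` of a given kind. -/
def translations : Side → Set (SU2 → SU2)
  | .left => {φ | ∃ g : SU2, φ = fun x => g⁻¹ * x}
  | .right => {φ | ∃ g : SU2, φ = fun x => x * g}
  | .bi => {φ | ∃ g g' : SU2, φ = fun x => g⁻¹ * x * g'}

instance : MeasurableSpace (Lp ℂ 2 vol) := borel _

instance : BorelSpace (Lp ℂ 2 vol) := ⟨rfl⟩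

open Classical in
/-- The class in `L²(2S³)` of a square integrable function (`0` for other functions). -/
def l2Class (f : SU2 → ℂ) : Lp ℂ 2 vol :=
  if h : MemLp f 2 vol then h.toLp f else 0

/-- Joint invariance in law of a collection of random fields with paths in `L²(2S³)`, considered as
random elements of `L²(2S³)`. -/
def InvariantInLaw [MeasurableSpace Ω] {ι : Type*} (side : Side) (P : Measure Ω)
    (Y : ι → Ω → SU2 → ℂ) : Prop :=
  ∀ φ ∈ translations side,
    IdentDistrib (fun ω i => l2Class (fun x => Y i ω (φ x))) (fun ω i => l2Class (Y i ω)) P P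

/-- Joint invariance in law of a collection of random fields, considered as random functions: the
laws on the space of functions with the product σ-algebra, that is, all joint finite-dimensional
distributions, agree. -/
def InvariantPointwise [MeasurableSpace Ω] {ι : Type*} (side : Side) (P : Measure Ω)
    (Y : ι → Ω → SU2 → ℂ) : Prop :=
  ∀ φ ∈ translations side,
    IdentDistrib (fun ω (q : ι × SU2) => Y q.1 ω (φ q.2)) (fun ω (q : ι × SU2) => Y q.1 ω q.2) P P

/-- Two square integrable complex random variables are uncorrelated: their covariance and their
pseudo-covariance vanish, that is, the real and imaginary parts of the one are uncorrelated with
those of the other. -/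
def Uncorrelated [MeasurableSpace Ω] (P : Measure Ω) (Z W : Ω → ℂ) : Prop :=
  MemLp Z 2 P ∧ MemLp W 2 P ∧
    ∫ ω, (Z ω - ∫ ω', Z ω' ∂P) * conj (W ω - ∫ ω', W ω' ∂P) ∂P = 0 ∧
    ∫ ω, (Z ω - ∫ ω', Z ω' ∂P) * (W ω - ∫ ω', W ω' ∂P) ∂P = 0

end HypersphereFields

end

open HypersphereFields

noncomputable section

namespace HypersphereFields

/-! ### Matrix entries of elements of `SU(2)` -/

/-! The functions `wignerD n j k` are the matrix entries of the unitary representation of `SU(2)` on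
binary forms of degree `n`, and the proof is harmonic analysis on this compact group.

Composition of linear substitutions gives multiplicativity (`wignerD_mul`), the binomial norming
gives unitarity (`wignerD_inv`), and invariance of the volume with Schur's lemma gives
orthogonality. Multiplying a matrix entry of degree `n` by an entry of `g` gives entries of degrees
`n + 1` and `n - 1`, so the span of all of them contains the polynomial functions, and
Stone-Weierstrass makes `harmBasis` a Hilbert basis. Grouping the expansion of a path in this basis
gives the unconditional convergence.

For fixed `z`, the value at `z` of `wignerPoly n k g` is a product of powers of two linear forms
spanning an isotropic plane, hence a harmonic polynomial; the Laplace eigenvalue follows from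
Euler's identity. The right torus action multiplies column `k` by a character, which is exactly the
condition for descending along the Hopf map to a section of the spin bundle.

The projection onto degree `n` is convolution with a character. A character is a class function, so
the projection commutes with translations from both sides (`degSum_coef_bi`). Both the path in `L²`
and its components are injective, measurable images of the Fourier coefficients, so the invariance
in law of `X` and the two invariances of its components all amount to invariance of the joint law of
the coefficients.

Pointwise laws see only finitely many values of `X` at a time, while a coefficient is an integral.
The strong law of large numbers bridges this: averages over independent random points of the sphere
involve finitely many values and converge to the coefficient. Conversely, partial sums converge to
`X` almost surely at almost every point along a subsequence, and continuity in probability reaches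
the remaining points.

Finally, under invariance a covariance between degrees `n ≠ n'` is unchanged by translating both
points by `g`. As a function of `g` it is a combination of products of matrix entries of the two
degrees, whose integral is zero; being constant, it vanishes. -/

theorem inv_coe (g : SU2) : (g⁻¹ : SU2).1 = star g.1 := rfl

/-- Column orthonormality and `det = 1` form a linear system that determines the second column from
the first. -/
theorem entries (g : SU2) :
    g.1 0 1 = -conj (g.1 1 0) ∧ g.1 1 1 = conj (g.1 0 0) ∧
      g.1 0 0 * conj (g.1 0 0) + g.1 1 0 * conj (g.1 1 0) = 1 := by
  obtain ⟨hu, hd⟩ := Matrix.mem_specialUnitaryGroup_iff.mp g.2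
  have h1 := Matrix.mem_unitaryGroup_iff'.mp hu
  have h00 := congrFun (congrFun h1 0) 0
  have h01 := congrFun (congrFun h1 0) 1
  simp [Matrix.mul_apply, Fin.sum_univ_two, Matrix.star_apply] at h00 h01
  rw [Matrix.det_fin_two] at hd
  refine ⟨?_, ?_, ?_⟩
  · linear_combination (-conj (g.1 1 0)) * hd - (g.1 0 1) * h00 + g.1 0 0 * h01
  · linear_combination (conj (g.1 0 0)) * hd - (g.1 1 1) * h00 + g.1 1 0 * h01
  · linear_combination h00

theorem ext_iff_col {g h : SU2} (h0 : g.1 0 0 = h.1 0 0) (h1 : g.1 1 0 = h.1 1 0) : g = h := by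
  obtain ⟨a1, a2, -⟩ := entries g
  obtain ⟨b1, b2, -⟩ := entries h
  apply Subtype.ext
  ext i j
  fin_cases i <;> fin_cases j <;> simp [a1, a2, b1, b2, h0, h1]

theorem mul_entry_zero (g h : SU2) :
    (g * h).1 0 0 = g.1 0 0 * h.1 0 0 - conj (g.1 1 0) * h.1 1 0 := by
  change (g.1 * h.1) 0 0 = _
  rw [Matrix.mul_apply, Fin.sum_univ_two, (entries g).1]; ring

theorem mul_entry_one (g h : SU2) :
    (g * h).1 1 0 = g.1 1 0 * h.1 0 0 + conj (g.1 0 0) * h.1 1 0 := by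
  change (g.1 * h.1) 1 0 = _
  rw [Matrix.mul_apply, Fin.sum_univ_two, (entries g).2.1]

theorem inv_entry_zero (g : SU2) : (g⁻¹ : SU2).1 0 0 = conj (g.1 0 0) := by
  rw [inv_coe, Matrix.star_apply]; rfl

theorem inv_entry_one (g : SU2) : (g⁻¹ : SU2).1 1 0 = -g.1 1 0 := by
  rw [inv_coe, Matrix.star_apply, (entries g).1]; simp

/-! ### Wigner functions as coefficients of polynomials -/

open Polynomial

/-! ### Substitution in binary forms -/

theorem coeff_linear_mul (a b : ℂ) (p : ℂ[X]) (l : ℕ) :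
    ((C a * X + C b) * p).coeff (l + 1) = a * p.coeff l + b * p.coeff (l + 1) := by
  rw [add_mul, mul_assoc, coeff_add, coeff_C_mul, coeff_C_mul, coeff_X_mul]

theorem coeff_linear_mul_zero (a b : ℂ) (p : ℂ[X]) :
    ((C a * X + C b) * p).coeff 0 = b * p.coeff 0 := by
  rw [add_mul, mul_assoc, coeff_add, coeff_C_mul, coeff_C_mul, coeff_X_mul_zero]; ring

/-- The homogeneous form of degree `n` attached to a polynomial, evaluated in an algebra. -/
def homEval {R : Type*} [CommRing R] [Algebra ℂ R] (u v : R) (n : ℕ) (p : ℂ[X]) : R :=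
  ∑ l ∈ Finset.range (n + 1), algebraMap ℂ R (p.coeff l) * (u ^ l * v ^ (n - l))

theorem homEval_linear_mul {R : Type*} [CommRing R] [Algebra ℂ R] (u v : R) (n : ℕ) (p : ℂ[X])
    (hp : p.natDegree ≤ n) (a b : ℂ) :
    homEval u v (n + 1) ((C a * X + C b) * p) =
      (algebraMap ℂ R a * u + algebraMap ℂ R b * v) * homEval u v n p := by
  have hz : p.coeff (n + 1) = 0 := coeff_eq_zero_of_natDegree_lt (by omega)
  have e1 : ∑ l ∈ Finset.range (n + 1),
      algebraMap ℂ R (p.coeff (l + 1)) * (u ^ (l + 1) * v ^ (n - l)) +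
        algebraMap ℂ R (p.coeff 0) * v ^ (n + 1) = v * homEval u v n p := by
    have := Finset.sum_range_succ'
      (fun l => algebraMap ℂ R (p.coeff l) * (u ^ l * v ^ (n + 1 - l))) (n + 1)
    rw [Finset.sum_range_succ] at this
    simp only [hz, map_zero, zero_mul, add_zero, pow_zero, one_mul, Nat.sub_zero,
      Nat.add_sub_add_right] at this
    rw [← this, homEval, Finset.mul_sum]
    refine Finset.sum_congr rfl fun l hl => ?_
    rw [show n + 1 - l = (n - l) + 1 by have := Finset.mem_range.mp hl; omega]
    ring
  have e2 : (algebraMap ℂ R a * u + algebraMap ℂ R b * v) * homEval u v n p =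
      algebraMap ℂ R a * (u * homEval u v n p) + algebraMap ℂ R b * (v * homEval u v n p) := by
    ring
  rw [e2, ← e1, mul_add, homEval, homEval, Finset.sum_range_succ', Finset.mul_sum, Finset.mul_sum,
    Finset.mul_sum, ← add_assoc, ← Finset.sum_add_distrib]
  congr 1
  · refine Finset.sum_congr rfl fun l _ => ?_
    rw [coeff_linear_mul, map_add, map_mul, map_mul, Nat.add_sub_add_right]
    ring
  · rw [coeff_linear_mul_zero, map_mul]; simp [mul_assoc]

theorem natDegree_linear_pow (a b : ℂ) (k : ℕ) : ((C a * X + C b) ^ k).natDegree ≤ k := by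
  refine natDegree_pow_le.trans ?_
  simpa using Nat.mul_le_mul_left k (natDegree_linear_le (a := a) (b := b))

theorem homEval_linear_pow_mul {R : Type*} [CommRing R] [Algebra ℂ R] (u v : R)
    (a b : ℂ) (k n : ℕ) (p : ℂ[X]) (hp : p.natDegree ≤ n) :
    homEval u v (k + n) ((C a * X + C b) ^ k * p) =
      (algebraMap ℂ R a * u + algebraMap ℂ R b * v) ^ k * homEval u v n p := by
  induction k with
  | zero => simp
  | succ k ih =>
    rw [pow_succ', mul_assoc, show k + 1 + n = (k + n) + 1 by ring, homEval_linear_mul, ih,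
      pow_succ', mul_assoc]
    exact natDegree_mul_le.trans (add_le_add (natDegree_linear_pow a b k) hp)

/-- Homogenization is compatible with products of linear factors. The values `u`, `v` may lie in any
algebra; the choice `u = polyA g`, `v = polyB g` turns this into the composition law of the
representation. -/
theorem homEval_linear_prod {R : Type*} [CommRing R] [Algebra ℂ R] (u v : R)
    (a b c d : ℂ) (k m : ℕ) :
    homEval u v (k + m) ((C a * X + C b) ^ k * (C c * X + C d) ^ m) =
      (algebraMap ℂ R a * u + algebraMap ℂ R b * v) ^ k *
        (algebraMap ℂ R c * u + algebraMap ℂ R d * v) ^ m := by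
  rw [homEval_linear_pow_mul _ _ _ _ _ _ _ (natDegree_linear_pow c d m)]
  congr 1
  have := homEval_linear_pow_mul u v c d m 0 1 (by simp)
  simpa [homEval] using this

/-- The first component of `g⁻¹ (z, 1)`, as a polynomial in `z`. -/
def polyA (g : SU2) : ℂ[X] := C (conj (g.1 0 0)) * X + C (conj (g.1 1 0))

/-- The second component of `g⁻¹ (z, 1)`, as a polynomial in `z`. -/
def polyB (g : SU2) : ℂ[X] := C (-(g.1 1 0)) * X + C (g.1 0 0)

/-- The image of the monomial `z₀ ^ k z₁ ^ (n - k)` under `g`, at `z₁ = 1`. -/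
def wignerPoly (n k : ℕ) (g : SU2) : ℂ[X] := polyA g ^ k * polyB g ^ (n - k)

theorem natDegree_wignerPoly {n k : ℕ} (hk : k ≤ n) (g : SU2) :
    (wignerPoly n k g).natDegree ≤ n :=
  (natDegree_mul_le.trans (add_le_add (natDegree_linear_pow _ _ k)
    (natDegree_linear_pow _ _ (n - k)))).trans (by omega)

/-- The norming factor of the monomials. -/
def normFactor (n k : ℕ) : ℂ := ((Real.sqrt (n.choose k) : ℝ) : ℂ)

theorem normFactor_ne_zero {n : ℕ} (k : Fin (n + 1)) : normFactor n k ≠ 0 := by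
  have : 0 < n.choose k := Nat.choose_pos (Nat.lt_succ_iff.mp k.2)
  rw [normFactor, Complex.ofReal_ne_zero]
  exact (Real.sqrt_pos.mpr (by exact_mod_cast this)).ne'

theorem normFactor_sq (n k : ℕ) : normFactor n k ^ 2 = (n.choose k : ℂ) := by
  rw [normFactor, ← Complex.ofReal_pow, Real.sq_sqrt (by positivity)]; simp

theorem wignerD_eq (n : ℕ) (j k : Fin (n + 1)) (g : SU2) :
    wignerD n j k g = normFactor n k / normFactor n j * (wignerPoly n k g).coeff j := by
  simp only [wignerD, wignerPoly, polyA, polyB, normFactor, Complex.ofReal_div]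

theorem conj_normFactor (n k : ℕ) : conj (normFactor n k) = normFactor n k := Complex.conj_ofReal _

/-- Since `(gh)⁻¹ = h⁻¹ g⁻¹`, the components of `(gh)⁻¹ z` are the linear forms of `h⁻¹` evaluated
at the components of `g⁻¹ z`. -/
theorem polyA_mul (g h : SU2) :
    polyA (g * h) = C (conj (h.1 0 0)) * polyA g + C (conj (h.1 1 0)) * polyB g := by
  simp only [polyA, polyB, mul_entry_zero, mul_entry_one, map_add, map_sub, map_mul, map_neg,
    Complex.conj_conj]
  ring

theorem polyB_mul (g h : SU2) :
    polyB (g * h) = C (-(h.1 1 0)) * polyA g + C (h.1 0 0) * polyB g := by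
  simp only [polyA, polyB, mul_entry_zero, mul_entry_one, map_add, map_sub, map_mul, map_neg]
  ring

theorem wignerPoly_mul {n k : ℕ} (hk : k ≤ n) (g h : SU2) :
    wignerPoly n k (g * h) =
      ∑ l ∈ Finset.range (n + 1), C ((wignerPoly n k h).coeff l) * wignerPoly n l g := by
  have := homEval_linear_prod (polyA g) (polyB g) (conj (h.1 0 0)) (conj (h.1 1 0))
    (-(h.1 1 0)) (h.1 0 0) k (n - k)
  rw [Nat.add_sub_cancel' hk] at this
  rw [wignerPoly, polyA_mul, polyB_mul]
  exact this.symm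

theorem wignerD_mul (n : ℕ) (j k : Fin (n + 1)) (g h : SU2) :
    wignerD n j k (g * h) = ∑ l, wignerD n j l g * wignerD n l k h := by
  simp only [wignerD_eq]
  rw [wignerPoly_mul (Nat.lt_succ_iff.mp k.2), finsetSum_coeff, Finset.sum_range, Finset.mul_sum]
  refine Finset.sum_congr rfl fun l _ => ?_
  rw [coeff_C_mul]
  have := normFactor_ne_zero l
  have := normFactor_ne_zero j
  field_simp

theorem wignerPoly_one (n k : ℕ) : wignerPoly n k 1 = X ^ k := by
  simp [wignerPoly, polyA, polyB]

theorem wignerD_one (n : ℕ) (j k : Fin (n + 1)) : wignerD n j k 1 = if j = k then 1 else 0 := by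
  rw [wignerD_eq, wignerPoly_one, coeff_X_pow]
  simp only [Fin.val_inj]
  split_ifs with h
  · subst h; simp [normFactor_ne_zero]
  · simp

/-- The generating function `(y A + B) ^ n`, with `A = polyA g` and `B = polyB g`, is expanded in
two ways: by powers of `y`, and by powers of `X` after regrouping `y A + B` as a linear polynomial
in `X`. The coefficients in the second grouping are the conjugated components of the inverse. The
binomial weights appearing here are why the monomials carry the factor `normFactor`. -/
theorem choose_mul_coeff_wignerPoly (n j k : ℕ) (hj : j ≤ n) (hk : k ≤ n) (g : SU2) :
    (n.choose k : ℂ) * (wignerPoly n k g).coeff j =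
      n.choose j * conj ((wignerPoly n j g⁻¹).coeff k) := by
  set q : ℂ[X] := (wignerPoly n j g⁻¹).map (starRingEnd ℂ) with hq
  have hqd : q.natDegree ≤ n := natDegree_map_le.trans (natDegree_wignerPoly hj _)
  have key : ∑ l ∈ Finset.range (n + 1), C ((n.choose l : ℂ) * (wignerPoly n l g).coeff j) * X ^ l =
      C (n.choose j : ℂ) * q := by
    -- Evaluating at a number `y` leaves a single polynomial variable, in which the coefficient of
    -- `X ^ j` is compared.
    refine Polynomial.funext fun y => ?_
    have e1 : (C (conj (g.1 0 0) * y - g.1 1 0) * X + C (conj (g.1 1 0) * y + g.1 0 0)) ^ n =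
        ∑ l ∈ Finset.range (n + 1), C ((n.choose l : ℂ) * y ^ l) * wignerPoly n l g := by
      have : C (conj (g.1 0 0) * y - g.1 1 0) * X + C (conj (g.1 1 0) * y + g.1 0 0) =
          C y * polyA g + polyB g := by
        simp only [polyA, polyB, map_add, map_sub, map_mul, map_neg]; ring
      rw [this, add_pow]
      refine Finset.sum_congr rfl fun l _ => ?_
      rw [wignerPoly, mul_pow, map_mul, map_pow, map_natCast]; ring
    have e2 := congrArg (fun p : ℂ[X] => p.coeff j) e1
    simp only [finsetSum_coeff, coeff_C_mul] at e2
    simp only [eval_finsetSum, eval_mul, eval_C, eval_pow, eval_X]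
    have e3 : (C (conj (g.1 0 0) * y - g.1 1 0) * X + C (conj (g.1 1 0) * y + g.1 0 0)) ^ n =
        ∑ m ∈ Finset.range (n + 1), C ((conj (g.1 0 0) * y - g.1 1 0) ^ m *
          (conj (g.1 1 0) * y + g.1 0 0) ^ (n - m) * n.choose m) * X ^ m := by
      rw [add_pow]
      refine Finset.sum_congr rfl fun l _ => ?_
      simp only [map_mul, map_pow, map_natCast, mul_pow]; ring
    rw [e3] at e2
    simp only [finsetSum_coeff, coeff_C_mul, coeff_X_pow, mul_ite, mul_one, mul_zero,
      Finset.sum_ite_eq, Finset.mem_range, Nat.lt_succ_iff, hj, if_true] at e2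
    have e4 : q.eval y = (conj (g.1 0 0) * y - g.1 1 0) ^ j *
        (conj (g.1 1 0) * y + g.1 0 0) ^ (n - j) := by
      rw [hq, wignerPoly, polyA, polyB, inv_entry_zero, inv_entry_one]
      simp [sub_eq_add_neg]
    rw [e4, mul_comm, e2]
    exact Finset.sum_congr rfl fun l _ => by ring
  have := congrArg (fun p : ℂ[X] => p.coeff k) key
  simp only [finsetSum_coeff, coeff_C_mul, coeff_X_pow, mul_ite, mul_one, mul_zero,
    Finset.sum_ite_eq, Finset.mem_range, Nat.lt_succ_iff, hk, if_true, hq, coeff_map] at this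
  exact this

theorem wignerD_inv (n : ℕ) (j k : Fin (n + 1)) (g : SU2) :
    wignerD n j k g⁻¹ = conj (wignerD n k j g) := by
  have h := choose_mul_coeff_wignerPoly n k j (Nat.lt_succ_iff.mp k.2) (Nat.lt_succ_iff.mp j.2) g
  rw [← normFactor_sq, ← normFactor_sq] at h
  have h' := congrArg (starRingEnd ℂ) h
  simp only [map_mul, map_pow, conj_normFactor, Complex.conj_conj] at h'
  have := normFactor_ne_zero k
  have := normFactor_ne_zero j
  simp only [wignerD_eq, map_mul, map_div₀, conj_normFactor]
  field_simp
  linear_combination -h'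

theorem wignerD_mul_inv (n : ℕ) (j k : Fin (n + 1)) (g h : SU2) :
    wignerD n j k (g * h⁻¹) = ∑ l, wignerD n j l g * conj (wignerD n k l h) := by
  simp only [wignerD_mul, wignerD_inv]

theorem wignerD_inv_mul (n : ℕ) (j k : Fin (n + 1)) (g h : SU2) :
    wignerD n j k (g⁻¹ * h) = ∑ l, conj (wignerD n l j g) * wignerD n l k h := by
  simp only [wignerD_mul, wignerD_inv]

/-- The element `h(0, 1)` of `SU(2)`. -/
def weyl : SU2 := ofUnit 0 1 (by simp)

theorem weyl_conj_entry (g : SU2) : (weyl * g * weyl⁻¹).1 0 0 = conj (g.1 0 0) ∧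
    (weyl * g * weyl⁻¹).1 1 0 = conj (g.1 1 0) := by
  have h0 : weyl.1 0 0 = 0 := rfl
  have h1 : weyl.1 1 0 = 1 := rfl
  simp only [mul_entry_zero, mul_entry_one, inv_entry_zero, inv_entry_one, h0, h1]
  simp

/-- Conjugation by `weyl` conjugates the entries of `g`, and the coefficients of `wignerPoly` are
polynomials with real coefficients in these entries and their conjugates. Thus the representation is
equivalent to its conjugate; this later makes the span stable under `star` and lets
pseudo-covariances be treated like covariances. -/
theorem conj_wignerD_eq (n : ℕ) (j k : Fin (n + 1)) (g : SU2) :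
    conj (wignerD n j k g) = wignerD n j k (weyl * g * weyl⁻¹) := by
  simp only [wignerD_eq, map_mul, map_div₀, conj_normFactor]
  rw [← coeff_map]
  simp [wignerPoly, polyA, polyB, weyl_conj_entry]

theorem conj_wignerD (n : ℕ) (j k : Fin (n + 1)) (g : SU2) :
    conj (wignerD n j k g) =
      ∑ l, ∑ m, wignerD n j m weyl * wignerD n l k weyl⁻¹ * wignerD n m l g := by
  rw [conj_wignerD_eq]
  simp only [wignerD_mul, Finset.sum_mul]
  exact Finset.sum_congr rfl fun l _ => Finset.sum_congr rfl fun m _ => by ring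

/-! ### Clebsch-Gordan relations with the entries of `g` -/

/-- This is the second coordinate of `g (g⁻¹ (z, 1)) = (z, 1)`. -/
theorem unit_relation (g : SU2) : C (g.1 1 0) * polyA g + C (conj (g.1 0 0)) * polyB g = 1 := by
  have h := congrArg (C : ℂ → ℂ[X]) (entries g).2.2
  simp only [map_add, map_mul, map_one] at h
  simp only [polyA, polyB, map_neg]
  linear_combination h

theorem derivative_polyA (g : SU2) : derivative (polyA g) = C (conj (g.1 0 0)) := by
  simp [polyA]

theorem derivative_polyB (g : SU2) : derivative (polyB g) = -C (g.1 1 0) := by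
  simp [polyB]

/-- By the product rule, the left side collapses to `k A ^ (k - 1) B ^ (n - k)` times the expression
of `unit_relation`. Read by coefficients, multiplication by `g.1 1 0` changes the degree by one in
either direction. For `k = 0` the truncated indices on the right are harmless, since the factor `k`
vanishes. -/
theorem derivative_wignerPoly_succ {n k : ℕ} (hk : k ≤ n) (g : SU2) :
    derivative (wignerPoly (n + 1) k g) + (n + 1 : ℂ[X]) * C (g.1 1 0) * wignerPoly n k g =
      (k : ℂ[X]) * wignerPoly (n - 1) (k - 1) g := by
  obtain ⟨m, rfl⟩ := Nat.exists_eq_add_of_le hk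
  have hu := unit_relation g
  rcases k with _ | k
  · simp only [wignerPoly, pow_zero, one_mul, Nat.sub_zero, derivative_pow_succ, derivative_polyB,
      zero_add, map_add, map_natCast, map_one]
    push_cast
    ring
  · simp only [wignerPoly, derivative_mul, derivative_polyB, derivative_polyA,
      show k + 1 + m + 1 - (k + 1) = m + 1 by omega, show k + 1 + m - (k + 1) = m by omega,
      show k + 1 + m - 1 - k = m by omega, Nat.add_sub_cancel, derivative_pow_succ,
      map_add, map_natCast, map_one]
    push_cast
    linear_combination (k + 1 : ℂ[X]) * (polyA g ^ k * polyB g ^ m) * hu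

/-- As `B = g₀₀ - g₁₀ X`, multiplication by `g₀₀` reduces to multiplication by `B`, which raises the
degree, and to the preceding relation for `g₁₀`. -/
theorem entry_zero_mul_wignerPoly {n k : ℕ} (hk : k ≤ n) (g : SU2) :
    (n + 1 : ℂ[X]) * C (g.1 0 0) * wignerPoly n k g =
      (n + 1 : ℂ[X]) * wignerPoly (n + 1) k g - X * derivative (wignerPoly (n + 1) k g) +
        (k : ℂ[X]) * (X * wignerPoly (n - 1) (k - 1) g) := by
  have h1 : wignerPoly (n + 1) k g = polyB g * wignerPoly n k g := by
    rw [wignerPoly, wignerPoly, show n + 1 - k = (n - k) + 1 by omega, pow_succ]; ring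
  have h2 : polyB g = C (g.1 0 0) - C (g.1 1 0) * X := by
    simp only [polyB, map_neg]; ring
  have h3 := derivative_wignerPoly_succ hk g
  have h4 : (n + 1 : ℂ[X]) * wignerPoly (n + 1) k g =
      (n + 1 : ℂ[X]) * ((C (g.1 0 0) - C (g.1 1 0) * X) * wignerPoly n k g) := by rw [h1, h2]
  linear_combination X * h3 - h4

end HypersphereFields

end

noncomputable section

namespace HypersphereFields

/-! ### The sphere and its volume -/

theorem normSq_entries (g : SU2) : Complex.normSq (g.1 0 0) + Complex.normSq (g.1 1 0) = 1 := by
  have h := (entries g).2.2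
  rw [Complex.mul_conj, Complex.mul_conj] at h
  exact_mod_cast h

theorem norm_sq_eq_sum (y : E4) : ‖y‖ ^ 2 = y 0 ^ 2 + y 1 ^ 2 + y 2 ^ 2 + y 3 ^ 2 := by
  rw [EuclideanSpace.norm_sq_eq]; simp [Fin.sum_univ_four]

theorem norm_coords (g : SU2) : ‖coords g‖ = 1 := by
  have h : ‖coords g‖ ^ 2 = 1 := by
    have := normSq_entries g
    simp only [Complex.normSq_apply] at this
    rw [norm_sq_eq_sum]
    simp [coords]
    linarith
  rw [← Real.sqrt_sq (norm_nonneg (coords g)), h, Real.sqrt_one]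

theorem coords_ne_zero (g : SU2) : coords g ≠ 0 := by
  rw [← norm_ne_zero_iff, norm_coords]; exact one_ne_zero

theorem radial_entry_zero {y : E4} (hy : y ≠ 0) :
    (radial y).1 0 0 = ⟨y 0 / ‖y‖, y 1 / ‖y‖⟩ := by
  rw [radial, dif_pos hy]; rfl

theorem radial_entry_one {y : E4} (hy : y ≠ 0) :
    (radial y).1 1 0 = ⟨y 2 / ‖y‖, y 3 / ‖y‖⟩ := by
  rw [radial, dif_pos hy]; rfl

theorem coords_radial {y : E4} (hy : y ≠ 0) : coords (radial y) = ‖y‖⁻¹ • y := by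
  ext i
  fin_cases i <;>
    simp [coords, radial_entry_zero hy, radial_entry_one hy, div_eq_inv_mul]

theorem radial_smul_coords {c : ℝ} (hc : 0 < c) (g : SU2) : radial (c • coords g) = g := by
  have h : c • coords g ≠ 0 := smul_ne_zero hc.ne' (coords_ne_zero g)
  have hn : ‖c • coords g‖ = c := by rw [norm_smul, norm_coords, mul_one, Real.norm_of_nonneg hc.le]
  apply ext_iff_col
  · rw [radial_entry_zero h, hn]
    apply Complex.ext <;> simp [coords, hc.ne']
  · rw [radial_entry_one h, hn]
    apply Complex.ext <;> simp [coords, hc.ne']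

theorem radial_coords (g : SU2) : radial (coords g) = g := by
  simpa using radial_smul_coords one_pos g

theorem continuous_entry (i j : Fin 2) : Continuous fun g : SU2 => g.1 i j :=
  continuous_subtype_val.matrix_elem i j

theorem continuous_to_SU2 {T : Type*} [TopologicalSpace T] {f : T → SU2}
    (h0 : Continuous fun t => (f t).1 0 0) (h1 : Continuous fun t => (f t).1 1 0) :
    Continuous f := by
  refine Continuous.subtype_mk (continuous_matrix fun i j => ?_) fun t => (f t).2
  fin_cases i <;> fin_cases j
  · exact h0
  · simp only [Fin.mk_one, Fin.zero_eta, (entries _).1]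
    exact (Complex.continuous_conj.comp h1).neg
  · exact h1
  · simp only [Fin.mk_one, (entries _).2.1]
    exact Complex.continuous_conj.comp h0

theorem sphere_ne_zero (y : Metric.sphere (0 : E4) 1) : (y : E4) ≠ 0 :=
  norm_ne_zero_iff.mp (by rw [norm_eq_of_mem_sphere]; exact one_ne_zero)

theorem continuous_radial_sphere :
    Continuous fun y : Metric.sphere (0 : E4) 1 => radial y := by
  have hc (i : Fin 4) : Continuous fun y : Metric.sphere (0 : E4) 1 => (y : E4) i :=
    (EuclideanSpace.proj (𝕜 := ℝ) i).continuous.comp continuous_subtype_val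
  have hm (i j : Fin 4) : Continuous fun y : Metric.sphere (0 : E4) 1 =>
      (⟨(y : E4) i, (y : E4) j⟩ : ℂ) :=
    Complex.equivRealProdCLM.symm.continuous.comp ((hc i).prodMk (hc j))
  apply continuous_to_SU2
  · simp only [radial_entry_zero (sphere_ne_zero _), norm_eq_of_mem_sphere, div_one]
    exact hm 0 1
  · simp only [radial_entry_one (sphere_ne_zero _), norm_eq_of_mem_sphere, div_one]
    exact hm 2 3

theorem surjective_radial_sphere :
    Surjective fun y : Metric.sphere (0 : E4) 1 => radial y := fun g =>
  ⟨⟨coords g, by simp [norm_coords]⟩, radial_coords g⟩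

instance : CompactSpace SU2 where
  isCompact_univ := by
    rw [← surjective_radial_sphere.range_eq]
    exact isCompact_range continuous_radial_sphere

theorem continuous_inv_SU2 : Continuous fun g : SU2 => g⁻¹ := by
  apply continuous_to_SU2
  · simp only [inv_entry_zero]
    exact Complex.continuous_conj.comp (continuous_entry 0 0)
  · simp only [inv_entry_one]
    exact (continuous_entry 1 0).neg

instance : SecondCountableTopology SU2 := by
  have : SecondCountableTopology (Matrix (Fin 2) (Fin 2) ℂ) :=
    inferInstanceAs (SecondCountableTopology (Fin 2 → Fin 2 → ℂ))
  exact TopologicalSpace.Subtype.secondCountableTopology _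

theorem vol_univ : vol Set.univ = ENNReal.ofReal (16 * Real.pi ^ 2) := by
  rw [vol, Measure.smul_apply, Measure.map_apply continuous_radial_sphere.measurable
    MeasurableSet.univ, Set.preimage_univ, Measure.toSphere_apply_univ, EuclideanSpace.volume_ball]
  have hG : Real.Gamma (4 / 2 + 1) = 2 := by
    rw [show (4 / 2 + 1 : ℝ) = (2 : ℕ) + 1 by norm_num, Real.Gamma_nat_eq_factorial]; norm_num
  have hs : Real.sqrt Real.pi ^ 4 = Real.pi ^ 2 := by
    rw [show 4 = 2 * 2 by norm_num, pow_mul, Real.sq_sqrt Real.pi_pos.le]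
  simp only [finrank_euclideanSpace, Fintype.card_fin, smul_eq_mul, ENNReal.ofReal_one, one_pow,
    one_mul, Nat.cast_ofNat, hG, hs]
  -- The surface measure is the dimension `4` times the volume `π² / 2` of the unit ball; the radius
  -- `2` contributes `2 ^ 3`.
  rw [show (16 * Real.pi ^ 2 : ℝ) = 2 ^ 3 * (4 * (Real.pi ^ 2 / 2)) by ring,
    ENNReal.ofReal_mul (by positivity), ENNReal.ofReal_mul (by positivity),
    ENNReal.ofReal_pow (by positivity)]
  simp

instance : IsFiniteMeasure vol where
  measure_univ_lt_top := by rw [vol_univ]; exact ENNReal.ofReal_lt_top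

instance : vol.IsOpenPosMeasure where
  open_pos U hU hne := by
    rw [vol, Measure.smul_apply, smul_eq_mul, Measure.map_apply continuous_radial_sphere.measurable
      hU.measurableSet]
    refine mul_ne_zero (by norm_num) ?_
    exact (hU.preimage continuous_radial_sphere).measure_ne_zero _
      (hne.preimage surjective_radial_sphere)

/-! ### Invariance of the volume under translations and inversion -/

open scoped Pointwise in
-- The surface measure of a set is a multiple of the volume of the cone over it, and a linear
-- isometry carries cones to cones and preserves volume.
theorem measurePreserving_sphere (L : E4 ≃ₗᵢ[ℝ] E4) :
    MeasurePreserving (fun y : Metric.sphere (0 : E4) 1 =>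
      (⟨L y, by simp⟩ : Metric.sphere (0 : E4) 1))
      (volume : Measure E4).toSphere (volume : Measure E4).toSphere := by
  have hc : Continuous (fun y : Metric.sphere (0 : E4) 1 =>
      (⟨L y, by simp⟩ : Metric.sphere (0 : E4) 1)) :=
    (L.continuous.comp continuous_subtype_val).subtype_mk _
  refine ⟨hc.measurable, ?_⟩
  ext s hs
  rw [Measure.map_apply hc.measurable hs, Measure.toSphere_apply' _ (hc.measurable hs),
    Measure.toSphere_apply' _ hs]
  congr 1
  rw [← L.measurePreserving.measure_preimage_emb L.toHomeomorph.measurableEmbedding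
    (Set.Ioo (0 : ℝ) 1 • (Subtype.val '' s))]
  congr 1
  ext x
  simp only [Set.mem_smul, Set.mem_image, Set.mem_preimage, Subtype.exists, exists_and_right,
    exists_eq_right]
  constructor
  · rintro ⟨r, hr, y, ⟨hy, hys⟩, rfl⟩
    exact ⟨r, hr, L y, ⟨by simpa using hy, hys⟩, by simp⟩
  · rintro ⟨r, hr, y, ⟨hy, hys⟩, h⟩
    refine ⟨r, hr, L.symm y, ⟨by simpa using hy, by simpa using hys⟩, ?_⟩
    apply L.injective
    simpa using h

theorem measurePreserving_of_isometry (L : E4 ≃ₗᵢ[ℝ] E4) (φ : SU2 → SU2) (hφ : Measurable φ)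
    (h : ∀ y : E4, ‖y‖ = 1 → radial (L y) = φ (radial y)) : MeasurePreserving φ vol vol := by
  refine ⟨hφ, ?_⟩
  have hr := continuous_radial_sphere.measurable
  have hL := measurePreserving_sphere L
  rw [vol, Measure.map_smul, Measure.map_map hφ hr]
  congr 1
  conv_rhs => rw [← hL.map_eq]
  rw [Measure.map_map hr hL.measurable]
  congr 1
  ext1 y
  exact (h y (norm_eq_of_mem_sphere y)).symm

/-- Left multiplication by an element of `SU(2)` as a linear isometry of `ℝ⁴`. -/
def leftIsometry (g : SU2) : E4 →ₗᵢ[ℝ] E4 where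
  toFun y := !₂[
    (g.1 0 0).re * y 0 - (g.1 0 0).im * y 1 - (g.1 1 0).re * y 2 - (g.1 1 0).im * y 3,
    (g.1 0 0).re * y 1 + (g.1 0 0).im * y 0 - (g.1 1 0).re * y 3 + (g.1 1 0).im * y 2,
    (g.1 1 0).re * y 0 - (g.1 1 0).im * y 1 + (g.1 0 0).re * y 2 + (g.1 0 0).im * y 3,
    (g.1 1 0).re * y 1 + (g.1 1 0).im * y 0 + (g.1 0 0).re * y 3 - (g.1 0 0).im * y 2]
  map_add' x y := by
    ext i; fin_cases i <;> simp <;> ring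
  map_smul' c y := by
    ext i; fin_cases i <;> simp <;> ring
  norm_map' y := by
    have h := normSq_entries g
    simp only [Complex.normSq_apply] at h
    rw [← sq_eq_sq₀ (norm_nonneg _) (norm_nonneg _), norm_sq_eq_sum, norm_sq_eq_sum]
    simp
    linear_combination (y 0 ^ 2 + y 1 ^ 2 + y 2 ^ 2 + y 3 ^ 2) * h

/-- Inversion in `SU(2)` as a linear isometry of `ℝ⁴`. -/
def invIsometry : E4 →ₗᵢ[ℝ] E4 where
  toFun y := !₂[y 0, -y 1, -y 2, -y 3]
  map_add' x y := by
    ext i; fin_cases i <;> simp <;> ring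
  map_smul' c y := by
    ext i; fin_cases i <;> simp
  norm_map' y := by
    rw [← sq_eq_sq₀ (norm_nonneg _) (norm_nonneg _), norm_sq_eq_sum, norm_sq_eq_sum]
    simp

theorem measurePreserving_mul_left (g : SU2) : MeasurePreserving (fun x => g * x) vol vol := by
  refine measurePreserving_of_isometry ((leftIsometry g).toLinearIsometryEquiv rfl) _
    (continuous_const_mul g).measurable fun y hy => ?_
  have hy0 : y ≠ 0 := norm_ne_zero_iff.mp (by rw [hy]; exact one_ne_zero)
  have hn : ‖leftIsometry g y‖ = 1 := by rw [LinearIsometry.norm_map, hy]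
  have hL0 : leftIsometry g y ≠ 0 := norm_ne_zero_iff.mp (by rw [hn]; exact one_ne_zero)
  rw [LinearIsometry.coe_toLinearIsometryEquiv]
  apply ext_iff_col
  · rw [radial_entry_zero hL0, mul_entry_zero, radial_entry_zero hy0, radial_entry_one hy0, hn, hy]
    apply Complex.ext <;> simp [leftIsometry] <;> ring
  · rw [radial_entry_one hL0, mul_entry_one, radial_entry_zero hy0, radial_entry_one hy0, hn, hy]
    apply Complex.ext <;> simp [leftIsometry] <;> ring

theorem measurePreserving_inv : MeasurePreserving (fun x : SU2 => x⁻¹) vol vol := by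
  refine measurePreserving_of_isometry (invIsometry.toLinearIsometryEquiv rfl) _
    continuous_inv_SU2.measurable fun y hy => ?_
  have hy0 : y ≠ 0 := norm_ne_zero_iff.mp (by rw [hy]; exact one_ne_zero)
  have hn : ‖invIsometry y‖ = 1 := by rw [LinearIsometry.norm_map, hy]
  have hL0 : invIsometry y ≠ 0 := norm_ne_zero_iff.mp (by rw [hn]; exact one_ne_zero)
  rw [LinearIsometry.coe_toLinearIsometryEquiv]
  apply ext_iff_col
  · rw [radial_entry_zero hL0, inv_entry_zero, radial_entry_zero hy0, hn, hy]
    apply Complex.ext <;> simp [invIsometry]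
  · rw [radial_entry_one hL0, inv_entry_one, radial_entry_one hy0, hn, hy]
    apply Complex.ext <;> simp [invIsometry]

/-- Obtained from `x g = (g⁻¹ x⁻¹)⁻¹`, so that only left multiplication and inversion need explicit
isometries. -/
theorem measurePreserving_mul_right (g : SU2) : MeasurePreserving (fun x => x * g) vol vol := by
  have h := measurePreserving_inv.comp
    ((measurePreserving_mul_left g⁻¹).comp measurePreserving_inv)
  simpa [Function.comp_def] using h

theorem measurePreserving_bi (g h : SU2) :
    MeasurePreserving (fun x => g⁻¹ * x * h) vol vol :=
  (measurePreserving_mul_right h).comp (measurePreserving_mul_left g⁻¹)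

/-- The transformation `x ↦ g⁻¹ x h`, as a homeomorphism. -/
def biHomeo (g h : SU2) : SU2 ≃ₜ SU2 where
  toFun x := g⁻¹ * x * h
  invFun x := g * x * h⁻¹
  left_inv x := by group
  right_inv x := by group
  continuous_toFun := (continuous_const.mul continuous_id).mul continuous_const
  continuous_invFun := (continuous_const.mul continuous_id).mul continuous_const

theorem integral_bi {E : Type*} [NormedAddCommGroup E] [NormedSpace ℝ E] (g h : SU2) (f : SU2 → E) :
    ∫ x, f (g⁻¹ * x * h) ∂vol = ∫ x, f x ∂vol :=
  (measurePreserving_bi g h).integral_comp (biHomeo g h).measurableEmbedding f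

end HypersphereFields

end

noncomputable section

namespace HypersphereFields

open Polynomial

/-! ### Schur orthogonality -/

theorem continuous_coeff_mul {p q : SU2 → ℂ[X]} (hp : ∀ j, Continuous fun g => (p g).coeff j)
    (hq : ∀ j, Continuous fun g => (q g).coeff j) (j : ℕ) :
    Continuous fun g => (p g * q g).coeff j := by
  simp only [coeff_mul]
  exact continuous_finsetSum _ fun x _ => (hp _).mul (hq _)

theorem continuous_coeff_pow {p : SU2 → ℂ[X]} (hp : ∀ j, Continuous fun g => (p g).coeff j)
    (k j : ℕ) : Continuous fun g => (p g ^ k).coeff j := by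
  induction k generalizing j with
  | zero => simpa using continuous_const
  | succ k ih =>
    simp only [pow_succ]
    exact continuous_coeff_mul ih hp j

theorem continuous_coeff_linear {a b : SU2 → ℂ} (ha : Continuous a) (hb : Continuous b) (j : ℕ) :
    Continuous fun g => (C (a g) * X + C (b g)).coeff j := by
  simp only [coeff_add, coeff_C_mul, coeff_X, coeff_C]
  refine (ha.mul continuous_const).add ?_
  split_ifs
  exacts [hb, continuous_const]

theorem continuous_coeff_wignerPoly (n k j : ℕ) :
    Continuous fun g => (wignerPoly n k g).coeff j := by
  have h0 := continuous_entry 0 0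
  have h1 := continuous_entry 1 0
  exact continuous_coeff_mul
    (continuous_coeff_pow (continuous_coeff_linear (Complex.continuous_conj.comp h0)
      (Complex.continuous_conj.comp h1)) _)
    (continuous_coeff_pow (continuous_coeff_linear h1.neg h0) _) j

theorem continuous_wignerD (n : ℕ) (j k : Fin (n + 1)) : Continuous (wignerD n j k) := by
  have : wignerD n j k = fun g => normFactor n k / normFactor n j * (wignerPoly n k g).coeff j :=
    funext fun g => wignerD_eq n j k g
  rw [this]
  exact continuous_const.mul (continuous_coeff_wignerPoly n k j)

theorem continuous_conj_wignerD (n : ℕ) (j k : Fin (n + 1)) :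
    Continuous fun g => conj (wignerD n j k g) :=
  Complex.continuous_conj.comp (continuous_wignerD n j k)

theorem _root_.Continuous.integrable_vol {E : Type*} [NormedAddCommGroup E] {f : SU2 → E}
    (hf : Continuous f) : Integrable f vol :=
  hf.integrable_of_hasCompactSupport (HasCompactSupport.of_compactSpace f)

/-- The matrix of Wigner functions of degree `n`. -/
def wignerMatrix (n : ℕ) (g : SU2) : Matrix (Fin (n + 1)) (Fin (n + 1)) ℂ :=
  Matrix.of fun j k => wignerD n j k g

theorem wignerMatrix_mul (n : ℕ) (g h : SU2) :
    wignerMatrix n (g * h) = wignerMatrix n g * wignerMatrix n h := by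
  ext j k
  simp [wignerMatrix, Matrix.mul_apply, wignerD_mul]

theorem wignerMatrix_one (n : ℕ) : wignerMatrix n 1 = 1 := by
  ext j k
  simp [wignerMatrix, wignerD_one, Matrix.one_apply]

theorem wignerMatrix_inv (n : ℕ) (g : SU2) :
    wignerMatrix n g⁻¹ = (wignerMatrix n g).conjTranspose := by
  ext j k
  simp [wignerMatrix, wignerD_inv]

/-! ### Weights of the torus and Schur's lemma -/

theorem exists_unit_pow_ne {m : ℤ} (hm : m ≠ 0) :
    ∃ u : ℂ, Complex.normSq u + Complex.normSq 0 = 1 ∧ u ^ m ≠ 1 := by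
  -- For this choice `u ^ m = exp (π i) = -1`.
  refine ⟨Complex.exp ((Real.pi / m : ℝ) * Complex.I), ?_, ?_⟩
  · rw [Complex.normSq_eq_norm_sq, Complex.norm_exp_ofReal_mul_I]; simp
  · have hm' : (m : ℂ) ≠ 0 := by exact_mod_cast hm
    rw [← Complex.exp_int_mul]
    have : (m : ℂ) * ((Real.pi / m : ℝ) * Complex.I) = Real.pi * Complex.I := by
      push_cast; field_simp
    rw [this, Complex.exp_pi_mul_I]
    norm_num

theorem wignerMatrix_torus (n : ℕ) (u : ℂ) (hu : Complex.normSq u + Complex.normSq 0 = 1) :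
    wignerMatrix n (ofUnit u 0 hu) = Matrix.diagonal fun k : Fin (n + 1) => u ^ ((n : ℤ) - 2 * k) := by
  have h00 : (ofUnit u 0 hu).1 0 0 = u := rfl
  have h10 : (ofUnit u 0 hu).1 1 0 = 0 := rfl
  have huu : conj u = u⁻¹ := by
    rw [map_zero, add_zero] at hu
    rw [Complex.inv_def, hu]; simp
  have hu0 : u ≠ 0 := by rintro rfl; simp at hu
  ext j k
  simp only [wignerMatrix, Matrix.of_apply, wignerD_eq, wignerPoly, polyA, polyB, h00, h10,
    map_zero, neg_zero, zero_mul, zero_add, add_zero, huu, Matrix.diagonal_apply]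
  rw [mul_pow, ← C_pow, ← C_pow, mul_right_comm, ← C_mul, coeff_C_mul, coeff_X_pow]
  simp only [Fin.val_inj]
  split_ifs with h
  · subst h
    have hk : (j : ℕ) ≤ n := Nat.lt_succ_iff.mp j.2
    rw [div_self (normFactor_ne_zero j), one_mul, mul_one, inv_pow, ← zpow_natCast,
      ← zpow_natCast, ← zpow_neg, ← zpow_add₀ hu0]
    congr 1
    push_cast [hk]
    ring
  · simp

/-- The leading coefficient of a product of linear polynomials is the product of the leading
coefficients, here a monomial in the entries of `g`. This row, and by inversion the corresponding
column, has no zero once both entries are non-zero; that replaces an abstract irreducibility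
argument. -/
theorem wignerD_last_ne_zero (n : ℕ) (l : Fin (n + 1)) {g : SU2} (h0 : g.1 0 0 ≠ 0)
    (h1 : g.1 1 0 ≠ 0) : wignerD n (Fin.last n) l g ≠ 0 := by
  have hl : (l : ℕ) ≤ n := Nat.lt_succ_iff.mp l.2
  have hlin (a b : ℂ) : (C a * X + C b).natDegree ≤ 1 := natDegree_linear_le
  have hcoeff : (wignerPoly n l g).coeff n = conj (g.1 0 0) ^ (l : ℕ) * (-g.1 1 0) ^ (n - l) := by
    have h2 := coeff_mul_add_eq_of_natDegree_le
      (natDegree_linear_pow (conj (g.1 0 0)) (conj (g.1 1 0)) l)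
      (natDegree_linear_pow (-(g.1 1 0)) (g.1 0 0) (n - l))
    rw [Nat.add_sub_cancel' hl] at h2
    have h3 := coeff_pow_of_natDegree_le (m := l) (hlin (conj (g.1 0 0)) (conj (g.1 1 0)))
    have h4 := coeff_pow_of_natDegree_le (m := n - l) (hlin (-(g.1 1 0)) (g.1 0 0))
    rw [mul_one] at h3 h4
    rw [wignerPoly, polyA, polyB, h2, h3, h4]
    simp
  rw [wignerD_eq, Fin.val_last, hcoeff]
  refine mul_ne_zero (div_ne_zero (normFactor_ne_zero l) ?_) (mul_ne_zero ?_ ?_)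
  · exact normFactor_ne_zero (Fin.last n)
  · exact pow_ne_zero _ ((_root_.map_ne_zero _).mpr h0)
  · exact pow_ne_zero _ (neg_ne_zero.mpr h1)

theorem exists_entries_ne_zero : ∃ g : SU2, g.1 0 0 ≠ 0 ∧ g.1 1 0 ≠ 0 := by
  refine ⟨ofUnit (3 / 5 : ℝ) (4 / 5 : ℝ) ?_, ?_, ?_⟩
  · rw [Complex.normSq_ofReal, Complex.normSq_ofReal]; norm_num
  · change ((3 / 5 : ℝ) : ℂ) ≠ 0
    norm_num
  · change ((4 / 5 : ℝ) : ℂ) ≠ 0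
    norm_num

theorem wignerD_apply_last_ne_zero (n : ℕ) (l : Fin (n + 1)) {g : SU2} (h0 : g.1 0 0 ≠ 0)
    (h1 : g.1 1 0 ≠ 0) : wignerD n l (Fin.last n) g ≠ 0 := by
  have h := wignerD_last_ne_zero n l (g := g⁻¹)
    (by rw [inv_entry_zero]; exact (_root_.map_ne_zero _).mpr h0)
    (by rw [inv_entry_one]; exact neg_ne_zero.mpr h1)
  rw [wignerD_inv] at h
  exact (_root_.map_ne_zero _).mp h

section Intertwiner

variable {n n' : ℕ} {T : Matrix (Fin (n + 1)) (Fin (n' + 1)) ℂ}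

/-- Commuting with the torus forces an intertwiner to preserve weights: the two sides differ by the
factor `u ^ m`, with `m` the difference of the weights. -/
theorem intertwiner_apply_eq_zero (hT : ∀ h, wignerMatrix n h * T = T * wignerMatrix n' h)
    {k : Fin (n + 1)} {k' : Fin (n' + 1)} (hk : (n : ℤ) - 2 * k ≠ n' - 2 * k') : T k k' = 0 := by
  obtain ⟨u, hu, hne⟩ := exists_unit_pow_ne (sub_ne_zero.mpr hk)
  have hu0 : u ≠ 0 := by rintro rfl; simp at hu
  have h := congrFun (congrFun (hT (ofUnit u 0 hu)) k) k'
  rw [wignerMatrix_torus, wignerMatrix_torus, Matrix.diagonal_mul, Matrix.mul_diagonal] at h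
  rw [zpow_sub₀ hu0] at hne
  by_contra h0
  apply hne
  rw [mul_comm] at h
  rw [mul_left_cancel₀ h0 h, div_self (zpow_ne_zero _ hu0)]

/-- The weight `-n` does not occur in degree `n' < n`, so the last row of `T` is zero. The
non-vanishing last row of `wignerMatrix n g` then kills the last column of `T`, and the
non-vanishing last column of `wignerMatrix n' g` kills everything else. -/
theorem intertwiner_eq_zero_of_lt (hT : ∀ h, wignerMatrix n h * T = T * wignerMatrix n' h)
    (hn : n' < n) : T = 0 := by
  obtain ⟨g, h0, h1⟩ := exists_entries_ne_zero
  have hlast (l : Fin (n + 1)) : T l (Fin.last n') = 0 := by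
    by_cases hl : (n : ℤ) - 2 * l = n' - 2 * n'
    · have h := congrFun (congrFun (hT g) (Fin.last n)) (Fin.last n')
      rw [Matrix.mul_apply, Matrix.mul_apply] at h
      rw [Finset.sum_eq_single l, Finset.sum_eq_zero] at h
      · exact (mul_eq_zero.mp h).resolve_left (wignerD_last_ne_zero n l h0 h1)
      · intro l' _
        rw [intertwiner_apply_eq_zero hT, zero_mul]
        have := l'.2
        simp only [Fin.val_last]
        omega
      · intro l' _ hl'
        rw [intertwiner_apply_eq_zero hT, mul_zero]
        intro h'
        apply hl'
        ext
        simp only [Fin.val_last] at h'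
        omega
      · simp
    · exact intertwiner_apply_eq_zero hT (by simpa using hl)
  ext k k'
  by_cases hk : (n : ℤ) - 2 * k = n' - 2 * k'
  -- In this entry the left side vanishes because the last column of `T` does; on the right only the
  -- index with the weight of `k` survives.
  · have h := congrFun (congrFun (hT g) k) (Fin.last n')
    rw [Matrix.mul_apply, Matrix.mul_apply] at h
    rw [Finset.sum_eq_zero (fun l _ => by rw [hlast, mul_zero]), Finset.sum_eq_single k'] at h
    · exact (mul_eq_zero.mp h.symm).resolve_right (wignerD_apply_last_ne_zero n' k' h0 h1)
    · intro l' _ hl'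
      rw [intertwiner_apply_eq_zero hT, zero_mul]
      intro h'
      apply hl'
      ext
      omega
    · simp
  · exact intertwiner_apply_eq_zero hT hk

/-- By unitarity, the adjoint of an intertwiner is an intertwiner in the opposite direction, which
reduces to the case of decreasing degree. -/
theorem intertwiner_eq_zero (hT : ∀ h, wignerMatrix n h * T = T * wignerMatrix n' h)
    (hn : n ≠ n') : T = 0 := by
  rcases lt_or_gt_of_ne hn with hlt | hlt
  · have hT' : ∀ h, wignerMatrix n' h * T.conjTranspose = T.conjTranspose * wignerMatrix n h := by
      intro h
      have := congrArg Matrix.conjTranspose (hT h⁻¹)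
      rw [Matrix.conjTranspose_mul, Matrix.conjTranspose_mul, wignerMatrix_inv, wignerMatrix_inv,
        Matrix.conjTranspose_conjTranspose, Matrix.conjTranspose_conjTranspose] at this
      exact this.symm
    exact Matrix.conjTranspose_eq_zero.mp (intertwiner_eq_zero_of_lt hT' hlt)
  · exact intertwiner_eq_zero_of_lt hT hlt

end Intertwiner

/-- The weights of one degree are distinct, so `T` is diagonal; comparing the entries in the
non-vanishing last column shows that all diagonal entries agree. -/
theorem intertwiner_self {n : ℕ} {T : Matrix (Fin (n + 1)) (Fin (n + 1)) ℂ}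
    (hT : ∀ h, wignerMatrix n h * T = T * wignerMatrix n h) (k k' : Fin (n + 1)) :
    T k k' = if k = k' then T 0 0 else 0 := by
  have hoff {k k' : Fin (n + 1)} (h : k ≠ k') : T k k' = 0 :=
    intertwiner_apply_eq_zero hT fun h' => h (by ext; omega)
  split_ifs with hk
  · subst hk
    obtain ⟨g, h0, h1⟩ := exists_entries_ne_zero
    have key (k : Fin (n + 1)) : T k k = T (Fin.last n) (Fin.last n) := by
      have h := congrFun (congrFun (hT g) k) (Fin.last n)
      rw [Matrix.mul_apply, Matrix.mul_apply, Finset.sum_eq_single (Fin.last n),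
        Finset.sum_eq_single k] at h
      · rw [mul_comm] at h
        exact (mul_right_cancel₀ (wignerD_apply_last_ne_zero n k h0 h1) h).symm
      · intro l _ hl
        rw [hoff hl.symm, zero_mul]
      · simp
      · intro l _ hl
        rw [hoff hl, mul_zero]
      · simp
    rw [key, key 0]
  · exact hoff hk

/-- The matrix of the inner products of the Wigner functions in the rows `j` and `j'`. -/
def schurMatrix (n n' : ℕ) (j : Fin (n + 1)) (j' : Fin (n' + 1)) :
    Matrix (Fin (n + 1)) (Fin (n' + 1)) ℂ :=
  Matrix.of fun k k' => ∫ g, conj (wignerD n j k g) * wignerD n' j' k' g ∂vol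

/-- Right translation by `h` preserves the volume and acts on the columns of the Wigner matrix by
`wignerMatrix n h`. -/
theorem schurMatrix_eq (n n' : ℕ) (j : Fin (n + 1)) (j' : Fin (n' + 1)) (h : SU2) :
    schurMatrix n n' j j' =
      (wignerMatrix n h).conjTranspose * schurMatrix n n' j j' * wignerMatrix n' h := by
  refine Matrix.ext fun k k' => ?_
  have hint := integral_bi 1 h fun g => conj (wignerD n j k g) * wignerD n' j' k' g
  simp only [inv_one, one_mul] at hint
  rw [schurMatrix, Matrix.of_apply, ← hint]
  have hcont (l : Fin (n' + 1)) (m : Fin (n + 1)) :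
      Continuous fun g => conj (wignerD n j m g) * wignerD n' j' l g :=
    (continuous_conj_wignerD n j m).mul (continuous_wignerD n' j' l)
  have hexp : ∀ g, conj (wignerD n j k (g * h)) * wignerD n' j' k' (g * h) =
      ∑ l, ∑ m, conj (wignerD n m k h) * wignerD n' l k' h *
        (conj (wignerD n j m g) * wignerD n' j' l g) := by
    intro g
    rw [wignerD_mul, wignerD_mul, map_sum, Finset.sum_mul_sum, Finset.sum_comm]
    refine Finset.sum_congr rfl fun l _ => Finset.sum_congr rfl fun m _ => ?_
    rw [map_mul]; ring
  simp only [hexp]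
  have hcont' (l : Fin (n' + 1)) (m : Fin (n + 1)) : Integrable (fun g =>
      conj (wignerD n m k h) * wignerD n' l k' h *
        (conj (wignerD n j m g) * wignerD n' j' l g)) vol :=
    ((hcont l m).integrable_vol).const_mul _
  rw [integral_finsetSum _ fun l _ => integrable_finsetSum _ fun m _ => hcont' l m]
  rw [Matrix.mul_apply]
  refine Finset.sum_congr rfl fun l _ => ?_
  rw [integral_finsetSum _ fun m _ => hcont' l m,
    Matrix.mul_apply, Finset.sum_mul]
  refine Finset.sum_congr rfl fun m _ => ?_
  rw [integral_const_mul]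
  simp only [wignerMatrix, Matrix.conjTranspose_apply, Matrix.of_apply, RCLike.star_def]
  ring

theorem schurMatrix_intertwines (n n' : ℕ) (j : Fin (n + 1)) (j' : Fin (n' + 1)) (h : SU2) :
    wignerMatrix n h * schurMatrix n n' j j' = schurMatrix n n' j j' * wignerMatrix n' h := by
  conv_lhs => rw [schurMatrix_eq n n' j j' h]
  rw [← Matrix.mul_assoc, ← Matrix.mul_assoc, ← wignerMatrix_inv, ← wignerMatrix_mul,
    mul_inv_cancel, wignerMatrix_one, Matrix.one_mul]

theorem integral_conj_wignerD_mul_of_ne {n n' : ℕ} (hn : n ≠ n') (j k : Fin (n + 1))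
    (j' k' : Fin (n' + 1)) : ∫ g, conj (wignerD n j k g) * wignerD n' j' k' g ∂vol = 0 :=
  congrFun (congrFun (intertwiner_eq_zero (schurMatrix_intertwines n n' j j') hn) k) k'

theorem integral_conj_wignerD_mul (n : ℕ) (j k j' k' : Fin (n + 1)) :
    ∫ g, conj (wignerD n j k g) * wignerD n j' k' g ∂vol =
      if j = j' ∧ k = k' then (16 * Real.pi ^ 2 / (n + 1) : ℂ) else 0 := by
  have hs := intertwiner_self (schurMatrix_intertwines n n j j')
  -- The scalar is found from the trace: summed over the columns, the integrand is an entry of `D(g)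
  -- D(g)⁻¹ = 1`, and the total volume is `16 π²`.
  have htr : ∑ l, schurMatrix n n j j' l l =
      if j = j' then (16 * Real.pi ^ 2 : ℂ) else 0 := by
    simp only [schurMatrix, Matrix.of_apply]
    have hcont (l : Fin (n + 1)) :
        Integrable (fun g => conj (wignerD n j l g) * wignerD n j' l g) vol :=
      ((continuous_conj_wignerD n j l).mul (continuous_wignerD n j' l)).integrable_vol
    rw [← integral_finsetSum _ fun l _ => hcont l]
    have : ∀ g, ∑ l, conj (wignerD n j l g) * wignerD n j' l g = if j = j' then 1 else 0 := by
      intro g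
      have h := wignerD_mul_inv n j' j g g
      rw [mul_inv_cancel, wignerD_one] at h
      simp only [eq_comm (a := j) (b := j')]
      rw [h]
      exact Finset.sum_congr rfl fun l _ => mul_comm _ _
    simp only [this]
    rw [integral_const, Measure.real, vol_univ, ENNReal.toReal_ofReal (by positivity)]
    split_ifs <;> simp
  have h0 : (n + 1 : ℂ) * schurMatrix n n j j' 0 0 =
      if j = j' then (16 * Real.pi ^ 2 : ℂ) else 0 := by
    rw [← htr]
    rw [Finset.sum_congr rfl fun l _ => (hs l l).trans (if_pos rfl)]
    simp only [Finset.sum_const, Finset.card_univ, Fintype.card_fin, nsmul_eq_mul]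
    push_cast; ring
  have hn : (n + 1 : ℂ) ≠ 0 := by exact_mod_cast Nat.succ_ne_zero n
  have h1 := hs k k'
  rw [show schurMatrix n n j j' k k' =
    ∫ g, conj (wignerD n j k g) * wignerD n j' k' g ∂vol from rfl] at h1
  rw [h1]
  by_cases hj : j = j'
  · rw [if_pos hj] at h0
    by_cases hk : k = k'
    · rw [if_pos hk, if_pos ⟨hj, hk⟩, eq_div_iff hn, mul_comm]; exact h0
    · rw [if_neg hk, if_neg fun h => hk h.2]
  · rw [if_neg hj] at h0
    rw [(mul_eq_zero.mp h0).resolve_left hn, ite_self, if_neg fun h => hj h.1]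

end HypersphereFields

end

noncomputable section

namespace HypersphereFields

open Polynomial

/-! ### Completeness of the Wigner functions -/

/-- The Wigner functions as continuous functions. -/
def wignerC (n : ℕ) (j k : Fin (n + 1)) : C(SU2, ℂ) := ⟨wignerD n j k, continuous_wignerD n j k⟩

/-- The span of the Wigner functions. -/
def wignerSpan : Submodule ℂ C(SU2, ℂ) :=
  Submodule.span ℂ {f | ∃ n j k, f = wignerC n j k}

/-- The coefficients of `wignerPoly` as continuous functions. -/
def coeffC (n k j : ℕ) : C(SU2, ℂ) :=
  ⟨fun g => (wignerPoly n k g).coeff j, continuous_coeff_wignerPoly n k j⟩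

theorem wignerC_mem (n : ℕ) (j k : Fin (n + 1)) : wignerC n j k ∈ wignerSpan :=
  Submodule.subset_span ⟨n, j, k, rfl⟩

theorem coeffC_mem {n k : ℕ} (hk : k ≤ n) (j : ℕ) : coeffC n k j ∈ wignerSpan := by
  by_cases hj : j ≤ n
  · lift k to Fin (n + 1) using Nat.lt_succ_of_le hk
    lift j to Fin (n + 1) using Nat.lt_succ_of_le hj
    have : coeffC n k j = (normFactor n j / normFactor n k) • wignerC n j k := by
      ext g
      have := normFactor_ne_zero k
      have := normFactor_ne_zero j
      simp only [coeffC, wignerC, ContinuousMap.coe_mk, ContinuousMap.coe_smul, Pi.smul_apply,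
        smul_eq_mul, wignerD_eq]
      field_simp
    rw [this]
    exact wignerSpan.smul_mem _ (wignerC_mem n j k)
  · have : coeffC n k j = 0 := by
      ext g
      exact coeff_eq_zero_of_natDegree_lt ((natDegree_wignerPoly hk g).trans_lt (by omega))
    rw [this]
    exact wignerSpan.zero_mem

/-- The entries of the first column, as continuous functions. -/
def entryC (i : Fin 2) : C(SU2, ℂ) := ⟨fun g => g.1 i 0, continuous_entry i 0⟩

theorem entryC_zero_mul_coeffC {n k : ℕ} (hk : k ≤ n) (j : ℕ) :
    entryC 0 * coeffC n k j ∈ wignerSpan := by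
  have hn : (n + 1 : ℂ) ≠ 0 := by exact_mod_cast Nat.succ_ne_zero n
  -- Coefficient `j` of the relation for `g₀₀`; the operator `X d/dX` contributes the factor `j`.
  -- The case distinction reflects that `X p` has no constant term, and there the index `j - 1` is a
  -- dummy.
  have key : (n + 1 : ℂ) • (entryC 0 * coeffC n k j) =
      (n + 1 - j : ℂ) • coeffC (n + 1) k j +
        (if j = 0 then 0 else (k : ℂ)) • coeffC (n - 1) (k - 1) (j - 1) := by
    ext g
    have h := congrArg (fun p : ℂ[X] => p.coeff j) (entry_zero_mul_wignerPoly hk g)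
    have hc : (n + 1 : ℂ[X]) = C (n + 1 : ℂ) := by simp
    have hc' : (k : ℂ[X]) = C (k : ℂ) := by simp
    simp only [hc, hc', ← C_mul, coeff_add, coeff_sub, coeff_C_mul] at h
    simp only [ContinuousMap.coe_smul, ContinuousMap.coe_add, ContinuousMap.coe_mul, Pi.smul_apply,
      Pi.add_apply, Pi.mul_apply, smul_eq_mul, coeffC, entryC, ContinuousMap.coe_mk]
    rcases j with _ | j
    · simp only [coeff_X_mul_zero] at h
      simp only [if_true, Nat.cast_zero]
      linear_combination h
    · simp only [coeff_X_mul, coeff_derivative] at h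
      simp only [Nat.succ_ne_zero, if_false, Nat.add_sub_cancel]
      push_cast
      linear_combination h
  rw [← inv_smul_smul₀ hn (entryC 0 * coeffC n k j), key]
  refine wignerSpan.smul_mem _ (wignerSpan.add_mem
    (wignerSpan.smul_mem _ (coeffC_mem (by omega) _)) (wignerSpan.smul_mem _ (coeffC_mem ?_ _)))
  omega

theorem entryC_one_mul_coeffC {n k : ℕ} (hk : k ≤ n) (j : ℕ) :
    entryC 1 * coeffC n k j ∈ wignerSpan := by
  have hn : (n + 1 : ℂ) ≠ 0 := by exact_mod_cast Nat.succ_ne_zero n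
  have key : (n + 1 : ℂ) • (entryC 1 * coeffC n k j) =
      (k : ℂ) • coeffC (n - 1) (k - 1) j - (j + 1 : ℂ) • coeffC (n + 1) k (j + 1) := by
    ext g
    have h := congrArg (fun p : ℂ[X] => p.coeff j) (derivative_wignerPoly_succ hk g)
    have hc : (n + 1 : ℂ[X]) = C (n + 1 : ℂ) := by simp
    have hc' : (k : ℂ[X]) = C (k : ℂ) := by simp
    simp only [hc, hc', ← C_mul, coeff_add, coeff_C_mul, coeff_derivative] at h
    simp only [ContinuousMap.coe_smul, ContinuousMap.coe_sub, ContinuousMap.coe_mul, Pi.smul_apply,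
      Pi.sub_apply, Pi.mul_apply, smul_eq_mul, coeffC, entryC, ContinuousMap.coe_mk]
    linear_combination h
  rw [← inv_smul_smul₀ hn (entryC 1 * coeffC n k j), key]
  refine wignerSpan.smul_mem _ (wignerSpan.sub_mem
    (wignerSpan.smul_mem _ (coeffC_mem ?_ _)) (wignerSpan.smul_mem _ (coeffC_mem (by omega) _)))
  omega

theorem entryC_mul_mem (i : Fin 2) {f : C(SU2, ℂ)} (hf : f ∈ wignerSpan) :
    entryC i * f ∈ wignerSpan := by
  induction hf using Submodule.span_induction with
  | mem f hf =>
    obtain ⟨n, j, k, rfl⟩ := hf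
    have : entryC i * wignerC n j k =
        (normFactor n k / normFactor n j) • (entryC i * coeffC n k j) := by
      ext g
      simp only [coeffC, wignerC, ContinuousMap.coe_mk, ContinuousMap.coe_smul, Pi.smul_apply,
        smul_eq_mul, wignerD_eq, ContinuousMap.coe_mul, Pi.mul_apply]
      ring
    rw [this]
    apply wignerSpan.smul_mem
    fin_cases i
    · exact entryC_zero_mul_coeffC (Nat.lt_succ_iff.mp k.2) j
    · exact entryC_one_mul_coeffC (Nat.lt_succ_iff.mp k.2) j
  | zero => rw [mul_zero]; exact wignerSpan.zero_mem
  | add f g _ _ hf hg => rw [mul_add]; exact wignerSpan.add_mem hf hg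
  | smul c f _ hf => rw [mul_smul_comm]; exact wignerSpan.smul_mem _ hf

theorem star_mem_wignerSpan {f : C(SU2, ℂ)} (hf : f ∈ wignerSpan) : star f ∈ wignerSpan := by
  induction hf using Submodule.span_induction with
  | mem f hf =>
    obtain ⟨n, j, k, rfl⟩ := hf
    have : star (wignerC n j k) = ∑ l, ∑ m,
        (wignerD n j m weyl * wignerD n l k weyl⁻¹) • wignerC n m l := by
      ext g
      simpa [wignerC] using conj_wignerD n j k g
    rw [this]
    exact wignerSpan.sum_mem fun l _ => wignerSpan.sum_mem fun m _ =>
      wignerSpan.smul_mem _ (wignerC_mem n m l)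
  | zero => rw [star_zero]; exact wignerSpan.zero_mem
  | add f g _ _ hf hg => rw [star_add]; exact wignerSpan.add_mem hf hg
  | smul c f _ hf => rw [star_smul]; exact wignerSpan.smul_mem _ hf

theorem one_mem_wignerSpan : (1 : C(SU2, ℂ)) ∈ wignerSpan := by
  have : (1 : C(SU2, ℂ)) = coeffC 0 0 0 := by
    ext g
    simp [coeffC, wignerPoly]
  rw [this]
  exact coeffC_mem le_rfl 0

/-- The star algebra of polynomial functions on `SU(2)`. -/
def polyAlgebra : StarSubalgebra ℂ C(SU2, ℂ) := StarAlgebra.adjoin ℂ (Set.range entryC)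

theorem polyAlgebra_separatesPoints : polyAlgebra.toSubalgebra.SeparatesPoints := by
  intro g h hgh
  by_contra hne
  apply hgh
  have key (i : Fin 2) : g.1 i 0 = h.1 i 0 := by
    by_contra hi
    exact hne ⟨entryC i, ⟨entryC i, StarAlgebra.subset_adjoin ℂ _ ⟨i, rfl⟩, rfl⟩, hi⟩
  exact ext_iff_col (key 0) (key 1)

/-- The span is never shown directly to be an algebra: stability under multiplication by each
polynomial function, applied to `1`, suffices. The claim is proved for `a` and `star a` together so
that the induction passes through `star`. -/
theorem mul_mem_wignerSpan {a : C(SU2, ℂ)} (ha : a ∈ polyAlgebra) :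
    ∀ f ∈ wignerSpan, a * f ∈ wignerSpan := by
  suffices h : (∀ f ∈ wignerSpan, a * f ∈ wignerSpan) ∧ ∀ f ∈ wignerSpan, star a * f ∈ wignerSpan
    from h.1
  induction ha using StarAlgebra.adjoin_induction with
  | mem x hx =>
    obtain ⟨i, rfl⟩ := hx
    refine ⟨fun f hf => entryC_mul_mem i hf, fun f hf => ?_⟩
    -- Multiplication by a conjugated entry is multiplication by the entry, conjugated by `star`.
    have := star_mem_wignerSpan (entryC_mul_mem i (star_mem_wignerSpan hf))
    rwa [star_mul', star_star] at this
  | algebraMap r =>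
    refine ⟨fun f hf => ?_, fun f hf => ?_⟩
    · rw [← Algebra.smul_def]; exact wignerSpan.smul_mem _ hf
    · rw [← algebraMap_star_comm, ← Algebra.smul_def]; exact wignerSpan.smul_mem _ hf
  | add x y _ _ hx hy =>
    refine ⟨fun f hf => ?_, fun f hf => ?_⟩
    · rw [add_mul]; exact wignerSpan.add_mem (hx.1 f hf) (hy.1 f hf)
    · rw [star_add, add_mul]; exact wignerSpan.add_mem (hx.2 f hf) (hy.2 f hf)
  | mul x y _ _ hx hy =>
    refine ⟨fun f hf => ?_, fun f hf => ?_⟩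
    · rw [mul_assoc]; exact hx.1 _ (hy.1 f hf)
    · rw [star_mul', mul_assoc]; exact hx.2 _ (hy.2 f hf)
  | star x _ hx => exact ⟨hx.2, by rw [star_star]; exact hx.1⟩

theorem wignerSpan_topologicalClosure : wignerSpan.topologicalClosure = ⊤ := by
  rw [eq_top_iff]
  have h := ContinuousMap.starSubalgebra_topologicalClosure_eq_top_of_separatesPoints polyAlgebra
    polyAlgebra_separatesPoints
  have hle : Subalgebra.toSubmodule polyAlgebra.toSubalgebra ≤ wignerSpan := fun a ha => by
    have := mul_mem_wignerSpan (a := a) ha 1 one_mem_wignerSpan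
    rwa [mul_one] at this
  intro f _
  have hf : f ∈ polyAlgebra.topologicalClosure := by rw [h]; trivial
  exact closure_mono hle hf

/-! ### The Hilbert basis of hyperspherical harmonics -/

/-- The indices `((n, k), j)` of the hyperspherical harmonics. -/
abbrev Idx : Type := Σ p : (Σ n : ℕ, Fin (n + 1)), Fin (p.1 + 1)

/-- The hyperspherical harmonic of index `i`. -/
def harm (i : Idx) : SU2 → ℂ := phi i.1.1 i.2 i.1.2

/-- The norming constant `√(2ℓ+1) / (4π)`. -/
def phiFactor (n : ℕ) : ℂ := ((Real.sqrt (n + 1) / (4 * Real.pi) : ℝ) : ℂ)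

theorem phi_eq (n : ℕ) (j k : Fin (n + 1)) (g : SU2) :
    phi n j k g = phiFactor n * wignerD n j k g := rfl

theorem conj_phiFactor (n : ℕ) : conj (phiFactor n) = phiFactor n := Complex.conj_ofReal _

theorem phiFactor_sq (n : ℕ) : phiFactor n ^ 2 = (n + 1) / (16 * Real.pi ^ 2) := by
  rw [phiFactor, ← Complex.ofReal_pow, div_pow, Real.sq_sqrt (by positivity)]
  push_cast; ring

theorem phiFactor_ne_zero (n : ℕ) : phiFactor n ≠ 0 := by
  have h := phiFactor_sq n
  intro h0
  rw [h0, zero_pow two_ne_zero, eq_comm, div_eq_zero_iff] at h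
  rcases h with h | h
  · exact Nat.cast_add_one_ne_zero n h
  · simp [Real.pi_ne_zero] at h

theorem continuous_phi (n : ℕ) (j k : Fin (n + 1)) : Continuous (phi n j k) :=
  continuous_const.mul (continuous_wignerD n j k)

theorem continuous_harm (i : Idx) : Continuous (harm i) := continuous_phi _ _ _

theorem integral_conj_phi_mul_of_ne {n n' : ℕ} (hn : n ≠ n') (j k : Fin (n + 1))
    (j' k' : Fin (n' + 1)) : ∫ g, conj (phi n j k g) * phi n' j' k' g ∂vol = 0 := by
  have : ∀ g, conj (phi n j k g) * phi n' j' k' g =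
      phiFactor n * phiFactor n' * (conj (wignerD n j k g) * wignerD n' j' k' g) := by
    intro g
    rw [phi_eq, phi_eq, map_mul, conj_phiFactor]; ring
  simp only [this]
  rw [integral_const_mul, integral_conj_wignerD_mul_of_ne hn, mul_zero]

theorem integral_conj_phi_mul (n : ℕ) (j k j' k' : Fin (n + 1)) :
    ∫ g, conj (phi n j k g) * phi n j' k' g ∂vol = if j = j' ∧ k = k' then 1 else 0 := by
  have : ∀ g, conj (phi n j k g) * phi n j' k' g =
      phiFactor n ^ 2 * (conj (wignerD n j k g) * wignerD n j' k' g) := by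
    intro g
    rw [phi_eq, phi_eq, map_mul, conj_phiFactor]; ring
  simp only [this]
  rw [integral_const_mul, integral_conj_wignerD_mul, phiFactor_sq]
  have h1 : (n + 1 : ℂ) ≠ 0 := Nat.cast_add_one_ne_zero n
  have h2 : (Real.pi : ℂ) ≠ 0 := by exact_mod_cast Real.pi_ne_zero
  split_ifs
  · field_simp
  · rw [mul_zero]

theorem integral_conj_harm_mul (i i' : Idx) :
    ∫ g, conj (harm i g) * harm i' g ∂vol = if i = i' then 1 else 0 := by
  obtain ⟨⟨n, k⟩, j⟩ := i
  obtain ⟨⟨n', k'⟩, j'⟩ := i'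
  by_cases hn : n = n'
  · subst hn
    rw [harm, harm, integral_conj_phi_mul]
    refine if_congr ?_ rfl rfl
    constructor
    · rintro ⟨rfl, rfl⟩; rfl
    · intro h
      simp only [Sigma.mk.injEq] at h
      obtain ⟨⟨-, h1⟩, h2⟩ := h
      have h1' := eq_of_heq h1
      subst h1'
      exact ⟨eq_of_heq h2, rfl⟩
  · rw [harm, harm, integral_conj_phi_mul_of_ne hn, if_neg]
    intro h
    exact hn (congrArg (fun i : Idx => i.1.1) h)

/-- A continuous function as an element of `L²`. -/
def contL2 : C(SU2, ℂ) →L[ℂ] Lp ℂ 2 vol := ContinuousMap.toLp 2 vol ℂ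

theorem inner_contL2 (f : C(SU2, ℂ)) (u : Lp ℂ 2 vol) :
    inner ℂ (contL2 f) u = ∫ x, conj (f x) * u x ∂vol := by
  rw [L2.inner_def]
  refine integral_congr_ae ?_
  filter_upwards [ContinuousMap.coeFn_toLp (p := 2) (𝕜 := ℂ) vol f] with x hx
  rw [contL2, hx, RCLike.inner_apply, mul_comm]

/-- The class of the hyperspherical harmonic of index `i`. -/
def harmL2 (i : Idx) : Lp ℂ 2 vol := contL2 ⟨harm i, continuous_harm i⟩

theorem inner_harmL2 (i : Idx) (u : Lp ℂ 2 vol) :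
    inner ℂ (harmL2 i) u = ∫ x, conj (harm i x) * u x ∂vol := inner_contL2 _ u

theorem orthonormal_harmL2 : Orthonormal ℂ harmL2 := by
  classical
  rw [orthonormal_iff_ite]
  intro i i'
  rw [inner_harmL2, ← integral_conj_harm_mul]
  refine integral_congr_ae ?_
  filter_upwards [ContinuousMap.coeFn_toLp (p := 2) (𝕜 := ℂ) vol
    ⟨harm i', continuous_harm i'⟩] with x hx
  rw [harmL2, contL2, hx]
  rfl

/-- Uniform density in `C(SU2, ℂ)` passes to `L²`, because continuous functions are dense there and
their inclusion is continuous. -/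
theorem span_harmL2 : ⊤ ≤ (Submodule.span ℂ (Set.range harmL2)).topologicalClosure := by
  have h : (wignerSpan.map contL2.toLinearMap).topologicalClosure = ⊤ :=
    (ContinuousMap.toLp_denseRange (p := 2) ℂ vol ℂ (by simp)).topologicalClosure_map_submodule
      wignerSpan_topologicalClosure
  rw [← h]
  refine Submodule.topologicalClosure_mono ?_
  rw [wignerSpan, Submodule.map_span, Submodule.span_le]
  rintro - ⟨-, ⟨n, j, k, rfl⟩, rfl⟩
  have : wignerC n j k =
      (phiFactor n)⁻¹ • (⟨harm ⟨⟨n, k⟩, j⟩, continuous_harm _⟩ : C(SU2, ℂ)) := by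
    ext g
    have := phiFactor_ne_zero n
    simp only [wignerC, ContinuousMap.coe_mk, ContinuousMap.coe_smul, Pi.smul_apply, smul_eq_mul,
      harm, phi_eq]
    field_simp
  rw [this]
  change contL2 _ ∈ _
  rw [map_smul]
  exact Submodule.smul_mem _ _ (Submodule.subset_span ⟨_, rfl⟩)

/-- The Hilbert basis of hyperspherical harmonics. -/
def harmBasis : HilbertBasis Idx ℂ (Lp ℂ 2 vol) :=
  HilbertBasis.mk orthonormal_harmL2 span_harmL2

theorem harmBasis_apply (i : Idx) : harmBasis i = harmL2 i := by
  rw [harmBasis, HilbertBasis.coe_mk]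

theorem hasSum_harmL2 (u : Lp ℂ 2 vol) :
    HasSum (fun i => (inner ℂ (harmL2 i) u : ℂ) • harmL2 i) u := by
  have h := harmBasis.hasSum_repr u
  simpa only [HilbertBasis.repr_apply_apply, harmBasis_apply] using h

instance : SecondCountableTopology (Lp ℂ 2 vol) :=
  have : Fact ((2 : ℝ≥0∞) ≠ ∞) := ⟨by simp⟩
  inferInstance

end HypersphereFields

end

noncomputable section

namespace HypersphereFields

/-! ### Harmonic polynomials and the Laplace-Beltrami operator -/

section Laplace

open MvPolynomial

/-- The value of a complex polynomial at a point of `ℝ⁴`. -/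
def evalE (p : MvPolynomial (Fin 4) ℂ) (y : E4) : ℂ := eval (fun i => (y i : ℂ)) p

theorem hasFDerivAt_coord (i : Fin 4) (y : E4) :
    HasFDerivAt (fun y : E4 => ((y i : ℝ) : ℂ))
      (Complex.ofRealCLM ∘L (EuclideanSpace.proj i : E4 →L[ℝ] ℝ)) y :=
  (Complex.ofRealCLM ∘L (EuclideanSpace.proj i : E4 →L[ℝ] ℝ)).hasFDerivAt

/-- Links formal and analytic partial derivatives, so that the Laplacian can be computed inside the
polynomial ring. -/
theorem hasFDerivAt_evalE (p : MvPolynomial (Fin 4) ℂ) (y : E4) :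
    ∃ L : E4 →L[ℝ] ℂ, HasFDerivAt (evalE p) L y ∧
      ∀ i, L (EuclideanSpace.single i 1) = evalE (pderiv i p) y := by
  induction p using MvPolynomial.induction_on with
  | C a =>
    refine ⟨0, ?_, fun i => by simp [evalE]⟩
    have : evalE (C a) = fun _ => a := by ext; simp [evalE]
    rw [this]
    exact hasFDerivAt_const a y
  | add p q hp hq =>
    obtain ⟨L, hL, hL'⟩ := hp
    obtain ⟨M, hM, hM'⟩ := hq
    have : evalE (p + q) = fun y => evalE p y + evalE q y := by ext; simp [evalE]
    refine ⟨L + M, this ▸ hL.add hM, fun i => ?_⟩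
    simp [hL', hM', evalE]
  | mul_X p j hp =>
    obtain ⟨L, hL, hL'⟩ := hp
    have : evalE (p * X j) = fun y => evalE p y * ((y j : ℝ) : ℂ) := by ext; simp [evalE]
    refine ⟨_, (hL.mul (hasFDerivAt_coord j y)).congr_of_eventuallyEq
      (Eventually.of_forall fun y => congrFun this y), fun i => ?_⟩
    rcases eq_or_ne i j with rfl | hij
    · simp [hL', evalE, pderiv_X, mul_comm, add_comm]
    · simp [hL', evalE, pderiv_X, hij.symm, mul_comm]

theorem contDiff_evalE (p : MvPolynomial (Fin 4) ℂ) {m : WithTop ℕ∞} :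
    ContDiff ℝ m (evalE p) := by
  induction p using MvPolynomial.induction_on with
  | C a =>
    have : evalE (C a) = fun _ => a := by ext; simp [evalE]
    rw [this]
    exact contDiff_const
  | add p q hp hq =>
    have : evalE (p + q) = fun y => evalE p y + evalE q y := by ext; simp [evalE]
    rw [this]
    exact hp.add hq
  | mul_X p j hp =>
    have : evalE (p * X j) = fun y => evalE p y * ((y j : ℝ) : ℂ) := by ext; simp [evalE]
    rw [this]
    exact hp.mul (Complex.ofRealCLM ∘L (EuclideanSpace.proj j : E4 →L[ℝ] ℝ)).contDiff

/-- The function `|y| ^ (2 s) p(y)`. -/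
def powMul (s : ℝ) (p : MvPolynomial (Fin 4) ℂ) (y : E4) : ℂ :=
  (((‖y‖ ^ 2) ^ s : ℝ) : ℂ) * evalE p y

theorem contDiffAt_powMul (s : ℝ) (p : MvPolynomial (Fin 4) ℂ) {y : E4} (hy : y ≠ 0)
    {m : WithTop ℕ∞} : ContDiffAt ℝ m (powMul s p) y := by
  have hn : ‖y‖ ^ 2 ≠ 0 := pow_ne_zero 2 (norm_ne_zero_iff.mpr hy)
  have h1 : ContDiffAt ℝ m (fun y : E4 => (‖y‖ ^ 2) ^ s) y :=
    (contDiff_norm_sq ℝ).contDiffAt.rpow_const_of_ne hn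
  exact (Complex.ofRealCLM.contDiff.contDiffAt.comp y h1).mul (contDiff_evalE p).contDiffAt

theorem fderiv_powMul (s : ℝ) (p : MvPolynomial (Fin 4) ℂ) {y : E4} (hy : y ≠ 0) (i : Fin 4) :
    fderiv ℝ (powMul s p) y (EuclideanSpace.single i 1) =
      powMul s (pderiv i p) y + 2 * s * powMul (s - 1) (X i * p) y := by
  have hn : ‖y‖ ^ 2 ≠ 0 := pow_ne_zero 2 (norm_ne_zero_iff.mpr hy)
  obtain ⟨L, hL, hL'⟩ := hasFDerivAt_evalE p y
  have h1 : HasFDerivAt (fun y : E4 => (‖y‖ ^ 2) ^ s) _ y :=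
    (hasStrictFDerivAt_norm_sq y).hasFDerivAt.rpow_const (p := s) (Or.inl hn)
  have h2 := Complex.ofRealCLM.hasFDerivAt.comp y h1
  have h3 := h2.mul hL
  have h4 : fderiv ℝ (powMul s p) y = _ := h3.fderiv
  rw [h4]
  simp only [powMul, add_apply, smul_apply,
    ContinuousLinearMap.comp_apply, hL', smul_eq_mul, Function.comp_apply, Complex.ofRealCLM_apply,
    innerSL_apply_apply, EuclideanSpace.inner_single_right]
  simp only [evalE, map_mul, eval_X]
  push_cast
  simp
  ring

theorem powMul_sub_one (s : ℝ) (p : MvPolynomial (Fin 4) ℂ) {y : E4} (hy : y ≠ 0) :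
    powMul (s - 1) p y = powMul s p y / ((‖y‖ ^ 2 : ℝ) : ℂ) := by
  have hn : 0 < ‖y‖ ^ 2 := by have := norm_pos_iff.mpr hy; positivity
  rw [powMul, powMul, Real.rpow_sub_one hn.ne']
  push_cast
  ring

/-- For harmonic `p` with `y · ∇p = n p`, the Laplacian of `|y| ^ (2s) p` is `(4 s n + 2 s (2 s +
2)) |y| ^ (2s - 2) p`. The exponent `2 s = -n`, which makes the function constant along rays, gives
`-n (n + 2)`. -/
theorem laplacian_powMul {n : ℕ} {p : MvPolynomial (Fin 4) ℂ} (hp : p.IsHomogeneous n)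
    (hh : ∑ i, pderiv i (pderiv i p) = 0) {y : E4} (hy : y ≠ 0) :
    Laplacian.laplacian (powMul (-(n / 2)) p) y =
      -(n * (n + 2)) * powMul (-(n / 2)) p y / ((‖y‖ ^ 2 : ℝ) : ℂ) := by
  set s : ℝ := -(n / 2) with hs
  have hsecond (i : Fin 4) : fderiv ℝ (fderiv ℝ (powMul s p)) y (EuclideanSpace.single i 1)
      (EuclideanSpace.single i 1) = powMul s (pderiv i (pderiv i p)) y +
        2 * s * powMul (s - 1) (X i * pderiv i p) y +
        2 * s * (powMul (s - 1) (pderiv i (X i * p)) y +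
          2 * (s - 1) * powMul (s - 1 - 1) (X i * (X i * p)) y) := by
    have hd : DifferentiableAt ℝ (fderiv ℝ (powMul s p)) y :=
      ((contDiffAt_powMul s p hy (m := 2)).fderiv_right (m := 1) (by norm_num)).differentiableAt
        (by norm_num)
    have e1 := (hd.hasFDerivAt.clm_apply
      (hasFDerivAt_const (EuclideanSpace.single i (1 : ℝ)) y)).fderiv
    have e2 : (fun z => fderiv ℝ (powMul s p) z (EuclideanSpace.single i (1 : ℝ))) =ᶠ[𝓝 y]
        fun z => powMul s (pderiv i p) z + 2 * s * powMul (s - 1) (X i * p) z := by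
      filter_upwards [isOpen_ne.mem_nhds hy] with z hz
      exact fderiv_powMul s p hz i
    have e3 := congrArg (fun L : E4 →L[ℝ] ℂ => L (EuclideanSpace.single i 1))
      (e1.symm.trans e2.fderiv_eq)
    have d1 := (contDiffAt_powMul s (pderiv i p) hy (m := 1)).differentiableAt (by norm_num)
    have d2 := (contDiffAt_powMul (s - 1) (X i * p) hy (m := 1)).differentiableAt (by norm_num)
    have e4 := (d1.hasFDerivAt.add (d2.hasFDerivAt.const_mul (2 * s : ℂ))).fderiv
    have e5 := congrArg (fun L : E4 →L[ℝ] ℂ => L (EuclideanSpace.single i 1)) e4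
    simp only [add_apply, smul_apply, smul_eq_mul,
      fderiv_powMul _ _ hy] at e5
    have e6 := e3.trans e5
    simp only [ContinuousLinearMap.flip_apply, zero_add, ContinuousLinearMap.comp_zero] at e6
    rw [e6]
    push_cast
    ring
  have hL := congrFun (InnerProductSpace.laplacian_eq_iteratedFDeriv_orthonormalBasis
    (powMul s p) (EuclideanSpace.basisFun (Fin 4) ℝ)) y
  rw [hL]
  simp only [iteratedFDeriv_two_apply, EuclideanSpace.basisFun_apply, Matrix.cons_val_zero,
    Matrix.cons_val_one, hsecond]
  have hc : ((‖y‖ ^ 2 : ℝ) : ℂ) ≠ 0 := by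
    exact_mod_cast pow_ne_zero 2 (norm_ne_zero_iff.mpr hy)
  simp only [powMul_sub_one _ _ hy]
  simp only [powMul]
  have heul := congrArg (MvPolynomial.eval fun i => (y i : ℂ)) hp.sum_X_mul_pderiv
  have hharm := congrArg (MvPolynomial.eval fun i => (y i : ℂ)) hh
  have hnorm : ((‖y‖ ^ 2 : ℝ) : ℂ) = (y 0 : ℂ) ^ 2 + (y 1 : ℂ) ^ 2 + (y 2 : ℂ) ^ 2 + (y 3 : ℂ) ^ 2 := by
    rw [norm_sq_eq_sum]; push_cast; ring
  have hs' : (s : ℂ) = -(n / 2) := by rw [hs]; push_cast; ring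
  rw [hs']
  simp only [Fin.sum_univ_four, map_add, map_mul, eval_X, map_zero, nsmul_eq_mul, map_natCast]
    at heul hharm
  simp only [Fin.sum_univ_four, evalE, map_add, map_mul, eval_X, Derivation.leibniz, smul_eq_mul,
    pderiv_X_self, map_one]
  set N : ℂ := ((‖y‖ ^ 2 : ℝ) : ℂ)
  set R : ℂ := (((‖y‖ ^ 2) ^ s : ℝ) : ℂ)
  field_simp
  -- The three inputs are harmonicity, Euler's identity and `|y|² = ∑ yᵢ²`.
  linear_combination (R * N ^ 2) * hharm + (-2 * n * R * N) * heul +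
    (-n * (n + 2) * R * MvPolynomial.eval (fun i => (y i : ℂ)) p) * hnorm

theorem evalE_smul {n : ℕ} {p : MvPolynomial (Fin 4) ℂ} (hp : p.IsHomogeneous n) (c : ℝ) (y : E4) :
    evalE p (c • y) = (c : ℂ) ^ n * evalE p y := by
  simp only [evalE, PiLp.smul_apply, smul_eq_mul, Complex.ofReal_mul]
  rw [eval_eq, eval_eq, Finset.mul_sum]
  refine Finset.sum_congr rfl fun d hd => ?_
  have := hp (mem_support_iff.mp hd)
  simp only [mul_pow, Finset.prod_mul_distrib, Finset.prod_pow_eq_pow_sum]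
  rw [Finsupp.weight_apply, Finsupp.sum] at this
  simp only [Pi.one_apply, smul_eq_mul, mul_one] at this
  rw [this]
  ring

theorem radial_eq_powMul {n : ℕ} {f : SU2 → ℂ} {p : MvPolynomial (Fin 4) ℂ}
    (hp : p.IsHomogeneous n) (hf : ∀ g, f g = eval (fun i => (coords g i : ℂ)) p) {y : E4}
    (hy : y ≠ 0) : f (radial y) = powMul (-(n / 2)) p y := by
  have hpos := norm_pos_iff.mpr hy
  rw [hf, coords_radial hy]
  change evalE p _ = _
  rw [evalE_smul hp, powMul]
  congr 1
  rw [Real.rpow_neg (by positivity), ← Real.rpow_natCast ‖y‖ 2, ← Real.rpow_mul hpos.le]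
  have : ((2 : ℕ) : ℝ) * (n / 2) = n := by push_cast; ring
  rw [this, Real.rpow_natCast]
  push_cast
  rw [inv_pow]

theorem IsHarmonicPolynomial.isLaplaceEigenfunction {n : ℕ} {f : SU2 → ℂ}
    (h : IsHarmonicPolynomial n f) : IsLaplaceEigenfunction ((n / 2 : ℝ) * (n / 2 + 1)) f := by
  obtain ⟨p, hp, hh, hf⟩ := h
  constructor
  · intro y hy
    refine ((contDiffAt_powMul (-(n / 2)) p hy).congr_of_eventuallyEq ?_).contDiffWithinAt
    filter_upwards [isOpen_ne.mem_nhds hy] with z hz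
    exact radial_eq_powMul hp hf hz
  · intro g
    have hy : (2 : ℝ) • coords g ≠ 0 := smul_ne_zero two_ne_zero (coords_ne_zero g)
    have he : (fun y : E4 => f (radial y)) =ᶠ[𝓝 ((2 : ℝ) • coords g)] powMul (-(n / 2)) p := by
      filter_upwards [isOpen_ne.mem_nhds hy] with z hz
      exact radial_eq_powMul hp hf hz
    -- At the points `2g` one has `|y|² = 4`, which turns `n (n + 2)` into `(n / 2) (n / 2 + 1)`.
    rw [laplaceBeltrami, (InnerProductSpace.laplacian_congr_nhds he).eq_of_nhds,
      laplacian_powMul hp hh hy, ← radial_eq_powMul hp hf hy, radial_smul_coords two_pos,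
      norm_smul, norm_coords]
    simp only [Real.norm_ofNat]
    push_cast
    ring

theorem IsHarmonicPolynomial.const_mul {n : ℕ} {f : SU2 → ℂ} (h : IsHarmonicPolynomial n f)
    (c : ℂ) : IsHarmonicPolynomial n fun g => c * f g := by
  obtain ⟨p, hp, hh, hf⟩ := h
  refine ⟨C c * p, ?_, ?_, fun g => by simp only [hf, map_mul, eval_C]⟩
  · simpa using (isHomogeneous_C (Fin 4) c).mul hp
  · simp only [pderiv_C_mul, ← Finset.mul_sum, hh, mul_zero]

theorem IsHarmonicPolynomial.sum {n : ℕ} {ι : Type*} (t : Finset ι) {f : ι → SU2 → ℂ}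
    (h : ∀ i ∈ t, IsHarmonicPolynomial n (f i)) : IsHarmonicPolynomial n fun g => ∑ i ∈ t, f i g := by
  classical
  induction t using Finset.induction_on with
  | empty => exact ⟨0, isHomogeneous_zero _ _ _, by simp, by simp⟩
  | insert i t hi ih =>
    obtain ⟨p, hp, hh, hf⟩ := h i (Finset.mem_insert_self i t)
    obtain ⟨q, hq, hh', hf'⟩ := ih fun j hj => h j (Finset.mem_insert_of_mem hj)
    refine ⟨p + q, hp.add hq, ?_, fun g => ?_⟩
    · simp only [map_add, Finset.sum_add_distrib, hh, hh', add_zero]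
    · simp only [Finset.sum_insert hi, hf, map_add, hf']

/-- The product of powers of two linear forms spanning an isotropic subspace is harmonic. -/
theorem harmonic_pow_mul_pow {a b : MvPolynomial (Fin 4) ℂ} {u v : Fin 4 → ℂ}
    (ha : ∀ i, pderiv i a = C (u i)) (hb : ∀ i, pderiv i b = C (v i))
    (huu : ∑ i, u i ^ 2 = 0) (huv : ∑ i, u i * v i = 0) (hvv : ∑ i, v i ^ 2 = 0) (k m : ℕ) :
    ∑ i, pderiv i (pderiv i (a ^ k * b ^ m)) = 0 := by
  have huu' : ∑ i, C (σ := Fin 4) (u i) ^ 2 = 0 := by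
    simp only [← map_pow, ← map_sum, huu, map_zero]
  have huv' : ∑ i, C (σ := Fin 4) (u i) * C (v i) = 0 := by
    simp only [← map_mul, ← map_sum, huv, map_zero]
  have hvv' : ∑ i, C (σ := Fin 4) (v i) ^ 2 = 0 := by
    simp only [← map_pow, ← map_sum, hvv, map_zero]
  have key (i : Fin 4) : pderiv i (pderiv i (a ^ k * b ^ m)) =
      ((k : MvPolynomial (Fin 4) ℂ) * ((k - 1 : ℕ) : MvPolynomial (Fin 4) ℂ) * a ^ (k - 1 - 1) * b ^ m) * C (u i) ^ 2 +
      (2 * (k : MvPolynomial (Fin 4) ℂ) * (m : MvPolynomial (Fin 4) ℂ) * a ^ (k - 1) * b ^ (m - 1)) * (C (u i) * C (v i)) +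
      ((m : MvPolynomial (Fin 4) ℂ) * ((m - 1 : ℕ) : MvPolynomial (Fin 4) ℂ) * a ^ k * b ^ (m - 1 - 1)) * C (v i) ^ 2 := by
    simp only [Derivation.leibniz, Derivation.leibniz_pow, ha, hb, smul_eq_mul, nsmul_eq_mul,
      map_add, pderiv_C, Derivation.map_natCast]
    ring
  simp only [key, Finset.sum_add_distrib, ← Finset.mul_sum, huu', huv', hvv', mul_zero, add_zero]

end Laplace

/-- Lagrange interpolation at `0, …, n`. It makes a coefficient a fixed combination of values, so
harmonicity need only be checked for the values of `wignerPoly`. -/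
theorem exists_coeff_eq_sum_eval (n j : ℕ) : ∃ c : Fin (n + 1) → ℂ, ∀ q : Polynomial ℂ,
    q.natDegree ≤ n → q.coeff j = ∑ i, c i * q.eval ((i : ℕ) : ℂ) := by
  refine ⟨fun i => (Lagrange.basis Finset.univ (fun i : Fin (n + 1) => ((i : ℕ) : ℂ)) i).coeff j,
    fun q hq => ?_⟩
  have hinj : Set.InjOn (fun i : Fin (n + 1) => ((i : ℕ) : ℂ)) (Finset.univ : Finset (Fin (n + 1))) := by
    intro i _ i' _ h
    exact Fin.ext (Nat.cast_injective (R := ℂ) h)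
  have hd : q.degree < (Finset.univ : Finset (Fin (n + 1))).card := by
    rw [Finset.card_univ, Fintype.card_fin]
    exact (Polynomial.degree_le_of_natDegree_le hq).trans_lt (by exact_mod_cast Nat.lt_succ_self n)
  conv_lhs => rw [Lagrange.eq_interpolate hinj hd, Lagrange.interpolate_apply]
  simp only [Polynomial.finsetSum_coeff, Polynomial.coeff_C_mul]
  exact Finset.sum_congr rfl fun i _ => mul_comm _ _

open MvPolynomial in
theorem isHarmonicPolynomial_eval_wignerPoly {n k : ℕ} (hk : k ≤ n) (z : ℂ) :
    IsHarmonicPolynomial n fun g => (wignerPoly n k g).eval z := by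
  set a : MvPolynomial (Fin 4) ℂ :=
    C z * X 0 + C (-Complex.I * z) * X 1 + X 2 + C (-Complex.I) * X 3 with ha
  set b : MvPolynomial (Fin 4) ℂ :=
    X 0 + C Complex.I * X 1 + C (-z) * X 2 + C (-Complex.I * z) * X 3 with hb
  have hX (i : Fin 4) : (X i : MvPolynomial (Fin 4) ℂ).IsHomogeneous 1 := isHomogeneous_X _ i
  have hCX (c : ℂ) (i : Fin 4) : (C c * X i : MvPolynomial (Fin 4) ℂ).IsHomogeneous 1 := by
    simpa using (isHomogeneous_C (Fin 4) c).mul (hX i)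
  have hah : a.IsHomogeneous 1 := (((hCX _ 0).add (hCX _ 1)).add (hX 2)).add (hCX _ 3)
  have hbh : b.IsHomogeneous 1 := (((hX 0).add (hCX _ 1)).add (hCX _ 2)).add (hCX _ 3)
  have hI : Complex.I ^ 2 = -1 := Complex.I_sq
  refine ⟨a ^ k * b ^ (n - k), ?_, ?_, fun g => ?_⟩
  · have := (hah.pow k).mul (hbh.pow (n - k))
    simpa [Nat.add_sub_cancel' hk] using this
  -- The vectors are the gradients of the two components of `g⁻¹ (z, 1)` with respect to the real
  -- coordinates of `g`.
  · refine harmonic_pow_mul_pow (u := ![z, -Complex.I * z, 1, -Complex.I])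
      (v := ![1, Complex.I, -z, -Complex.I * z]) ?_ ?_ ?_ ?_ ?_ k (n - k)
    · intro i
      fin_cases i <;> simp [ha, pderiv_X]
    · intro i
      fin_cases i <;> simp [hb, pderiv_X]
    · simp only [Fin.sum_univ_four, Matrix.cons_val]
      linear_combination (z ^ 2 + 1) * hI
    · simp only [Fin.sum_univ_four, Matrix.cons_val]
      linear_combination 0 * hI
    · simp only [Fin.sum_univ_four, Matrix.cons_val]
      linear_combination (1 + z ^ 2) * hI
  · change (polyA g ^ k * polyB g ^ (n - k)).eval z = _
    rw [map_mul, map_pow, map_pow, Polynomial.eval_mul, Polynomial.eval_pow,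
      Polynomial.eval_pow]
    congr 2
    · simp only [polyA, ha, coords, map_add, map_mul, eval_C, eval_X, Polynomial.eval_add,
        Polynomial.eval_mul, Polynomial.eval_C, Polynomial.eval_X]
      simp
      apply Complex.ext <;> simp <;> ring
    · simp only [polyB, hb, coords, map_add, map_mul, eval_C, eval_X, Polynomial.eval_add,
        Polynomial.eval_mul, Polynomial.eval_C, Polynomial.eval_X]
      simp
      apply Complex.ext <;> simp <;> ring

theorem isHarmonicPolynomial_phi (n : ℕ) (j k : Fin (n + 1)) :
    IsHarmonicPolynomial n (phi n j k) := by
  obtain ⟨c, hc⟩ := exists_coeff_eq_sum_eval n j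
  have hk : (k : ℕ) ≤ n := Nat.lt_succ_iff.mp k.2
  have h : phi n j k = fun g => phiFactor n * (normFactor n k / normFactor n j *
      ∑ i, c i * (wignerPoly n k g).eval ((i : ℕ) : ℂ)) := by
    ext g
    rw [phi_eq, wignerD_eq, hc _ (natDegree_wignerPoly hk g)]
  rw [h]
  exact ((IsHarmonicPolynomial.sum _ fun i _ =>
    (isHarmonicPolynomial_eval_wignerPoly hk _).const_mul (c i)).const_mul _).const_mul _

theorem isHarmonicPolynomial_columnField {Ω : Type*} (X : Ω → SU2 → ℂ) (n : ℕ) (k : Fin (n + 1))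
    (ω : Ω) : IsHarmonicPolynomial n (columnField X n k ω) :=
  IsHarmonicPolynomial.sum _ fun j _ => (isHarmonicPolynomial_phi n j k).const_mul _

end HypersphereFields

end

noncomputable section

namespace HypersphereFields

/-! ### Sections of the spin bundles -/

/-- The linear form on a line that is dual to a vector of that line. -/
def dualAt (p : RiemannSphere) (w : p.submodule) : Module.Dual ℂ p.submodule where
  toFun u := (star (w : Fin 2 → ℂ) ⬝ᵥ (u : Fin 2 → ℂ)) / (star (w : Fin 2 → ℂ) ⬝ᵥ (w : Fin 2 → ℂ))
  map_add' u u' := by rw [Submodule.coe_add, dotProduct_add, add_div]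
  map_smul' c u := by
    rw [Submodule.coe_smul, dotProduct_smul, smul_eq_mul, mul_div_assoc, RingHom.id_apply, smul_eq_mul]

/-- The power of exponent `d` of a vector of a line. -/
def vecPowAt (d : ℤ) (p : RiemannSphere) (w : p.submodule) : SpinFibre d p :=
  PiTensorProduct.tprod ℂ (fun _ => w) ⊗ₜ[ℂ] PiTensorProduct.tprod ℂ (fun _ => dualAt p w)

theorem vecPow_eq (d : ℤ) (v : Fin 2 → ℂ) (hv : v ≠ 0) :
    vecPow d v hv = vecPowAt d (Projectivization.mk ℂ v hv) (lineVec v hv) := rfl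

theorem dualAt_smul (p : RiemannSphere) (w : p.submodule) {c : ℂ} (hc : c ≠ 0) :
    dualAt p (c • w) = c⁻¹ • dualAt p w := by
  ext u
  have hc' : conj c ≠ 0 := (map_ne_zero _).mpr hc
  simp only [dualAt, LinearMap.coe_mk, AddHom.coe_mk, LinearMap.smul_apply, Submodule.coe_smul,
    star_smul, smul_dotProduct, dotProduct_smul, smul_eq_mul, RCLike.star_def]
  rw [mul_left_comm c, mul_div_mul_left _ _ hc', ← div_eq_inv_mul, div_div, mul_comm c]

/-- The dual factor scales by `c⁻¹`. One of the exponents `d.toNat` and `(-d).toNat` is zero, and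
together they yield `c ^ d`. -/
theorem vecPowAt_smul (d : ℤ) (p : RiemannSphere) (w : p.submodule) {c : ℂ} (hc : c ≠ 0) :
    vecPowAt d p (c • w) = c ^ d • vecPowAt d p w := by
  rw [vecPowAt, vecPowAt, dualAt_smul p w hc]
  have h1 := (PiTensorProduct.tprod ℂ (s := fun _ : Fin d.toNat => p.submodule)).map_smul_univ
    (fun _ => c) (fun _ => w)
  have h2 := (PiTensorProduct.tprod ℂ
    (s := fun _ : Fin (-d).toNat => Module.Dual ℂ p.submodule)).map_smul_univ
    (fun _ => c⁻¹) (fun _ => dualAt p w)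
  rw [h1, h2, TensorProduct.smul_tmul_smul]
  congr 1
  simp only [Finset.prod_const, Finset.card_univ, Fintype.card_fin]
  rcases le_total 0 d with h | h
  · obtain ⟨m, rfl⟩ := Int.eq_ofNat_of_zero_le h
    simp
  · obtain ⟨m, hm⟩ := Int.eq_ofNat_of_zero_le (neg_nonneg.mpr h)
    obtain rfl : d = -(m : ℤ) := by omega
    simp

theorem tau_mem (g : SU2) : tau g ∈ (hopf g).submodule := (lineVec (tau g) (tau_ne_zero g)).2

theorem normSq_tau (g : SU2) : Complex.normSq (tau g 0) + Complex.normSq (tau g 1) = 1 :=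
  normSq_entries g

/-- The unit vector in the direction of a non-zero vector of `ℂ²`, as an element of `SU(2)`. -/
theorem normSq_normalize (a b : ℂ) (h : Complex.normSq a + Complex.normSq b ≠ 0) :
    Complex.normSq (((Real.sqrt (Complex.normSq a + Complex.normSq b))⁻¹ : ℝ) * a) +
      Complex.normSq (((Real.sqrt (Complex.normSq a + Complex.normSq b))⁻¹ : ℝ) * b) = 1 := by
  have hpos : 0 ≤ Complex.normSq a + Complex.normSq b :=
    add_nonneg (Complex.normSq_nonneg a) (Complex.normSq_nonneg b)
  rw [Complex.normSq_mul, Complex.normSq_mul, ← mul_add, Complex.normSq_ofReal, ← mul_inv,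
    Real.mul_self_sqrt hpos, inv_mul_cancel₀ h]

theorem normSq_add_ne_zero {v : Fin 2 → ℂ} (hv : v ≠ 0) :
    Complex.normSq (v 0) + Complex.normSq (v 1) ≠ 0 := by
  intro h
  obtain ⟨h0, h1⟩ := (add_eq_zero_iff_of_nonneg (Complex.normSq_nonneg (v 0))
    (Complex.normSq_nonneg (v 1))).mp h
  apply hv
  ext i
  fin_cases i
  · exact Complex.normSq_eq_zero.mp h0
  · exact Complex.normSq_eq_zero.mp h1

/-- The element of `SU(2)` whose first column is the normalization of `v`. -/
def normalize (v : Fin 2 → ℂ) (hv : v ≠ 0) : SU2 :=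
  ofUnit _ _ (normSq_normalize (v 0) (v 1) (normSq_add_ne_zero hv))

theorem tau_normalize (v : Fin 2 → ℂ) (hv : v ≠ 0) : tau (normalize v hv) =
    (((Real.sqrt (Complex.normSq (v 0) + Complex.normSq (v 1)))⁻¹ : ℝ) : ℂ) • v := by
  ext i
  fin_cases i <;> rfl

theorem sqrt_inv_ne_zero {v : Fin 2 → ℂ} (hv : v ≠ 0) :
    (((Real.sqrt (Complex.normSq (v 0) + Complex.normSq (v 1)))⁻¹ : ℝ) : ℂ) ≠ 0 := by
  rw [Complex.ofReal_ne_zero]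
  refine inv_ne_zero (Real.sqrt_ne_zero'.mpr ?_)
  exact lt_of_le_of_ne (add_nonneg (Complex.normSq_nonneg _) (Complex.normSq_nonneg _))
    (normSq_add_ne_zero hv).symm

theorem hopf_normalize (v : Fin 2 → ℂ) (hv : v ≠ 0) :
    hopf (normalize v hv) = Projectivization.mk ℂ v hv := by
  rw [hopf, Projectivization.mk_eq_mk_iff']
  exact ⟨_, (tau_normalize v hv).symm⟩

theorem hopf_surjective : Surjective hopf := fun p =>
  ⟨normalize p.rep p.rep_nonzero, by rw [hopf_normalize, Projectivization.mk_rep]⟩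

/-- The fibres of the Hopf map are the right torus orbits: two unit vectors on one complex line
differ by a phase, and the first column determines the group element. -/
theorem exists_eq_mul_torus {g h : SU2} (hgh : hopf g = hopf h) :
    ∃ (u : ℂ) (hu : Complex.normSq u + Complex.normSq 0 = 1),
      tau g = u • tau h ∧ g = h * ofUnit u 0 hu := by
  rw [hopf, hopf, Projectivization.mk_eq_mk_iff'] at hgh
  obtain ⟨u, hu⟩ := hgh
  have hu1 : Complex.normSq u + Complex.normSq 0 = 1 := by
    have h1 := normSq_tau g
    rw [← hu] at h1
    simp only [Pi.smul_apply, smul_eq_mul, Complex.normSq_mul] at h1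
    rw [← mul_add, normSq_tau, mul_one] at h1
    rw [h1, map_zero, add_zero]
  refine ⟨u, hu1, hu.symm, ?_⟩
  have h00 : (ofUnit u 0 hu1).1 0 0 = u := rfl
  have h10 : (ofUnit u 0 hu1).1 1 0 = 0 := rfl
  apply ext_iff_col
  · rw [mul_entry_zero, h00, h10, mul_zero, sub_zero, mul_comm]
    exact (congrFun hu 0).symm
  · rw [mul_entry_one, h00, h10, mul_zero, add_zero, mul_comm]
    exact (congrFun hu 1).symm

/-- A function on `SU(2)` that transforms under the right torus action like the pullback of a
section of the spin-`d/2` bundle. -/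
def IsEquivariant (d : ℤ) (F : SU2 → ℂ) : Prop :=
  ∀ (g : SU2) (u : ℂ) (hu : Complex.normSq u + Complex.normSq 0 = 1),
    F (g * ofUnit u 0 hu) = u ^ (-d) * F g

/-- The section of the spin-`d/2` bundle that is induced by an equivariant function. -/
def sectionOf (d : ℤ) (F : SU2 → ℂ) (p : RiemannSphere) : SpinFibre d p :=
  F (hopf_surjective p).choose • vecPowAt d p
    ⟨tau (hopf_surjective p).choose,
      (congrArg (fun q : RiemannSphere => tau (hopf_surjective p).choose ∈ q.submodule)
        (hopf_surjective p).choose_spec).mp (tau_mem _)⟩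

/-- Independence of the chosen lift: a phase `u` multiplies `F` by `u ^ (-d)` and the frame by `u ^
d`. Keeping `p` and `w` as variables avoids transport between the fibres over equal points. -/
theorem sectionOf_eq {d : ℤ} {F : SU2 → ℂ} (hF : IsEquivariant d F) (g : SU2) (p : RiemannSphere)
    (hp : hopf g = p) (w : p.submodule) (hw : (w : Fin 2 → ℂ) = tau g) :
    sectionOf d F p = F g • vecPowAt d p w := by
  obtain ⟨u, hu, ht, hg⟩ := exists_eq_mul_torus ((hopf_surjective p).choose_spec.trans hp.symm)
  have hu0 : u ≠ 0 := by rintro rfl; simp at hu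
  have hw' : (⟨tau (hopf_surjective p).choose,
      (congrArg (fun q : RiemannSphere => tau (hopf_surjective p).choose ∈ q.submodule)
        (hopf_surjective p).choose_spec).mp (tau_mem _)⟩ : p.submodule) = u • w := by
    apply Subtype.ext
    rw [Submodule.coe_smul, hw]
    exact ht
  rw [sectionOf, hw', vecPowAt_smul _ _ _ hu0, smul_smul, hg, hF, mul_right_comm, ← zpow_add₀ hu0,
    neg_add_cancel, zpow_zero, one_mul]

theorem isPullback_sectionOf {d : ℤ} {F : SU2 → ℂ} (hF : IsEquivariant d F) :
    IsPullback d (sectionOf d F) F := fun g =>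
  sectionOf_eq hF g (hopf g) rfl (lineVec (tau g) (tau_ne_zero g)) rfl

theorem sectionOf_mk {d : ℤ} {F : SU2 → ℂ} (hF : IsEquivariant d F) (v : Fin 2 → ℂ) (hv : v ≠ 0) :
    sectionOf d F (Projectivization.mk ℂ v hv) = (F (normalize v hv) *
      (((Real.sqrt (Complex.normSq (v 0) + Complex.normSq (v 1)))⁻¹ : ℝ) : ℂ) ^ d) •
        vecPow d v hv := by
  rw [sectionOf_eq hF (normalize v hv) _ (hopf_normalize v hv)
    ((((Real.sqrt (Complex.normSq (v 0) + Complex.normSq (v 1)))⁻¹ : ℝ) : ℂ) • lineVec v hv)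
    (by rw [tau_normalize]; rfl), vecPowAt_smul _ _ _ (sqrt_inv_ne_zero hv), smul_smul, vecPow_eq]

theorem contDiff_zpow_of_ne_zero {f : ℂ → ℝ} (hf : ContDiff ℝ (⊤ : ℕ∞) f) (h0 : ∀ z, f z ≠ 0)
    (d : ℤ) : ContDiff ℝ (⊤ : ℕ∞) fun z => (f z : ℂ) ^ d := by
  have hc : ContDiff ℝ (⊤ : ℕ∞) fun z => (f z : ℂ) := Complex.ofRealCLM.contDiff.comp hf
  obtain ⟨m, rfl | rfl⟩ := d.eq_nat_or_neg
  · simpa only [zpow_natCast] using hc.pow m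
  · simp only [zpow_neg, zpow_natCast]
    exact (hc.pow m).inv fun z => pow_ne_zero m (Complex.ofReal_ne_zero.mpr (h0 z))

/-- The component is `F` at the normalized vector times `|v| ^ (-d)`. It is smooth because `F` is
the restriction of a polynomial and `v` has no zero; treating a general `v` covers both charts. -/
theorem exists_component {Ω : Type*} [MeasurableSpace Ω] {d : ℤ} {n : ℕ} {F : Ω → SU2 → ℂ}
    (hm : Measurable (uncurry F)) (hh : ∀ ω, IsHarmonicPolynomial n (F ω))
    (hF : ∀ ω, IsEquivariant d (F ω)) {v : ℂ → Fin 2 → ℂ} (hv : ∀ ζ, v ζ ≠ 0)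
    (hv0 : ContDiff ℝ (⊤ : ℕ∞) fun ζ => v ζ 0) (hv1 : ContDiff ℝ (⊤ : ℕ∞) fun ζ => v ζ 1) :
    ∃ c : Ω → ℂ → ℂ, Measurable (uncurry c) ∧ (∀ ω, ContDiff ℝ (⊤ : ℕ∞) (c ω)) ∧
      ∀ ω ζ, sectionOf d (F ω) (Projectivization.mk ℂ (v ζ) (hv ζ)) =
        c ω ζ • vecPow d (v ζ) (hv ζ) := by
  have hre0 := Complex.reCLM.contDiff.comp hv0
  have him0 := Complex.imCLM.contDiff.comp hv0
  have hre1 := Complex.reCLM.contDiff.comp hv1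
  have him1 := Complex.imCLM.contDiff.comp hv1
  set r : ℂ → ℝ := fun ζ =>
    (Real.sqrt (Complex.normSq (v ζ 0) + Complex.normSq (v ζ 1)))⁻¹ with hr
  have hr0 (ζ : ℂ) : r ζ ≠ 0 := Complex.ofReal_ne_zero.mp (sqrt_inv_ne_zero (hv ζ))
  have hrs : ContDiff ℝ (⊤ : ℕ∞) r := by
    have hN : ContDiff ℝ (⊤ : ℕ∞) fun ζ => Complex.normSq (v ζ 0) + Complex.normSq (v ζ 1) := by
      simp only [Complex.normSq_apply]
      exact ((hre0.mul hre0).add (him0.mul him0)).add ((hre1.mul hre1).add (him1.mul him1))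
    exact (hN.sqrt fun ζ => normSq_add_ne_zero (hv ζ)).inv fun ζ h => hr0 ζ (by simp only [hr, h, inv_zero])
  have hn : Continuous fun ζ => normalize (v ζ) (hv ζ) := by
    have hrc : Continuous fun ζ => (r ζ : ℂ) := Complex.continuous_ofReal.comp hrs.continuous
    exact continuous_to_SU2 (hrc.mul hv0.continuous) (hrc.mul hv1.continuous)
  have hz := contDiff_zpow_of_ne_zero hrs hr0 d
  refine ⟨fun ω ζ => F ω (normalize (v ζ) (hv ζ)) * (r ζ : ℂ) ^ d, ?_, fun ω => ?_,
    fun ω ζ => sectionOf_mk (hF ω) _ _⟩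
  · have h1 : Measurable fun q : Ω × ℂ => (q.1, normalize (v q.2) (hv q.2)) :=
      measurable_fst.prodMk (hn.measurable.comp measurable_snd)
    exact (hm.comp h1).mul (hz.continuous.measurable.comp measurable_snd)
  · obtain ⟨p, -, -, hp⟩ := hh ω
    have hcoord : ContDiff ℝ (⊤ : ℕ∞) fun ζ => coords (normalize (v ζ) (hv ζ)) := by
      rw [contDiff_euclidean]
      intro i
      have e (ζ : ℂ) : (normalize (v ζ) (hv ζ)).1 0 0 = r ζ * v ζ 0 ∧
        (normalize (v ζ) (hv ζ)).1 1 0 = r ζ * v ζ 1 := ⟨rfl, rfl⟩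
      fin_cases i
      · simpa [coords, e] using hrs.mul hre0
      · simpa [coords, e] using hrs.mul him0
      · simpa [coords, e] using hrs.mul hre1
      · simpa [coords, e] using hrs.mul him1
    have h2 : ContDiff ℝ (⊤ : ℕ∞) fun ζ => F ω (normalize (v ζ) (hv ζ)) := by
      simp only [hp]
      exact (contDiff_evalE p).comp hcoord
    exact h2.mul hz

theorem isRandomSection_sectionOf {Ω : Type*} [MeasurableSpace Ω] {d : ℤ} {n : ℕ}
    {F : Ω → SU2 → ℂ} (hm : Measurable (uncurry F)) (hh : ∀ ω, IsHarmonicPolynomial n (F ω))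
    (hF : ∀ ω, IsEquivariant d (F ω)) : IsRandomSection d fun ω => sectionOf d (F ω) :=
  ⟨exists_component hm hh hF vec_ne_zero_right contDiff_id contDiff_const,
    exists_component hm hh hF vec_ne_zero_left contDiff_const contDiff_id⟩

theorem phi_mul_torus (n : ℕ) (j k : Fin (n + 1)) (g : SU2) (u : ℂ)
    (hu : Complex.normSq u + Complex.normSq 0 = 1) :
    phi n j k (g * ofUnit u 0 hu) = u ^ (-(2 * (k : ℤ) - n)) * phi n j k g := by
  have h := congrFun (congrFun (wignerMatrix_mul n g (ofUnit u 0 hu)) j) k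
  rw [wignerMatrix_torus, Matrix.mul_diagonal] at h
  simp only [wignerMatrix, Matrix.of_apply] at h
  rw [phi_eq, phi_eq, h, neg_sub]
  ring

theorem isEquivariant_columnField {Ω : Type*} (X : Ω → SU2 → ℂ) (n : ℕ) (k : Fin (n + 1))
    (ω : Ω) : IsEquivariant (2 * (k : ℤ) - n) (columnField X n k ω) := by
  intro g u hu
  rw [columnField, columnField, Finset.mul_sum]
  refine Finset.sum_congr rfl fun j _ => ?_
  rw [phi_mul_torus]
  ring

end HypersphereFields

end

noncomputable section

namespace HypersphereFields

/-! ### Fourier coefficients and components of square integrable functions -/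

/-- The Fourier coefficients of a function on `SU(2)`. -/
def coef (f : SU2 → ℂ) (i : Idx) : ℂ := ∫ x, conj (harm i x) * f x ∂vol

/-- The component of degree `n` with given coefficients. -/
def degSum (a : Idx → ℂ) (n : ℕ) (x : SU2) : ℂ := ∑ k, ∑ j, a ⟨⟨n, k⟩, j⟩ * phi n j k x

theorem degreeField_eq {Ω : Type*} (X : Ω → SU2 → ℂ) (n : ℕ) (ω : Ω) (x : SU2) :
    degreeField X n ω x = degSum (coef (X ω)) n x := rfl

theorem l2Class_of_memLp {f : SU2 → ℂ} (hf : MemLp f 2 vol) : l2Class f = hf.toLp f := dif_pos hf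

theorem inner_l2Class {f : SU2 → ℂ} (hf : MemLp f 2 vol) (i : Idx) :
    inner ℂ (harmL2 i) (l2Class f) = coef f i := by
  rw [l2Class_of_memLp hf, inner_harmL2]
  refine integral_congr_ae ?_
  filter_upwards [hf.coeFn_toLp] with x hx
  rw [hx]

theorem l2Class_continuous (f : C(SU2, ℂ)) : l2Class f = contL2 f := by
  have hc := ContinuousMap.coeFn_toLp (p := 2) (𝕜 := ℂ) vol f
  have hf : MemLp f 2 vol := (memLp_congr_ae hc).mp (Lp.memLp _)
  rw [l2Class_of_memLp hf]
  apply Lp.ext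
  filter_upwards [hf.coeFn_toLp, hc] with x h1 h2
  rw [h1, contL2, h2]

/-- The hyperspherical harmonics as continuous functions. -/
def harmC (i : Idx) : C(SU2, ℂ) := ⟨harm i, continuous_harm i⟩

/-- The component of degree `n` as a continuous function. -/
def degC (a : Idx → ℂ) (n : ℕ) : C(SU2, ℂ) := ∑ k : Fin (n + 1), ∑ j, a ⟨⟨n, k⟩, j⟩ • harmC ⟨⟨n, k⟩, j⟩

theorem degC_apply (a : Idx → ℂ) (n : ℕ) (x : SU2) : degC a n x = degSum a n x := by
  simp [degC, degSum, harmC, harm]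

theorem continuous_degSum (a : Idx → ℂ) (n : ℕ) : Continuous (degSum a n) := by
  have : degSum a n = degC a n := funext fun x => (degC_apply a n x).symm
  rw [this]
  exact (degC a n).continuous

theorem l2Class_degSum (a : Idx → ℂ) (n : ℕ) :
    l2Class (degSum a n) = ∑ k : Fin (n + 1), ∑ j, a ⟨⟨n, k⟩, j⟩ • harmL2 ⟨⟨n, k⟩, j⟩ := by
  have : degSum a n = degC a n := funext fun x => (degC_apply a n x).symm
  rw [this, l2Class_continuous, degC]
  simp only [map_sum, map_smul]
  rfl

theorem memLp_degSum (a : Idx → ℂ) (n : ℕ) : MemLp (degSum a n) 2 vol := by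
  have hc := ContinuousMap.coeFn_toLp (p := 2) (𝕜 := ℂ) vol (degC a n)
  have : degSum a n = degC a n := funext fun x => (degC_apply a n x).symm
  rw [this]
  exact (memLp_congr_ae hc).mp (Lp.memLp _)

/-- The coefficients can be recovered from the components, so passing to components loses no
information. -/
theorem inner_harmL2_degSum (a : Idx → ℂ) (i : Idx) :
    inner ℂ (harmL2 i) (l2Class (degSum a i.1.1)) = a i := by
  classical
  obtain ⟨⟨n, k⟩, j⟩ := i
  simp only [l2Class_degSum, inner_sum, inner_smul_right, orthonormal_iff_ite.mp orthonormal_harmL2]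
  rw [Finset.sum_eq_single k, Finset.sum_eq_single j]
  · simp
  · intro j' _ hj
    rw [if_neg, mul_zero]
    intro h
    simp only [Sigma.mk.injEq, heq_eq_eq, true_and] at h
    exact hj h.symm
  · simp
  · intro k' _ hk
    refine Finset.sum_eq_zero fun j' _ => ?_
    rw [if_neg, mul_zero]
    intro h
    simp only [Sigma.mk.injEq, heq_eq_eq, true_and] at h
    exact hk h.1.symm
  · simp

theorem coef_degSum (a : Idx → ℂ) (i : Idx) : coef (degSum a i.1.1) i = a i := by
  rw [← inner_l2Class (memLp_degSum a i.1.1), inner_harmL2_degSum]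

theorem norm_harmL2 (i : Idx) : ‖harmL2 i‖ = 1 := orthonormal_harmL2.1 i

theorem tendsto_eLpNorm_sub_columns {f : SU2 → ℂ} (hf : MemLp f 2 vol) :
    Tendsto (fun F : Finset (Σ n : ℕ, Fin (n + 1)) =>
      eLpNorm (fun x => f x - ∑ p ∈ F, ∑ j, coef f ⟨p, j⟩ * phi p.1 j p.2 x) 2 vol)
      atTop (𝓝 0) := by
  have h1 := hasSum_harmL2 (l2Class f)
  simp only [inner_l2Class hf] at h1
  -- Unconditional summability permits grouping the terms of each column.
  have h2 : HasSum (fun p : Σ n : ℕ, Fin (n + 1) => ∑ j, coef f ⟨p, j⟩ • harmL2 ⟨p, j⟩)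
      (l2Class f) := h1.sigma fun p => hasSum_fintype _
  have h3 : Tendsto (fun F : Finset (Σ n : ℕ, Fin (n + 1)) =>
      ‖l2Class f - ∑ p ∈ F, ∑ j, coef f ⟨p, j⟩ • harmL2 ⟨p, j⟩‖ₑ) atTop (𝓝 0) := by
    have := (tendsto_const_nhds (x := l2Class f)).sub h2
    rw [sub_self] at this
    simpa using this.enorm
  refine h3.congr fun F => ?_
  rw [Lp.enorm_def]
  refine eLpNorm_congr_ae ?_
  have h4 : ∑ p ∈ F, ∑ j, coef f ⟨p, j⟩ • harmL2 ⟨p, j⟩ =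
      contL2 (∑ p ∈ F, ∑ j, coef f ⟨p, j⟩ • harmC ⟨p, j⟩) := by
    simp only [map_sum, map_smul]
    rfl
  rw [h4, l2Class_of_memLp hf]
  filter_upwards [Lp.coeFn_sub (hf.toLp f) (contL2 (∑ p ∈ F, ∑ j, coef f ⟨p, j⟩ • harmC ⟨p, j⟩)),
    hf.coeFn_toLp, ContinuousMap.coeFn_toLp (p := 2) (𝕜 := ℂ) vol
      (∑ p ∈ F, ∑ j, coef f ⟨p, j⟩ • harmC ⟨p, j⟩)] with x e1 e2 e3
  rw [e1, Pi.sub_apply, e2, contL2, e3]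
  simp [harmC, harm]

/-! ### Invariance of the decomposition into degrees -/

/-- The reproducing kernel of the degree `n`, up to a constant. -/
theorem sum_phi_mul_conj_phi (n : ℕ) (x y : SU2) :
    ∑ k, ∑ j, phi n j k x * conj (phi n j k y) =
      phiFactor n ^ 2 * (wignerMatrix n (x * y⁻¹)).trace := by
  rw [wignerMatrix_mul, wignerMatrix_inv, Matrix.trace, Finset.mul_sum, Finset.sum_comm]
  refine Finset.sum_congr rfl fun j _ => ?_
  rw [Matrix.diag_apply, Matrix.mul_apply, Finset.mul_sum]
  refine Finset.sum_congr rfl fun k _ => ?_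
  rw [phi_eq, phi_eq, map_mul, conj_phiFactor]
  simp only [wignerMatrix, Matrix.of_apply, Matrix.conjTranspose_apply, RCLike.star_def]
  ring

/-- The kernel is a character evaluated at `x y⁻¹`. A translation from the right cancels there, and
one from the left conjugates the argument, which the trace does not see. -/
theorem sum_phi_mul_conj_phi_bi (n : ℕ) (g h x y : SU2) :
    ∑ k, ∑ j, phi n j k (g⁻¹ * x * h) * conj (phi n j k (g⁻¹ * y * h)) =
      ∑ k, ∑ j, phi n j k x * conj (phi n j k y) := by
  rw [sum_phi_mul_conj_phi, sum_phi_mul_conj_phi,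
    show g⁻¹ * x * h * (g⁻¹ * y * h)⁻¹ = g⁻¹ * ((x * y⁻¹) * g) by group, wignerMatrix_mul,
    wignerMatrix_mul n (x * y⁻¹) g, Matrix.trace_mul_comm, Matrix.mul_assoc, ← wignerMatrix_mul,
    mul_inv_cancel, wignerMatrix_one, Matrix.mul_one]

theorem degSum_coef {f : SU2 → ℂ} (hf : Integrable f vol) (n : ℕ) (x : SU2) :
    degSum (coef f) n x = ∫ y, (∑ k, ∑ j, phi n j k x * conj (phi n j k y)) * f y ∂vol := by
  have hint (j k : Fin (n + 1)) :
      Integrable (fun y => phi n j k x * (conj (phi n j k y) * f y)) vol := by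
    have hc : Continuous fun y => conj (phi n j k y) :=
      Complex.continuous_conj.comp (continuous_phi n j k)
    obtain ⟨C, hC⟩ := (isCompact_univ (X := SU2)).exists_bound_of_continuousOn hc.continuousOn
    exact (hf.bdd_mul hc.aestronglyMeasurable
      (ae_of_all _ fun y => hC y (Set.mem_univ y))).const_mul _
  simp only [Finset.sum_mul, mul_assoc]
  rw [integral_finsetSum _ fun k _ => integrable_finsetSum _ fun j _ => hint j k]
  refine Finset.sum_congr rfl fun k _ => ?_
  rw [integral_finsetSum _ fun j _ => hint j k]
  refine Finset.sum_congr rfl fun j _ => ?_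
  rw [integral_const_mul, mul_comm]
  rfl

theorem degSum_coef_bi {f : SU2 → ℂ} (hf : Integrable f vol) (n : ℕ) (g h x : SU2) :
    degSum (coef f) n (g⁻¹ * x * h) = degSum (coef fun y => f (g⁻¹ * y * h)) n x := by
  have hf' : Integrable (fun y => f (g⁻¹ * y * h)) vol :=
    (measurePreserving_bi g h).integrable_comp_of_integrable hf
  rw [degSum_coef hf, degSum_coef hf', ← integral_bi g h]
  simp only [sum_phi_mul_conj_phi_bi]

end HypersphereFields

end

noncomputable section

namespace HypersphereFields

/-! ### Equivalent forms of invariance -/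

theorem identDistrib_congr {α β γ : Type*} [MeasurableSpace α] [MeasurableSpace β]
    [MeasurableSpace γ] {μ : Measure α} {ν : Measure β} {f f' : α → γ} {g g' : β → γ}
    (h : IdentDistrib f g μ ν) (hf : f =ᵐ[μ] f') (hg : g =ᵐ[ν] g') : IdentDistrib f' g' μ ν :=
  (IdentDistrib.of_ae_eq h.aemeasurable_fst hf).symm.trans
    (h.trans (IdentDistrib.of_ae_eq h.aemeasurable_snd hg))

/-- Under a measurable embedding the image law determines the law; this is how the different notions
of invariance are compared. -/
theorem identDistrib_of_measurableEmbedding {α β γ δ : Type*} [MeasurableSpace α]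
    [MeasurableSpace β] [MeasurableSpace γ] [MeasurableSpace δ] {μ : Measure α} {ν : Measure β}
    {f : α → γ} {g : β → γ} {Φ : γ → δ} (hΦ : MeasurableEmbedding Φ)
    (h : IdentDistrib (fun a => Φ (f a)) (fun b => Φ (g b)) μ ν) : IdentDistrib f g μ ν := by
  have hf : AEMeasurable f μ := hΦ.aemeasurable_comp_iff.mp h.aemeasurable_fst
  have hg : AEMeasurable g ν := hΦ.aemeasurable_comp_iff.mp h.aemeasurable_snd
  refine ⟨hf, hg, ?_⟩
  have h1 : (μ.map f).map Φ = (ν.map g).map Φ := by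
    rw [AEMeasurable.map_map_of_aemeasurable hΦ.measurable.aemeasurable hf,
      AEMeasurable.map_map_of_aemeasurable hΦ.measurable.aemeasurable hg]
    exact h.map_eq
  have h2 := congrArg (Measure.comap Φ) h1
  rwa [hΦ.comap_map, hΦ.comap_map] at h2

theorem exists_eq_bi {side : Side} {φ : SU2 → SU2} (hφ : φ ∈ translations side) :
    ∃ g h : SU2, φ = fun x => g⁻¹ * x * h := by
  cases side with
  | left =>
    obtain ⟨g, rfl⟩ := hφ
    exact ⟨g, 1, by simp⟩
  | right =>
    obtain ⟨g, rfl⟩ := hφ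
    exact ⟨1, g, by simp⟩
  | bi => exact hφ

/-- The map taking an element of `L²` to its Fourier coefficients. -/
def coefMap (u : Lp ℂ 2 vol) (i : Idx) : ℂ := inner ℂ (harmL2 i) u

theorem continuous_coefMap : Continuous coefMap :=
  continuous_pi fun _ => continuous_const.inner continuous_id

theorem injective_coefMap : Injective coefMap := by
  intro u v huv
  have hu := hasSum_harmL2 u
  have hv := hasSum_harmL2 v
  have : (fun i => (inner ℂ (harmL2 i) u : ℂ) • harmL2 i) =
      fun i => (inner ℂ (harmL2 i) v : ℂ) • harmL2 i :=
    funext fun i => by rw [show inner ℂ (harmL2 i) u = inner ℂ (harmL2 i) v from congrFun huv i]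
  rw [this] at hu
  exact hu.unique hv

/-- A continuous injection from a Polish space into this countable product is a measurable
embedding, by the Lusin-Souslin theorem. -/
theorem measurableEmbedding_coefMap : MeasurableEmbedding coefMap :=
  continuous_coefMap.measurableEmbedding injective_coefMap

theorem coefMap_l2Class {f : SU2 → ℂ} (hf : MemLp f 2 vol) : coefMap (l2Class f) = coef f :=
  funext fun i => inner_l2Class hf i

theorem continuous_degSum_left (n : ℕ) (x : SU2) : Continuous fun a : Idx → ℂ => degSum a n x :=
  continuous_finsetSum _ fun _ _ => continuous_finsetSum _ fun _ _ =>
    (continuous_apply _).mul continuous_const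

/-- The values of the components at the points of a countable dense set. -/
def denseValues (a : Idx → ℂ) (q : ℕ × Set.range (TopologicalSpace.denseSeq SU2)) : ℂ :=
  degSum a q.1 q.2

/-- The components are continuous, so their values on a dense set determine them and hence the
coefficients. Countability of that set makes the target second countable, with its product σ-algebra
the Borel one. -/
theorem measurableEmbedding_denseValues : MeasurableEmbedding denseValues := by
  have : Countable (Set.range (TopologicalSpace.denseSeq SU2)) := (Set.countable_range _).to_subtype
  have hc : Continuous denseValues := continuous_pi fun q => continuous_degSum_left q.1 q.2
  refine hc.measurableEmbedding fun a b hab => funext fun i => ?_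
  rw [← coef_degSum a i, ← coef_degSum b i]
  congr 1
  refine Continuous.ext_on (TopologicalSpace.denseRange_denseSeq SU2) (continuous_degSum a i.1.1)
    (continuous_degSum b i.1.1) ?_
  intro x hx
  exact congrFun hab (i.1.1, ⟨x, hx⟩)

section

variable {Ω : Type*} [MeasurableSpace Ω] {P : Measure Ω} {X : Ω → SU2 → ℂ}

theorem memLp_bi {f : SU2 → ℂ} (hf : MemLp f 2 vol) (g h : SU2) :
    MemLp (fun x => f (g⁻¹ * x * h)) 2 vol :=
  hf.comp_measurePreserving (measurePreserving_bi g h)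

theorem degreeField_bi (hL2 : ∀ᵐ ω ∂P, MemLp (X ω) 2 vol) (g h : SU2) :
    ∀ᵐ ω ∂P, ∀ n x, degreeField X n ω (g⁻¹ * x * h) =
      degSum (coef fun y => X ω (g⁻¹ * y * h)) n x := by
  filter_upwards [hL2] with ω hω n x
  rw [degreeField_eq, degSum_coef_bi (hω.integrable (by norm_num))]

/-- The Fourier coefficients of `X` and of its translate have the same joint law. -/
def CoefInvariant (P : Measure Ω) (X : Ω → SU2 → ℂ) (g h : SU2) : Prop :=
  IdentDistrib (fun ω => coef fun x => X ω (g⁻¹ * x * h)) (fun ω => coef (X ω)) P P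

theorem identDistrib_l2Class_iff (hL2 : ∀ᵐ ω ∂P, MemLp (X ω) 2 vol) (g h : SU2) :
    IdentDistrib (fun ω (_ : Unit) => l2Class fun x => X ω (g⁻¹ * x * h))
      (fun ω (_ : Unit) => l2Class (X ω)) P P ↔ CoefInvariant P X g h := by
  have e1 : (fun ω => coefMap (l2Class fun x => X ω (g⁻¹ * x * h))) =ᵐ[P]
      fun ω => coef fun x => X ω (g⁻¹ * x * h) := by
    filter_upwards [hL2] with ω hω
    exact coefMap_l2Class (memLp_bi hω g h)
  have e2 : (fun ω => coefMap (l2Class (X ω))) =ᵐ[P] fun ω => coef (X ω) := by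
    filter_upwards [hL2] with ω hω
    exact coefMap_l2Class hω
  constructor
  · intro hI
    refine identDistrib_congr (hI.comp (u := fun u : Unit → Lp ℂ 2 vol => coefMap (u ())) ?_) e1 e2
    exact continuous_coefMap.measurable.comp (measurable_pi_apply _)
  · intro hI
    have := identDistrib_of_measurableEmbedding measurableEmbedding_coefMap
      (identDistrib_congr hI e1.symm e2.symm)
    exact this.comp (u := fun (u : Lp ℂ 2 vol) (_ : Unit) => u)
      (measurable_pi_lambda _ fun _ => measurable_id)

theorem identDistrib_l2Class_degreeField_iff (hL2 : ∀ᵐ ω ∂P, MemLp (X ω) 2 vol) (g h : SU2) :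
    IdentDistrib (fun ω n => l2Class fun x => degreeField X n ω (g⁻¹ * x * h))
      (fun ω n => l2Class (degreeField X n ω)) P P ↔ CoefInvariant P X g h := by
  have e1 : (fun ω n => l2Class (degSum (coef fun x => X ω (g⁻¹ * x * h)) n)) =ᵐ[P]
      fun ω n => l2Class fun x => degreeField X n ω (g⁻¹ * x * h) := by
    filter_upwards [degreeField_bi hL2 g h] with ω hω
    funext n
    congr 1
    funext x
    exact (hω n x).symm
  constructor
  · intro hI
    have h1 := (identDistrib_congr hI e1.symm (ae_eq_refl _)).comp
      (u := fun (u : ℕ → Lp ℂ 2 vol) (i : Idx) => coefMap (u i.1.1) i)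
      (measurable_pi_lambda _ fun i => ((measurable_pi_apply i).comp
        continuous_coefMap.measurable).comp (measurable_pi_apply _))
    refine identDistrib_congr h1 (Eventually.of_forall fun ω => ?_)
      (Eventually.of_forall fun ω => ?_)
    · exact funext fun i => inner_harmL2_degSum _ i
    · exact funext fun i => inner_harmL2_degSum (coef (X ω)) i
  · intro hI
    have hm : Measurable fun (a : Idx → ℂ) n => l2Class (degSum a n) := by
      refine measurable_pi_lambda _ fun n => Continuous.measurable ?_
      simp only [l2Class_degSum]
      exact continuous_finsetSum _ fun _ _ => continuous_finsetSum _ fun _ _ =>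
        (continuous_apply _).smul continuous_const
    exact identDistrib_congr (hI.comp hm) e1 (ae_eq_refl _)

/-- In one direction, restricting to countably many points already recovers the law of the
coefficients; in the other, each value of a component is a continuous function of the coefficients.
-/
theorem identDistrib_degreeField_iff (hL2 : ∀ᵐ ω ∂P, MemLp (X ω) 2 vol) (g h : SU2) :
    IdentDistrib (fun ω (q : ℕ × SU2) => degreeField X q.1 ω (g⁻¹ * q.2 * h))
      (fun ω (q : ℕ × SU2) => degreeField X q.1 ω q.2) P P ↔ CoefInvariant P X g h := by
  have e1 : (fun ω (q : ℕ × SU2) => degSum (coef fun x => X ω (g⁻¹ * x * h)) q.1 q.2) =ᵐ[P]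
      fun ω (q : ℕ × SU2) => degreeField X q.1 ω (g⁻¹ * q.2 * h) := by
    filter_upwards [degreeField_bi hL2 g h] with ω hω
    funext q
    exact (hω q.1 q.2).symm
  constructor
  · intro hI
    refine identDistrib_of_measurableEmbedding measurableEmbedding_denseValues ?_
    exact (identDistrib_congr hI e1.symm (ae_eq_refl _)).comp
      (u := fun (f : ℕ × SU2 → ℂ) (q : ℕ × Set.range (TopologicalSpace.denseSeq SU2)) =>
        f (q.1, q.2)) (measurable_pi_lambda _ fun _ => measurable_pi_apply _)
  · intro hI
    have hm : Measurable fun (a : Idx → ℂ) (q : ℕ × SU2) => degSum a q.1 q.2 :=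
      measurable_pi_lambda _ fun q => (continuous_degSum_left q.1 q.2).measurable
    exact identDistrib_congr (hI.comp hm) e1 (ae_eq_refl _)

theorem measurable_fourierCoeff (hX : Measurable (uncurry X)) (n : ℕ) (j k : Fin (n + 1)) :
    Measurable (fourierCoeff X n j k) := by
  have hm : Measurable (uncurry fun ω x => conj (phi n j k x) * X ω x) :=
    ((Complex.continuous_conj.comp (continuous_phi n j k)).measurable.comp measurable_snd).mul hX
  exact (hm.stronglyMeasurable.integral_prod_right (ν := vol)).measurable

theorem measurable_coef (hX : Measurable (uncurry X)) : Measurable fun ω => coef (X ω) :=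
  measurable_pi_lambda _ fun i => measurable_fourierCoeff hX i.1.1 i.2 i.1.2

theorem measurable_columnField (hX : Measurable (uncurry X)) (n : ℕ) (k : Fin (n + 1)) :
    Measurable (uncurry (columnField X n k)) := by
  have : uncurry (columnField X n k) =
      fun q : Ω × SU2 => ∑ j, fourierCoeff X n j k q.1 * phi n j k q.2 := rfl
  rw [this]
  exact Finset.measurable_fun_sum _ fun j _ =>
    ((measurable_fourierCoeff hX n j k).comp measurable_fst).mul
      ((continuous_phi n j k).measurable.comp measurable_snd)

theorem measurable_degreeField (hX : Measurable (uncurry X)) (n : ℕ) :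
    Measurable (uncurry (degreeField X n)) := by
  have : uncurry (degreeField X n) =
      fun q : Ω × SU2 => ∑ k, uncurry (columnField X n k) q := rfl
  rw [this]
  exact Finset.measurable_fun_sum _ fun k _ => measurable_columnField hX n k

theorem measurable_bi (hX : Measurable (uncurry X)) (g h : SU2) :
    Measurable (uncurry fun ω x => X ω (g⁻¹ * x * h)) :=
  hX.comp (measurable_fst.prodMk ((measurePreserving_bi g h).measurable.comp measurable_snd))

end

end HypersphereFields

end

noncomputable section

namespace HypersphereFields

/-! ### Limits of identically distributed random variables -/

/-- Finite Borel measures on a pseudo-metrizable space are determined by integrals of bounded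
continuous functions, and these pass to the limit by dominated convergence. -/
theorem identDistrib_of_tendsto {α E : Type*} [MeasurableSpace α] {μ : Measure α}
    [IsProbabilityMeasure μ] [TopologicalSpace E] [TopologicalSpace.PseudoMetrizableSpace E]
    [MeasurableSpace E] [BorelSpace E] {Z Z' : ℕ → α → E} {Y Y' : α → E}
    (h : ∀ N, IdentDistrib (Z N) (Z' N) μ μ)
    (hZ : ∀ᵐ a ∂μ, Tendsto (fun N => Z N a) atTop (𝓝 (Y a)))
    (hZ' : ∀ᵐ a ∂μ, Tendsto (fun N => Z' N a) atTop (𝓝 (Y' a))) : IdentDistrib Y Y' μ μ := by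
  have hY := aemeasurable_of_tendsto_metrizable_ae atTop (fun N => (h N).aemeasurable_fst) hZ
  have hY' := aemeasurable_of_tendsto_metrizable_ae atTop (fun N => (h N).aemeasurable_snd) hZ'
  refine ⟨hY, hY', ?_⟩
  have := Measure.isProbabilityMeasure_map hY
  have := Measure.isProbabilityMeasure_map hY'
  refine ext_of_forall_integral_eq_of_IsFiniteMeasure fun f => ?_
  have hfm : Measurable f := f.continuous.measurable
  rw [integral_map hY hfm.aestronglyMeasurable, integral_map hY' hfm.aestronglyMeasurable]
  have hlim {Z : ℕ → α → E} {Y : α → E} (hm : ∀ N, AEMeasurable (Z N) μ)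
      (hZ : ∀ᵐ a ∂μ, Tendsto (fun N => Z N a) atTop (𝓝 (Y a))) :
      Tendsto (fun N => ∫ a, f (Z N a) ∂μ) atTop (𝓝 (∫ a, f (Y a) ∂μ)) := by
    refine tendsto_integral_of_dominated_convergence (fun _ => ‖f‖)
      (fun N => (hfm.comp_aemeasurable (hm N)).aestronglyMeasurable) (integrable_const _)
      (fun N => ae_of_all _ fun a => f.norm_coe_le_norm _) ?_
    filter_upwards [hZ] with a ha
    exact (f.continuous.tendsto _).comp ha
  refine tendsto_nhds_unique (hlim (fun N => (h N).aemeasurable_fst) hZ) ?_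
  refine (hlim (fun N => (h N).aemeasurable_snd) hZ').congr fun N => ?_
  exact ((h N).comp hfm).integral_eq.symm

/-! ### Fourier coefficients by random sampling -/

/-- The normalized volume. -/
def unifProb : Measure SU2 := (vol Set.univ)⁻¹ • vol

instance : NeZero vol := ⟨by
  intro h
  have := vol_univ
  rw [h, Measure.coe_zero, Pi.zero_apply, eq_comm, ENNReal.ofReal_eq_zero] at this
  have := Real.pi_pos
  nlinarith⟩

instance : IsProbabilityMeasure unifProb := isProbabilityMeasureSMul

/-- The law of a sequence of independent uniformly distributed points. -/
def sampleLaw : Measure (ℕ → SU2) := Measure.infinitePi fun _ : ℕ => unifProb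

instance : IsProbabilityMeasure sampleLaw := by unfold sampleLaw; infer_instance

/-- The approximation of the Fourier coefficients of `f` by the mean over `N` sample points. -/
def sampleCoef (f : SU2 → ℂ) (N : ℕ) (U : ℕ → SU2) (i : Idx) : ℂ :=
  (N : ℝ)⁻¹ • ∑ k ∈ Finset.range N, (vol.real Set.univ : ℂ) * (conj (harm i (U k)) * f (U k))

/-- The strong law of large numbers for the integrand at independent uniform points; the factor
`vol.real univ` undoes the normalization of the volume. -/
theorem tendsto_sampleCoef {f : SU2 → ℂ} (hfm : Measurable f) (hf : MemLp f 2 vol) (i : Idx) :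
    ∀ᵐ U ∂sampleLaw, Tendsto (fun N => sampleCoef f N U i) atTop (𝓝 (coef f i)) := by
  set w : SU2 → ℂ := fun x => (vol.real Set.univ : ℂ) * (conj (harm i x) * f x) with hw
  have hc : Continuous fun x => conj (harm i x) :=
    Complex.continuous_conj.comp (continuous_harm i)
  have hwm : Measurable w := (hc.measurable.mul hfm).const_mul _
  have hwi : Integrable w vol := by
    obtain ⟨C, hC⟩ := (isCompact_univ (X := SU2)).exists_bound_of_continuousOn hc.continuousOn
    exact ((hf.integrable (by norm_num)).bdd_mul hc.aestronglyMeasurable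
      (ae_of_all _ fun y => hC y (Set.mem_univ y))).const_mul _
  have hwi' : Integrable w unifProb :=
    hwi.smul_measure (ENNReal.inv_ne_top.mpr (NeZero.ne _))
  have hmp (k : ℕ) : MeasurePreserving (fun U : ℕ → SU2 => U k) sampleLaw unifProb :=
    measurePreserving_eval_infinitePi (fun _ => unifProb) k
  have hlaw := strong_law_ae (μ := sampleLaw) (fun k (U : ℕ → SU2) => w (U k))
    ((hmp 0).integrable_comp_of_integrable hwi')
    (fun k l hkl => (iIndepFun_infinitePi (P := fun _ : ℕ => unifProb)
      (X := fun _ => w) fun _ => hwm).indepFun hkl)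
    (fun k => ⟨(hwm.comp (hmp k).measurable).aemeasurable,
      (hwm.comp (hmp 0).measurable).aemeasurable, by
        have e (k : ℕ) : sampleLaw.map (fun U => w (U k)) = unifProb.map w := by
          rw [← (hmp k).map_eq, Measure.map_map hwm (hmp k).measurable]; rfl
        rw [e, e]⟩)
  have hint : ∫ U, w (U 0) ∂sampleLaw = coef f i := by
    have h0 := (hmp 0).map_eq
    have h1 : ∫ U, w (U 0) ∂sampleLaw = ∫ x, w x ∂unifProb := by
      rw [← h0, integral_map (hmp 0).measurable.aemeasurable hwm.aestronglyMeasurable]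
    have hM : (vol.real Set.univ : ℂ) ≠ 0 := by
      rw [Complex.ofReal_ne_zero]
      exact (measureReal_ne_zero_iff).mpr (NeZero.ne _)
    rw [h1, unifProb, integral_smul_measure, hw, integral_const_mul, ENNReal.toReal_inv]
    change ((vol.real Set.univ)⁻¹ : ℝ) • ((vol.real Set.univ : ℂ) * coef f i) = _
    rw [Complex.real_smul, Complex.ofReal_inv, inv_mul_cancel_left₀ hM]
  rw [hint] at hlaw
  exact hlaw

section

variable {Ω : Type*} [MeasurableSpace Ω] {P : Measure Ω} {X : Ω → SU2 → ℂ}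

theorem measurable_sampleCoef (hX : Measurable (uncurry X)) (N : ℕ) :
    Measurable fun q : Ω × (ℕ → SU2) => sampleCoef (X q.1) N q.2 := by
  refine measurable_pi_lambda _ fun i => ?_
  refine Measurable.const_smul (Finset.measurable_fun_sum _ fun k _ => ?_) ((N : ℝ)⁻¹)
  have hk : Measurable fun q : Ω × (ℕ → SU2) => q.2 k :=
    (measurable_pi_apply k).comp measurable_snd
  have hc : Continuous fun x => conj (harm i x) :=
    Complex.continuous_conj.comp (continuous_harm i)
  exact ((hc.measurable.comp hk).mul (hX.comp (measurable_fst.prodMk hk))).const_mul _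

theorem tendsto_sampleCoef_prod (hX : Measurable (uncurry X))
    (hL2 : ∀ᵐ ω ∂P, MemLp (X ω) 2 vol) :
    ∀ᵐ q ∂P.prod sampleLaw, Tendsto (fun N => sampleCoef (X q.1) N q.2) atTop
      (𝓝 (coef (X q.1))) := by
  simp only [tendsto_pi_nhds]
  rw [ae_all_iff]
  intro i
  have hm : MeasurableSet {q : Ω × (ℕ → SU2) | Tendsto (fun N => sampleCoef (X q.1) N q.2 i) atTop
      (𝓝 (coef (X q.1) i))} :=
    measurableSet_tendsto_fun (fun N => (measurable_pi_apply i).comp (measurable_sampleCoef hX N))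
      (((measurable_pi_apply i).comp (measurable_coef hX)).comp measurable_fst)
  rw [Measure.ae_prod_iff_ae_ae hm]
  filter_upwards [hL2] with ω hω
  exact tendsto_sampleCoef (hX.comp measurable_prodMk_left) hω i

theorem measurable_sampleCoef_apply (N : ℕ) (U : ℕ → SU2) :
    Measurable fun f : Unit × SU2 → ℂ => sampleCoef (fun x => f ((), x)) N U := by
  refine measurable_pi_lambda _ fun i => ?_
  have hk (k : ℕ) : Measurable fun f : Unit × SU2 → ℂ => f ((), U k) := measurable_pi_apply _
  have hs : Measurable fun f : Unit × SU2 → ℂ => ∑ k ∈ Finset.range N,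
      (vol.real Set.univ : ℂ) * (conj (harm i (U k)) * f ((), U k)) :=
    Finset.measurable_fun_sum _ fun k _ => ((hk k).const_mul _).const_mul _
  exact hs.const_smul ((N : ℝ)⁻¹)

/-- For fixed sample points the average involves finitely many values of the field, so its law is
given by the hypothesis. The sample is independent of the field, and integrating over it preserves
the equality. -/
theorem identDistrib_sampleCoef [IsProbabilityMeasure P] {X' : Ω → SU2 → ℂ}
    (hX' : Measurable (uncurry X')) (hX : Measurable (uncurry X))
    (hI : IdentDistrib (fun ω (q : Unit × SU2) => X' ω q.2) (fun ω (q : Unit × SU2) => X ω q.2) P P)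
    (N : ℕ) :
    IdentDistrib (fun q : Ω × (ℕ → SU2) => sampleCoef (X' q.1) N q.2)
      (fun q : Ω × (ℕ → SU2) => sampleCoef (X q.1) N q.2) (P.prod sampleLaw)
      (P.prod sampleLaw) := by
  have hc (U : ℕ → SU2) : IdentDistrib (fun ω => sampleCoef (X' ω) N U)
      (fun ω => sampleCoef (X ω) N U) P P := hI.comp (measurable_sampleCoef_apply N U)
  have m1 := measurable_sampleCoef hX' N
  have m2 := measurable_sampleCoef hX N
  refine ⟨m1.aemeasurable, m2.aemeasurable, ?_⟩
  ext s hs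
  rw [Measure.map_apply m1 hs, Measure.map_apply m2 hs, Measure.prod_apply_symm (m1 hs),
    Measure.prod_apply_symm (m2 hs)]
  refine lintegral_congr fun U => ?_
  exact (hc U).measure_mem_eq hs

theorem identDistrib_of_comp_fst {α β : Type*} [MeasurableSpace α] [MeasurableSpace β]
    {ν : Measure α} [IsProbabilityMeasure ν] [IsProbabilityMeasure P] {Y Z : Ω → β}
    (hY : Measurable Y) (hZ : Measurable Z)
    (h : IdentDistrib (fun q : Ω × α => Y q.1) (fun q : Ω × α => Z q.1) (P.prod ν) (P.prod ν)) :
    IdentDistrib Y Z P P := by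
  refine ⟨hY.aemeasurable, hZ.aemeasurable, ?_⟩
  rw [← (measurePreserving_fst (μ := P) (ν := ν)).map_eq, Measure.map_map hY measurable_fst,
    Measure.map_map hZ measurable_fst]
  exact h.map_eq

theorem identDistrib_coef_of_pointwise [IsProbabilityMeasure P] {X' : Ω → SU2 → ℂ}
    (hX' : Measurable (uncurry X')) (hX : Measurable (uncurry X))
    (hL2' : ∀ᵐ ω ∂P, MemLp (X' ω) 2 vol) (hL2 : ∀ᵐ ω ∂P, MemLp (X ω) 2 vol)
    (hI : IdentDistrib (fun ω (q : Unit × SU2) => X' ω q.2)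
      (fun ω (q : Unit × SU2) => X ω q.2) P P) :
    IdentDistrib (fun ω => coef (X' ω)) (fun ω => coef (X ω)) P P := by
  have t1 := tendsto_sampleCoef_prod hX' hL2'
  have t2 := tendsto_sampleCoef_prod hX hL2
  have hlim : IdentDistrib (fun q : Ω × (ℕ → SU2) => coef (X' q.1))
      (fun q : Ω × (ℕ → SU2) => coef (X q.1)) (P.prod sampleLaw) (P.prod sampleLaw) :=
    identDistrib_of_tendsto (identDistrib_sampleCoef hX' hX hI) t1 t2
  exact identDistrib_of_comp_fst (measurable_coef hX') (measurable_coef hX) hlim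

theorem coefInvariant_of_pointwise [IsProbabilityMeasure P] (hX : Measurable (uncurry X))
    (hL2 : ∀ᵐ ω ∂P, MemLp (X ω) 2 vol) (g h : SU2)
    (hI : IdentDistrib (fun ω (q : Unit × SU2) => X ω (g⁻¹ * q.2 * h))
      (fun ω (q : Unit × SU2) => X ω q.2) P P) : CoefInvariant P X g h := by
  have hL2' : ∀ᵐ ω ∂P, MemLp (fun x => X ω (g⁻¹ * x * h)) 2 vol := by
    filter_upwards [hL2] with ω hω
    exact memLp_bi hω g h
  exact identDistrib_coef_of_pointwise (measurable_bi hX g h) hX hL2' hL2 hI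

/-! ### Fields that are continuous in probability -/

/-- The partial sums of the decomposition into degrees. -/
def partialField (X : Ω → SU2 → ℂ) (N : ℕ) (ω : Ω) (x : SU2) : ℂ :=
  ∑ n ∈ Finset.range N, degreeField X n ω x

theorem measurable_partialField (hX : Measurable (uncurry X)) (N : ℕ) :
    Measurable (uncurry (partialField X N)) := by
  have : uncurry (partialField X N) =
      fun q : Ω × SU2 => ∑ n ∈ Finset.range N, uncurry (degreeField X n) q := rfl
  rw [this]
  exact Finset.measurable_fun_sum _ fun n _ => measurable_degreeField hX n

theorem tendsto_eLpNorm_sub_partialField {f : SU2 → ℂ} (hf : MemLp f 2 vol) :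
    Tendsto (fun N : ℕ => eLpNorm (fun x => f x - ∑ n ∈ Finset.range N, degSum (coef f) n x) 2 vol)
      atTop (𝓝 0) := by
  have h1 := tendsto_eLpNorm_sub_columns hf
  -- The sets of all columns of degree less than `N` are cofinal among the finite sets of columns.
  have h2 : Tendsto (fun N : ℕ => (Finset.range N).sigma fun n =>
      (Finset.univ : Finset (Fin (n + 1)))) atTop atTop := by
    refine tendsto_atTop_finset_of_monotone ?_ fun p => ⟨p.1 + 1, by simp⟩
    intro a b hab p hp
    simp only [Finset.mem_sigma, Finset.mem_range, Finset.mem_univ, and_true] at hp ⊢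
    omega
  refine (h1.comp h2).congr fun N => ?_
  simp only [Function.comp_apply, Finset.sum_sigma]
  rfl

/-- By Fubini, the measure of the exceptional set in the product is the mean of the measures of its
slices, which tend to zero and are bounded by the mass of `ν`. -/
theorem tendstoInMeasure_prod {α : Type*} [MeasurableSpace α] {ν : Measure α} [IsFiniteMeasure ν]
    [IsProbabilityMeasure P] {F : ℕ → Ω → α → ℂ} {Y : Ω → α → ℂ}
    (hF : ∀ N, Measurable (uncurry (F N))) (hY : Measurable (uncurry Y))
    (h : ∀ᵐ ω ∂P, TendstoInMeasure ν (fun N => F N ω) atTop (Y ω)) :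
    TendstoInMeasure (P.prod ν) (fun N => uncurry (F N)) atTop (uncurry Y) := by
  intro ε hε
  have hset (N : ℕ) : MeasurableSet {q : Ω × α | ε ≤ edist (uncurry (F N) q) (uncurry Y q)} :=
    measurableSet_le measurable_const ((hF N).edist hY)
  have hprod (N : ℕ) : P.prod ν {q : Ω × α | ε ≤ edist (uncurry (F N) q) (uncurry Y q)} =
      ∫⁻ ω, ν {x | ε ≤ edist (F N ω x) (Y ω x)} ∂P := Measure.prod_apply (hset N)
  have hmeas (N : ℕ) : Measurable fun ω => ν {x | ε ≤ edist (F N ω x) (Y ω x)} :=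
    measurable_measure_prodMk_left (hset N)
  have hlim : Tendsto (fun N => ∫⁻ ω, ν {x | ε ≤ edist (F N ω x) (Y ω x)} ∂P) atTop
      (𝓝 (∫⁻ _, 0 ∂P)) := by
    refine tendsto_lintegral_of_dominated_convergence (fun _ => ν Set.univ) hmeas
      (fun N => ae_of_all _ fun ω => measure_mono (Set.subset_univ _)) ?_ ?_
    · rw [lintegral_const, measure_univ (μ := P), mul_one]
      exact measure_ne_top _ _
    · filter_upwards [h] with ω hω
      exact hω ε hε
  rw [lintegral_zero] at hlim
  exact hlim.congr fun N => (hprod N).symm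

theorem tendstoInMeasure_partialField (hX : Measurable (uncurry X)) {ω : Ω}
    (hω : MemLp (X ω) 2 vol) :
    TendstoInMeasure vol (fun N => partialField X N ω) atTop (X ω) := by
  have hω' : Tendsto (fun N => eLpNorm (partialField X N ω - X ω) 2 vol) atTop (𝓝 0) := by
    refine (tendsto_eLpNorm_sub_partialField hω).congr fun N => ?_
    rw [← eLpNorm_neg]
    congr 1
    funext x
    simp [partialField, degreeField_eq]
  exact tendstoInMeasure_of_tendsto_eLpNorm two_ne_zero
    (fun N => ((measurable_partialField hX N).comp measurable_prodMk_left).aestronglyMeasurable)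
    hω.aestronglyMeasurable hω'

theorem exists_subseq_partialField [IsProbabilityMeasure P] (hX : Measurable (uncurry X))
    (hL2 : ∀ᵐ ω ∂P, MemLp (X ω) 2 vol) :
    ∃ ns : ℕ → ℕ, ∀ᵐ x ∂vol, ∀ᵐ ω ∂P,
      Tendsto (fun m => partialField X (ns m) ω x) atTop (𝓝 (X ω x)) := by
  have hae : ∀ᵐ ω ∂P, TendstoInMeasure vol (fun N => partialField X N ω) atTop (X ω) := by
    filter_upwards [hL2] with ω hω
    exact tendstoInMeasure_partialField hX hω
  have hmeas := tendstoInMeasure_prod (measurable_partialField hX) hX hae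
  obtain ⟨ns, -, hns⟩ := hmeas.exists_seq_tendsto_ae
  -- The factors are swapped so that the exceptional set of points `x` is chosen first,
  -- independently of `ω`.
  have hns' : ∀ᵐ q ∂vol.prod P,
      Tendsto (fun m => partialField X (ns m) q.2 q.1) atTop (𝓝 (X q.2 q.1)) :=
    (Measure.measurePreserving_swap (μ := vol) (ν := P)).quasiMeasurePreserving.ae hns
  exact ⟨ns, Measure.ae_ae_of_ae_prod hns'⟩

/-- Convergence in probability gives almost sure convergence along a sequence. A first extraction
handles `x`, a second one within it handles `φ x`, and dropping finitely many terms keeps the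
sequence in `G`. -/
theorem exists_seq_tendsto [IsProbabilityMeasure P]
    (hcont : ∀ x₀ : SU2, TendstoInMeasure P (fun x ω => X ω x) (𝓝 x₀) fun ω => X ω x₀)
    {G : Set SU2} (hG : Dense G) {φ : SU2 → SU2} (hφ : Continuous φ) (x : SU2) :
    ∃ y : ℕ → SU2, (∀ m, y m ∈ G) ∧
      (∀ᵐ ω ∂P, Tendsto (fun m => X ω (y m)) atTop (𝓝 (X ω x))) ∧
      ∀ᵐ ω ∂P, Tendsto (fun m => X ω (φ (y m))) atTop (𝓝 (X ω (φ x))) := by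
  have : (𝓝[G] x).NeBot := mem_closure_iff_nhdsWithin_neBot.mp (hG x)
  have h1 : TendstoInMeasure P (fun x ω => X ω x) (𝓝[G] x) fun ω => X ω x := fun ε hε =>
    (hcont x ε hε).mono_left nhdsWithin_le_nhds
  obtain ⟨y, hy, hyx⟩ := h1.exists_seq_tendsto_ae'
  have h2 : TendstoInMeasure P (fun m ω => X ω (φ (y m))) atTop fun ω => X ω (φ x) :=
    fun ε hε => (hcont (φ x) ε hε).comp
      ((hφ.tendsto x).comp (hy.mono_right nhdsWithin_le_nhds))
  obtain ⟨ms, hms, hmsx⟩ := h2.exists_seq_tendsto_ae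
  have hyG : ∀ᶠ m in atTop, y (ms m) ∈ G :=
    (hy.comp hms.tendsto_atTop).eventually self_mem_nhdsWithin
  obtain ⟨K, hK⟩ := eventually_atTop.mp hyG
  refine ⟨fun m => y (ms (m + K)), fun m => hK _ (by omega), ?_, ?_⟩
  · filter_upwards [hyx] with ω hω
    exact hω.comp (hms.tendsto_atTop.comp (tendsto_add_atTop_nat K))
  · filter_upwards [hmsx] with ω hω
    exact hω.comp (tendsto_add_atTop_nat K)

theorem identDistrib_eval_of_tendsto [IsProbabilityMeasure P] {Y Y' : ℕ → Ω → SU2 → ℂ}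
    {X' : Ω → SU2 → ℂ} {ι : Type*} [Countable ι] (x : ι → SU2)
    (hI : ∀ m, IdentDistrib (fun ω i => Y' m ω (x i)) (fun ω i => Y m ω (x i)) P P)
    (h' : ∀ i, ∀ᵐ ω ∂P, Tendsto (fun m => Y' m ω (x i)) atTop (𝓝 (X' ω (x i))))
    (h : ∀ i, ∀ᵐ ω ∂P, Tendsto (fun m => Y m ω (x i)) atTop (𝓝 (X ω (x i)))) :
    IdentDistrib (fun ω i => X' ω (x i)) (fun ω i => X ω (x i)) P P := by
  refine identDistrib_of_tendsto (Z := fun m ω i => Y' m ω (x i))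
    (Z' := fun m ω i => Y m ω (x i)) hI ?_ ?_
  · simp only [tendsto_pi_nhds]
    exact ae_all_iff.mpr h'
  · simp only [tendsto_pi_nhds]
    exact ae_all_iff.mpr h

theorem identDistrib_partialField {φ : SU2 → SU2}
    (hI : IdentDistrib (fun ω (q : ℕ × SU2) => degreeField X q.1 ω (φ q.2))
      (fun ω (q : ℕ × SU2) => degreeField X q.1 ω q.2) P P) (N : ℕ) {ι : Type*} (x : ι → SU2) :
    IdentDistrib (fun ω i => partialField X N ω (φ (x i))) (fun ω i => partialField X N ω (x i))
      P P := by
  have hm : Measurable fun (f : ℕ × SU2 → ℂ) (i : ι) => ∑ n ∈ Finset.range N, f (n, x i) :=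
    measurable_pi_lambda _ fun i => Finset.measurable_fun_sum _ fun n _ => measurable_pi_apply _
  exact hI.comp hm

theorem identDistrib_of_forall_finset {ι : Type*} {Y Z : Ω → ι → ℂ} [IsProbabilityMeasure P]
    (hY : Measurable Y) (hZ : Measurable Z)
    (h : ∀ I : Finset ι, IdentDistrib (fun ω (i : I) => Y ω i) (fun ω (i : I) => Z ω i) P P) :
    IdentDistrib Y Z P P := by
  have := (identDistrib_iff_forall_finset_identDistrib (X := fun i ω => Y ω i)
    (Y := fun i ω => Z ω i) hY.aemeasurable hZ.aemeasurable).mpr h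
  exact this

/-- Two successive limits: from partial sums to `X` at points where they converge almost surely both
there and at the image under `φ`, then from this dense set to arbitrary points. Only finitely many
points are treated at once, so countably many almost sure statements suffice. -/
theorem pointwise_of_degreeField [IsProbabilityMeasure P] (hX : Measurable (uncurry X))
    (hL2 : ∀ᵐ ω ∂P, MemLp (X ω) 2 vol) {φ : SU2 → SU2} (hφ : Continuous φ)
    (hφm : MeasurePreserving φ vol vol)
    (hcont : ∀ x₀ : SU2, TendstoInMeasure P (fun x ω => X ω x) (𝓝 x₀) fun ω => X ω x₀)
    (hI : IdentDistrib (fun ω (q : ℕ × SU2) => degreeField X q.1 ω (φ q.2))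
      (fun ω (q : ℕ × SU2) => degreeField X q.1 ω q.2) P P) :
    IdentDistrib (fun ω (q : Unit × SU2) => X ω (φ q.2))
      (fun ω (q : Unit × SU2) => X ω q.2) P P := by
  obtain ⟨ns, hns⟩ := exists_subseq_partialField hX hL2
  have hdense : Dense {x | (∀ᵐ ω ∂P, Tendsto (fun m => partialField X (ns m) ω x) atTop
      (𝓝 (X ω x))) ∧ ∀ᵐ ω ∂P, Tendsto (fun m => partialField X (ns m) ω (φ x)) atTop
      (𝓝 (X ω (φ x)))} :=
    Measure.dense_of_ae (hns.and (hφm.quasiMeasurePreserving.ae hns))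
  choose y hyG hy hy' using exists_seq_tendsto hcont hdense hφ
  have hpart (m : ℕ) (I : Finset (Unit × SU2)) : IdentDistrib (fun ω (q : I) => X ω (φ (y q.1.2 m)))
      (fun ω (q : I) => X ω (y q.1.2 m)) P P :=
    identDistrib_eval_of_tendsto (X := X) (X' := fun ω x => X ω (φ x))
      (Y := fun m => partialField X (ns m)) (Y' := fun m ω x => partialField X (ns m) ω (φ x))
      (fun q : I => y q.1.2 m) (fun k => identDistrib_partialField hI (ns k) _)
      (fun q => (hyG q.1.2 m).2) (fun q => (hyG q.1.2 m).1)
  have m1 : Measurable fun ω (q : Unit × SU2) => X ω (φ q.2) :=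
    measurable_pi_lambda _ fun q => hX.comp measurable_prodMk_right
  have m2 : Measurable fun ω (q : Unit × SU2) => X ω q.2 :=
    measurable_pi_lambda _ fun q => hX.comp measurable_prodMk_right
  refine identDistrib_of_forall_finset m1 m2 fun I => ?_
  refine identDistrib_of_tendsto (Z := fun m ω (q : I) => X ω (φ (y q.1.2 m)))
    (Z' := fun m ω (q : I) => X ω (y q.1.2 m)) (fun m => hpart m I) ?_ ?_
  · simp only [tendsto_pi_nhds]
    exact ae_all_iff.mpr fun q => hy' q.1.2
  · simp only [tendsto_pi_nhds]
    exact ae_all_iff.mpr fun q => hy q.1.2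

end

end HypersphereFields

end

noncomputable section

namespace HypersphereFields

/-! ### The matrix coefficients of a given degree -/

/-- The span of the Wigner functions of degree `n`. -/
def degreeSpace (n : ℕ) : Submodule ℂ (SU2 → ℂ) :=
  Submodule.span ℂ (Set.range fun p : Fin (n + 1) × Fin (n + 1) => wignerD n p.1 p.2)

theorem wignerD_mem_degreeSpace (n : ℕ) (j k : Fin (n + 1)) : wignerD n j k ∈ degreeSpace n :=
  Submodule.subset_span ⟨(j, k), rfl⟩

theorem mem_degreeSpace_of_eq_sum {n : ℕ} {f : SU2 → ℂ} (c : Fin (n + 1) → Fin (n + 1) → ℂ)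
    (hf : ∀ g, f g = ∑ j, ∑ k, c j k * wignerD n j k g) : f ∈ degreeSpace n := by
  have : f = ∑ j, ∑ k, c j k • wignerD n j k := by
    funext g
    simp [hf]
  rw [this]
  exact Submodule.sum_mem _ fun j _ => Submodule.sum_mem _ fun k _ =>
    Submodule.smul_mem _ _ (wignerD_mem_degreeSpace n j k)

theorem continuous_of_mem_degreeSpace {n : ℕ} {f : SU2 → ℂ} (hf : f ∈ degreeSpace n) :
    Continuous f := by
  induction hf using Submodule.span_induction with
  | mem f h =>
    obtain ⟨p, rfl⟩ := h
    exact continuous_wignerD n p.1 p.2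
  | zero => exact continuous_const
  | add f f' _ _ h h' => exact h.add h'
  | smul c f _ h => exact h.const_smul c

theorem conj_mem_degreeSpace {n : ℕ} {f : SU2 → ℂ} (hf : f ∈ degreeSpace n) :
    (fun g => conj (f g)) ∈ degreeSpace n := by
  induction hf using Submodule.span_induction with
  | mem f h =>
    obtain ⟨⟨j, k⟩, rfl⟩ := h
    refine mem_degreeSpace_of_eq_sum
      (fun m l => wignerD n j m weyl * wignerD n l k weyl⁻¹) fun g => ?_
    rw [conj_wignerD, Finset.sum_comm]
  | zero =>
    simp only [Pi.zero_apply, map_zero]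
    exact (degreeSpace n).zero_mem
  | add f f' _ _ h h' =>
    simp only [Pi.add_apply, map_add]
    exact (degreeSpace n).add_mem h h'
  | smul c f _ h =>
    simp only [Pi.smul_apply, smul_eq_mul, map_mul]
    exact (degreeSpace n).smul_mem (conj c) h

theorem integral_mul_eq_zero_of_mem_span {u : SU2 → ℂ} (hu : Continuous u) {n : ℕ}
    (h : ∀ j k, ∫ g, u g * wignerD n j k g ∂vol = 0) {f : SU2 → ℂ} (hf : f ∈ degreeSpace n) :
    ∫ g, u g * f g ∂vol = 0 := by
  have hi {v : SU2 → ℂ} (hv : v ∈ degreeSpace n) : Integrable (fun g => u g * v g) vol :=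
    (hu.mul (continuous_of_mem_degreeSpace hv)).integrable_vol
  induction hf using Submodule.span_induction with
  | mem f hf =>
    obtain ⟨p, rfl⟩ := hf
    exact h p.1 p.2
  | zero => simp
  | add v w hv hw h1 h2 =>
    simp only [Pi.add_apply, mul_add]
    rw [integral_add (hi hv) (hi hw), h1, h2, add_zero]
  | smul c v hv h1 =>
    simp only [Pi.smul_apply, smul_eq_mul, mul_left_comm _ c]
    rw [integral_const_mul, h1, mul_zero]

/-- Each degree is stable under conjugation, so orthogonality holds for the bilinear pairing too;
both the covariance and the pseudo-covariance need this form. -/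
theorem integral_mul_eq_zero_of_mem_degreeSpace {n n' : ℕ} (hn : n ≠ n') {f f' : SU2 → ℂ}
    (hf : f ∈ degreeSpace n) (hf' : f' ∈ degreeSpace n') : ∫ g, f g * f' g ∂vol = 0 := by
  refine integral_mul_eq_zero_of_mem_span (continuous_of_mem_degreeSpace hf) (fun j' k' => ?_) hf'
  have h0 : ∫ g, conj (wignerD n' j' k' g) * conj (f g) ∂vol = 0 :=
    integral_mul_eq_zero_of_mem_span
      (Complex.continuous_conj.comp (continuous_wignerD n' j' k'))
      (fun j k => integral_conj_wignerD_mul_of_ne hn.symm j' k' j k) (conj_mem_degreeSpace hf)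
  simp only [← map_mul] at h0
  rw [integral_conj, map_eq_zero] at h0
  simpa only [mul_comm] using h0

/-- By unitarity, inverting `g` replaces matrix entries by conjugates of entries of the same degree.
-/
theorem phi_inv_mul_mem_degreeSpace (n : ℕ) (j k : Fin (n + 1)) (x : SU2) :
    (fun g => phi n j k (g⁻¹ * x)) ∈ degreeSpace n := by
  have : (fun g => phi n j k (g⁻¹ * x)) = ∑ l, (phiFactor n * wignerD n l k x) •
      fun g => conj (wignerD n l j g) := by
    funext g
    rw [phi_eq, wignerD_inv_mul, Finset.mul_sum, Finset.sum_apply]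
    refine Finset.sum_congr rfl fun l _ => ?_
    simp only [Pi.smul_apply, smul_eq_mul]
    ring
  rw [this]
  exact Submodule.sum_mem _ fun l _ => Submodule.smul_mem _ _
    (conj_mem_degreeSpace (wignerD_mem_degreeSpace n l j))

theorem phi_mul_mem_degreeSpace (n : ℕ) (j k : Fin (n + 1)) (x : SU2) :
    (fun g => phi n j k (x * g)) ∈ degreeSpace n := by
  have : (fun g => phi n j k (x * g)) = ∑ l, (phiFactor n * wignerD n j l x) •
      wignerD n l k := by
    funext g
    rw [phi_eq, wignerD_mul, Finset.mul_sum, Finset.sum_apply]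
    refine Finset.sum_congr rfl fun l _ => ?_
    simp only [Pi.smul_apply, smul_eq_mul]
    ring
  rw [this]
  exact Submodule.sum_mem _ fun l _ => Submodule.smul_mem _ _ (wignerD_mem_degreeSpace n l k)

/-! ### Absence of correlation -/

theorem degreeField_eq_sum_prod {Ω : Type*} {X : Ω → SU2 → ℂ} (n : ℕ) (ω : Ω) (x : SU2) :
    degreeField X n ω x = ∑ p : Fin (n + 1) × Fin (n + 1),
      coef (X ω) ⟨⟨n, p.1⟩, p.2⟩ * phi n p.2 p.1 x := by
  rw [degreeField_eq, degSum, Fintype.sum_prod_type]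

section

variable {Ω : Type*} [MeasurableSpace Ω] {P : Measure Ω} {X : Ω → SU2 → ℂ}

theorem memLp_coef (hX : Measurable (uncurry X)) (hL2 : ∀ᵐ ω ∂P, MemLp (X ω) 2 vol)
    (hE : ∫⁻ ω, ∫⁻ x, ‖X ω x‖ₑ ^ 2 ∂vol ∂P < ∞) (i : Idx) :
    MemLp (fun ω => coef (X ω) i) 2 P := by
  refine ⟨((measurable_pi_apply i).comp (measurable_coef hX)).aestronglyMeasurable, ?_⟩
  rw [eLpNorm_lt_top_iff_lintegral_rpow_enorm_lt_top two_ne_zero ENNReal.ofNat_ne_top]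
  refine lt_of_le_of_lt (lintegral_mono_ae ?_) hE
  filter_upwards [hL2] with ω hω
  -- Cauchy-Schwarz against a unit vector bounds each coefficient by the norm of the path.
  have h1 : ‖coef (X ω) i‖ₑ ≤ eLpNorm (X ω) 2 vol := by
    rw [← inner_l2Class hω, ← eLpNorm_congr_ae hω.coeFn_toLp, ← Lp.enorm_def,
      ← l2Class_of_memLp hω, enorm_le_iff_norm_le]
    refine (norm_inner_le_norm _ _).trans ?_
    rw [norm_harmL2, one_mul]
  have h2 : eLpNorm (X ω) 2 vol ^ 2 = ∫⁻ x, ‖X ω x‖ₑ ^ 2 ∂vol := by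
    have := eLpNorm_nnreal_pow_eq_lintegral (f := X ω) (μ := vol) (p := 2) two_ne_zero
    simpa using this
  rw [← h2]
  simpa using pow_le_pow_left' h1 2

/-- The expectation is expanded into products of functions of `g` in two different degrees.
Integrating over `g` gives zero on one side and `c` times the positive total volume on the other. -/
theorem eq_zero_of_forall_integral_mul_eq {ι ι' : Type*} [Fintype ι] [Fintype ι'] {n n' : ℕ}
    (hn : n ≠ n') {a : ι → Ω → ℂ} {b : ι' → Ω → ℂ} (ha : ∀ i, MemLp (a i) 2 P)
    (hb : ∀ i, MemLp (b i) 2 P) {f : ι → SU2 → ℂ} {f' : ι' → SU2 → ℂ}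
    (hf : ∀ i, f i ∈ degreeSpace n) (hf' : ∀ i, f' i ∈ degreeSpace n') {c : ℂ}
    (h : ∀ g, ∫ ω, (∑ i, a i ω * f i g) * ∑ i, b i ω * f' i g ∂P = c) : c = 0 := by
  have hab (i : ι) (i' : ι') : Integrable (fun ω => a i ω * b i' ω) P :=
    (ha i).integrable_mul (hb i')
  have hg (g : SU2) : ∑ i, ∑ i', (∫ ω, a i ω * b i' ω ∂P) * (f i g * f' i' g) = c := by
    rw [← h g]
    have e (ω : Ω) : (∑ i, a i ω * f i g) * ∑ i, b i ω * f' i g =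
        ∑ i, ∑ i', (a i ω * b i' ω) * (f i g * f' i' g) := by
      rw [Finset.sum_mul_sum]
      exact Finset.sum_congr rfl fun i _ => Finset.sum_congr rfl fun i' _ => by ring
    simp only [e]
    rw [integral_finsetSum _ fun i _ => integrable_finsetSum _ fun i' _ => (hab i i').mul_const _]
    refine Finset.sum_congr rfl fun i _ => ?_
    rw [integral_finsetSum _ fun i' _ => (hab i i').mul_const _]
    exact Finset.sum_congr rfl fun i' _ => (integral_mul_const _ _).symm
  have hff (i : ι) (i' : ι') : Integrable (fun g => f i g * f' i' g) vol :=
    ((continuous_of_mem_degreeSpace (hf i)).mul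
      (continuous_of_mem_degreeSpace (hf' i'))).integrable_vol
  have h0 : ∫ _ : SU2, c ∂vol = 0 := by
    rw [show (fun _ : SU2 => c) = fun g => ∑ i, ∑ i', (∫ ω, a i ω * b i' ω ∂P) * (f i g * f' i' g)
      from funext fun g => (hg g).symm]
    rw [integral_finsetSum _ fun i _ => integrable_finsetSum _ fun i' _ => (hff i i').const_mul _]
    refine Finset.sum_eq_zero fun i _ => ?_
    rw [integral_finsetSum _ fun i' _ => (hff i i').const_mul _]
    refine Finset.sum_eq_zero fun i' _ => ?_
    rw [integral_const_mul, integral_mul_eq_zero_of_mem_degreeSpace hn (hf i) (hf' i'), mul_zero]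
  rw [integral_const, smul_eq_zero] at h0
  refine h0.resolve_left ?_
  change vol.real Set.univ ≠ 0
  exact (measureReal_ne_zero_iff).mpr (NeZero.ne _)

theorem memLp_degreeField (hX : Measurable (uncurry X)) (hL2 : ∀ᵐ ω ∂P, MemLp (X ω) 2 vol)
    (hE : ∫⁻ ω, ∫⁻ x, ‖X ω x‖ₑ ^ 2 ∂vol ∂P < ∞) (n : ℕ) (x : SU2) :
    MemLp (fun ω => degreeField X n ω x) 2 P := by
  simp only [degreeField_eq_sum_prod]
  exact memLp_finsetSum _ fun p _ => (memLp_coef hX hL2 hE _).mul_const _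

theorem degreeField_sub_integral [IsProbabilityMeasure P] (hX : Measurable (uncurry X))
    (hL2 : ∀ᵐ ω ∂P, MemLp (X ω) 2 vol) (hE : ∫⁻ ω, ∫⁻ x, ‖X ω x‖ₑ ^ 2 ∂vol ∂P < ∞)
    (n : ℕ) (ω : Ω) (x : SU2) :
    degreeField X n ω x - ∫ ω', degreeField X n ω' x ∂P = ∑ p : Fin (n + 1) × Fin (n + 1),
      (coef (X ω) ⟨⟨n, p.1⟩, p.2⟩ - ∫ ω', coef (X ω') ⟨⟨n, p.1⟩, p.2⟩ ∂P) * phi n p.2 p.1 x := by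
  simp only [degreeField_eq_sum_prod]
  rw [integral_finsetSum _ fun p _ =>
    ((memLp_coef hX hL2 hE _).integrable (by norm_num)).mul_const _, ← Finset.sum_sub_distrib]
  refine Finset.sum_congr rfl fun p _ => ?_
  rw [integral_mul_const, sub_mul]

/-- The map `Φ` stands for a left or a right translation; only its matrix coefficients in `g`
matter, so one argument covers both sides. -/
theorem uncorrelated_degreeField [IsProbabilityMeasure P] (hX : Measurable (uncurry X))
    (hL2 : ∀ᵐ ω ∂P, MemLp (X ω) 2 vol) (hE : ∫⁻ ω, ∫⁻ x, ‖X ω x‖ₑ ^ 2 ∂vol ∂P < ∞)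
    {Φ : SU2 → SU2 → SU2}
    (hΦ : ∀ (n : ℕ) (j k : Fin (n + 1)) (x : SU2), (fun g => phi n j k (Φ g x)) ∈ degreeSpace n)
    (hI : ∀ g, IdentDistrib (fun ω (q : ℕ × SU2) => degreeField X q.1 ω (Φ g q.2))
      (fun ω (q : ℕ × SU2) => degreeField X q.1 ω q.2) P P)
    {n n' : ℕ} (hn : n ≠ n') (x y : SU2) :
    Uncorrelated P (fun ω => degreeField X n ω x) (fun ω => degreeField X n' ω y) := by
  have hmean (n : ℕ) (x g : SU2) :
      ∫ ω, degreeField X n ω (Φ g x) ∂P = ∫ ω, degreeField X n ω x ∂P :=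
    ((hI g).comp (measurable_pi_apply (n, x))).integral_eq
  have ha (n : ℕ) (p : Fin (n + 1) × Fin (n + 1)) : MemLp (fun ω =>
      coef (X ω) ⟨⟨n, p.1⟩, p.2⟩ - ∫ ω', coef (X ω') ⟨⟨n, p.1⟩, p.2⟩ ∂P) 2 P :=
    (memLp_coef hX hL2 hE _).sub (memLp_const _)
  refine ⟨memLp_degreeField hX hL2 hE n x, memLp_degreeField hX hL2 hE n' y, ?_, ?_⟩
  · refine eq_zero_of_forall_integral_mul_eq hn (ha n) (fun p => (ha n' p).star)
      (fun p => hΦ n p.2 p.1 x) (fun p => conj_mem_degreeSpace (hΦ n' p.2 p.1 y)) fun g => ?_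
    have hm : Measurable fun f : ℕ × SU2 → ℂ => (f (n, x) - ∫ ω', degreeField X n ω' x ∂P) *
        conj (f (n', y) - ∫ ω', degreeField X n' ω' y ∂P) :=
      ((measurable_pi_apply _).sub_const _).mul
        (Complex.continuous_conj.measurable.comp ((measurable_pi_apply _).sub_const _))
    have := ((hI g).comp hm).integral_eq
    refine Eq.trans (integral_congr_ae (ae_of_all _ fun ω => ?_)) this
    simp only [comp_apply]
    -- The means are replaced by those at the translated points, where centring amounts to centring
    -- the coefficients.
    rw [← hmean n x g, ← hmean n' y g, degreeField_sub_integral hX hL2 hE,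
      degreeField_sub_integral hX hL2 hE]
    simp only [map_sum, map_mul, Pi.star_apply, RCLike.star_def]
  · refine eq_zero_of_forall_integral_mul_eq hn (ha n) (ha n')
      (fun p => hΦ n p.2 p.1 x) (fun p => hΦ n' p.2 p.1 y) fun g => ?_
    have hm : Measurable fun f : ℕ × SU2 → ℂ => (f (n, x) - ∫ ω', degreeField X n ω' x ∂P) *
        (f (n', y) - ∫ ω', degreeField X n' ω' y ∂P) :=
      ((measurable_pi_apply _).sub_const _).mul ((measurable_pi_apply _).sub_const _)
    have := ((hI g).comp hm).integral_eq
    refine Eq.trans (integral_congr_ae (ae_of_all _ fun ω => ?_)) this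
    simp only [comp_apply]
    rw [← hmean n x g, ← hmean n' y g, degreeField_sub_integral hX hL2 hE,
      degreeField_sub_integral hX hL2 hE]

/-! ### The kinds of invariance -/

theorem invariantInLaw_unit_iff (hL2 : ∀ᵐ ω ∂P, MemLp (X ω) 2 vol) (side : Side) :
    InvariantInLaw side P (fun _ : Unit => X) ↔ InvariantInLaw side P (degreeField X) := by
  refine forall₂_congr fun φ hφ => ?_
  obtain ⟨g, h, rfl⟩ := exists_eq_bi hφ
  exact (identDistrib_l2Class_iff hL2 g h).trans (identDistrib_l2Class_degreeField_iff hL2 g h).symm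

theorem invariantInLaw_degreeField_iff (hL2 : ∀ᵐ ω ∂P, MemLp (X ω) 2 vol) (side : Side) :
    InvariantInLaw side P (degreeField X) ↔ InvariantPointwise side P (degreeField X) := by
  refine forall₂_congr fun φ hφ => ?_
  obtain ⟨g, h, rfl⟩ := exists_eq_bi hφ
  exact (identDistrib_l2Class_degreeField_iff hL2 g h).trans
    (identDistrib_degreeField_iff hL2 g h).symm

theorem invariantPointwise_degreeField [IsProbabilityMeasure P] {side : Side}
    (hI : InvariantPointwise side P (fun _ : Unit => X)) (hX : Measurable (uncurry X))
    (hL2 : ∀ᵐ ω ∂P, MemLp (X ω) 2 vol) : InvariantPointwise side P (degreeField X) := by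
  intro φ hφ
  have h1 := hI φ hφ
  obtain ⟨g, h, rfl⟩ := exists_eq_bi hφ
  exact (identDistrib_degreeField_iff hL2 g h).mpr (coefInvariant_of_pointwise hX hL2 g h h1)

theorem invariantPointwise_of_degreeField [IsProbabilityMeasure P] {side : Side}
    (hI : InvariantPointwise side P (degreeField X)) (hX : Measurable (uncurry X))
    (hL2 : ∀ᵐ ω ∂P, MemLp (X ω) 2 vol)
    (hcont : ∀ x₀ : SU2, TendstoInMeasure P (fun x ω => X ω x) (𝓝 x₀) fun ω => X ω x₀) :
    InvariantPointwise side P (fun _ : Unit => X) := by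
  intro φ hφ
  have h1 := hI φ hφ
  obtain ⟨g, h, rfl⟩ := exists_eq_bi hφ
  exact pointwise_of_degreeField hX hL2 (biHomeo g h).continuous (measurePreserving_bi g h) hcont h1

theorem invariantPointwise_left_of_bi {ι : Type*} {Y : ι → Ω → SU2 → ℂ}
    (hI : InvariantPointwise .bi P Y) : InvariantPointwise .left P Y := by
  rintro φ ⟨g, rfl⟩
  exact hI (fun x => g⁻¹ * x) ⟨g, 1, by simp⟩

theorem uncorrelated_of_invariantPointwise [IsProbabilityMeasure P] {side : Side}
    (hI : InvariantPointwise side P (degreeField X)) (hX : Measurable (uncurry X))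
    (hL2 : ∀ᵐ ω ∂P, MemLp (X ω) 2 vol) (hE : ∫⁻ ω, ∫⁻ x, ‖X ω x‖ₑ ^ 2 ∂vol ∂P < ∞)
    {n n' : ℕ} (hn : n ≠ n') (x y : SU2) :
    Uncorrelated P (fun ω => degreeField X n ω x)
      (fun ω => degreeField X n' ω y) := by
  have hleft (hI : InvariantPointwise .left P (degreeField X)) :
      Uncorrelated P (fun ω => degreeField X n ω x) (fun ω => degreeField X n' ω y) := by
    have h (g : SU2) : IdentDistrib (fun ω (q : ℕ × SU2) => degreeField X q.1 ω (g⁻¹ * q.2))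
        (fun ω (q : ℕ × SU2) => degreeField X q.1 ω q.2) P P := hI (fun x => g⁻¹ * x) ⟨g, rfl⟩
    exact uncorrelated_degreeField (Φ := fun g x => g⁻¹ * x) hX hL2 hE
      phi_inv_mul_mem_degreeSpace h hn x y
  cases side with
  | left => exact hleft hI
  | right =>
    have h (g : SU2) : IdentDistrib (fun ω (q : ℕ × SU2) => degreeField X q.1 ω (q.2 * g))
        (fun ω (q : ℕ × SU2) => degreeField X q.1 ω q.2) P P := hI (fun x => x * g) ⟨g, rfl⟩
    exact uncorrelated_degreeField (Φ := fun g x => x * g) hX hL2 hE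
      phi_mul_mem_degreeSpace h hn x y
  | bi => exact hleft (invariantPointwise_left_of_bi hI)

end

end HypersphereFields

end

theorem mainTheorem9 {Ω : Type*} [MeasurableSpace Ω] (P : Measure Ω) [IsProbabilityMeasure P]
    (X : Ω → SU2 → ℂ) (hX : Measurable (uncurry X)) (hL2 : ∀ᵐ ω ∂P, MemLp (X ω) 2 vol) :
    -- the decomposition and its convergence
    (∀ (n : ℕ) (j k : Fin (n + 1)), Measurable (fourierCoeff X n j k)) ∧
    (∀ᵐ ω ∂P, Tendsto
      (fun F : Finset (Σ n : ℕ, Fin (n + 1)) =>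
        eLpNorm (fun x => X ω x - ∑ p ∈ F, columnField X p.1 p.2 ω x) 2 vol) atTop (𝓝 0)) ∧
    -- the nature of the terms
    (∀ (n : ℕ) (k : Fin (n + 1)),
      Measurable (uncurry (columnField X n k)) ∧
      (∀ ω, IsHarmonicPolynomial n (columnField X n k ω)) ∧
      (∀ ω, IsLaplaceEigenfunction ((n / 2 : ℝ) * (n / 2 + 1)) (columnField X n k ω)) ∧
      ∃ σ : Ω → (p : RiemannSphere) → SpinFibre (2 * (k : ℤ) - n) p,
        IsRandomSection (2 * (k : ℤ) - n) σ ∧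
        ∀ ω, IsPullback (2 * (k : ℤ) - n) (σ ω) (columnField X n k ω)) ∧
    -- left, right and bi-invariance
    ∀ side : Side,
      (InvariantInLaw side P (fun _ : Unit => X) ↔ InvariantInLaw side P (degreeField X)) ∧
      (InvariantInLaw side P (degreeField X) ↔ InvariantPointwise side P (degreeField X)) ∧
      (InvariantPointwise side P (fun _ : Unit => X) →
        InvariantPointwise side P (degreeField X)) ∧
      ((∀ x₀ : SU2, TendstoInMeasure P (fun x ω => X ω x) (𝓝 x₀) (fun ω => X ω x₀)) →
        InvariantPointwise side P (degreeField X) →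
          InvariantPointwise side P (fun _ : Unit => X)) ∧
      (InvariantInLaw side P (fun _ : Unit => X) →
        ∫⁻ ω, ∫⁻ x, ‖X ω x‖ₑ ^ 2 ∂vol ∂P < ∞ →
        ∀ n n' : ℕ, n ≠ n' → ∀ x y : SU2,
          Uncorrelated P (fun ω => degreeField X n ω x) (fun ω => degreeField X n' ω y)) := by
  refine ⟨measurable_fourierCoeff hX, ?_, fun n k => ⟨measurable_columnField hX n k,
    isHarmonicPolynomial_columnField X n k, fun ω =>
      (isHarmonicPolynomial_columnField X n k ω).isLaplaceEigenfunction, ?_⟩, fun side =>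
    ⟨invariantInLaw_unit_iff hL2 side, invariantInLaw_degreeField_iff hL2 side,
      fun hI => invariantPointwise_degreeField hI hX hL2, fun hc hI => invariantPointwise_of_degreeField hI hX hL2 hc,
      fun hI hE n n' hn x y => uncorrelated_of_invariantPointwise
        ((invariantInLaw_degreeField_iff hL2 side).mp ((invariantInLaw_unit_iff hL2 side).mp hI))
        hX hL2 hE hn x y⟩⟩
  · filter_upwards [hL2] with ω hω
    exact tendsto_eLpNorm_sub_columns hω
  · exact ⟨fun ω => sectionOf _ (columnField X n k ω),
      isRandomSection_sectionOf (measurable_columnField hX n k) (isHarmonicPolynomial_columnField X n k)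
        (isEquivariant_columnField X n k),
      fun ω => isPullback_sectionOf (isEquivariant_columnField X n k ω)⟩
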